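/- Let $N=2n$ with $n\ge 1$. Let $\mathcal M_N$ be the quotient of the algebra of complex upper triangular matrices $M=(M_{ij})_{i,j\in\mathbb Z}$ with $M_{i+N,j+N}=M_{ij}$ by the ideal generated by $S^N$, $S=(\delta_{i,j-1})$; its coordinates are the entries $M_{ij}$ with $i\le j<i+N$. Put $\varepsilon_i=1$ if $i\equiv 1,\dots,n \pmod N$, $\varepsilon_i=-1$ otherwise, and $M^\dagger_{ij}=\varepsilon_i\varepsilon_j M_{N-j+1,N-i+1}$. Let $\mathcal M_N^{\mathrm i}$ (resp. $\mathcal M_N^{\mathrm c}$) be the subspace of $\mathcal M_N$ given by $M=-M^\dagger$ (resp. $M=M^\dagger$). For $\mathrm a\in\{\mathrm i,\mathrm c\}$ the Brauer loop scheme is the closed subscheme $$E^{\mathrm a}_N=\{M\in\mathcal M^{\mathrm a}_N \mid M^2=0 \text{ in } \mathcal M_N,\ M_{ii}=0\ \forall i\}$$ of the affine space $\mathcal M_N^{\mathrm a}$. A link pattern $\pi$ of type $\mathrm i$ is an involution of $\{1,\dots,n\}$ whose fixed points are regarded as connected to the boundary; one of type $\mathrm c$ is an involution of $\{1,\dots,n\}$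 with at most one fixed point. It defines an involution $\tilde\pi$ of $\{1,\dots,N\}$ commuting with $j\mapsto N-j+1$: for $j\le n$, $\tilde\pi(j)=\pi(j)$, except that $\tilde\pi(j)=N-j+1$ if $\mathrm a=\mathrm i$ and $\pi(j)=j$. Let $\pi^{\mathrm a}_<$ be the strictly upper triangular $N\times N$ matrix whose entry at $(i,j)$, $i<j$, is: for $\mathrm a=\mathrm i$, $-\delta_{i,\tilde\pi(j)}$ if $n<i$ and $\delta_{i,\tilde\pi(j)}$ otherwise; for $\mathrm a=\mathrm c$, $0$ if $i+j=N+1$, $-\delta_{i,\tilde\pi(j)}$ if $N-j+1<i\le n$, and $\delta_{i,\tilde\pi(j)}$ otherwise. Let $J=(\delta_{i+j,N+1}\varepsilon_i)_{1\le i,j\le N}$ and let $\tilde B_N$ be the group of invertible upper triangular $N\times N$ matrices $B$ with $B^{-1}=J^{-1}B^TJ$. Let $F^{\mathrm a}_\pi$ be the set of points $M\in E^{\mathrm a}_N$ whose submatrix $(M_{ij})_{1\le i,j\le N}$ is conjugate to $\pi^{\mathrm a}_<$ by an element of $\tilde B_N$, and let $E^{\mathrm a}_\pi$ be the Zariski closure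 of $F^{\mathrm a}_\pi$. Theorem. For $\mathrm a\in\{\mathrm i,\mathrm c\}$ and every link pattern $\pi$ of type $\mathrm a$, $E^{\mathrm a}_\pi$ is a top-dimensional irreducible component of $E^{\mathrm a}_N$ (that is, an irreducible component with $\dim E^{\mathrm a}_\pi=\dim E^{\mathrm a}_N$), and $E^{\mathrm a}_N$ is generically reduced along it: the local ring of $E^{\mathrm a}_N$ at the generic point of $E^{\mathrm a}_\pi$ is reduced. Moreover, at every point of some dense open subset of $E^{\mathrm a}_\pi$ the Zariski tangent space of $E^{\mathrm a}_N$ has dimension $\dim E^{\mathrm a}_\pi$. -/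

import Mathlib

noncomputable section

namespace BrauerLoop

/-- The two boundary types of type `Ĉ` considered here: identified (`i`) and closed (`c`). -/
inductive BoundaryType where
  | identified : BoundaryType
  | closed : BoundaryType

/-- The sign `s` such that the matrices of boundary type `a` satisfy `M = s M†`. -/
def BoundaryType.sign : BoundaryType → ℤ
  | .identified => -1
  | .closed => 1

/-- Positions in a fundamental domain of the infinite strip, where `N = 2n`. The position `(r, c)`,
with `r, c` counted from `0`, is that of the entry `M_{r+1,c+1}` if `r ≤ c` and of the entry
`M_{r+1,c+1+N}` if `c < r`. So `Coord n → K` is the space `𝓜_N` over `K`. -/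
abbrev Coord (n : ℕ) : Type := Fin (2 * n) × Fin (2 * n)

/-- The index in `{1, …, N}` (stored as an element of `Fin N`, counted from `0`) congruent to the
integer `i` modulo `N = 2n`. -/
def residue {n : ℕ} (hn : 0 < n) (i : ℤ) : Fin (2 * n) :=
  ⟨((i - 1) % (2 * (n : ℤ))).toNat, by
    have h1 := Int.emod_nonneg (i - 1) (show (2 * (n : ℤ)) ≠ 0 by omega)
    have h2 := Int.emod_lt_of_pos (i - 1) (show (0 : ℤ) < 2 * (n : ℤ) by omega)
    omega⟩

/-- The entries `M_{ij}`, `i, j ∈ ℤ`, of the `(N,N)`-periodic upper triangular infinite matrix with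
prescribed entries on the strip `i ≤ j < i + N`. Entries with `j ≥ i + N`, which are irrelevant
modulo `⟨S^N⟩`, are taken to be `0`. -/
def entry {n : ℕ} {K : Type*} [Zero K] (x : Coord n → K) (i j : ℤ) : K :=
  if h : 0 ≤ j - i ∧ j - i < 2 * (n : ℤ) then
    x (residue (by omega) i, residue (by omega) j)
  else 0

/-- `ε_i = 1` if `i = 1, …, n` modulo `N = 2n`, and `ε_i = -1` if `i = n+1, …, N` modulo `N`. -/
def eps (n : ℕ) (i : ℤ) : ℤ :=
  if (i - 1) % (2 * (n : ℤ)) < n then 1 else -1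

/-- The entries of the adjoint: `M†_{ij} = ε_i ε_j M_{N-j+1,N-i+1}`. -/
def daggerEntry {n : ℕ} {K : Type*} [CommRing K] (x : Coord n → K) (i j : ℤ) : K :=
  ((eps n i * eps n j : ℤ) : K) * entry x (2 * (n : ℤ) - j + 1) (2 * (n : ℤ) - i + 1)

/-- The entries of `M²` for an infinite upper triangular matrix `M`. -/
def sqEntry {n : ℕ} {K : Type*} [CommRing K] (x : Coord n → K) (i j : ℤ) : K :=
  ∑ k ∈ Finset.Icc i j, entry x i k * entry x k j

/-- The left-hand sides of the equations of the Brauer loop scheme `E^a_N`, `N = 2n`: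
`M ∈ 𝓜^a_N` (that is, `M = -M†` or `M = M†`), `M² = 0` modulo `⟨S^N⟩`, and `M_{ii} = 0`. -/
def equations {n : ℕ} {K : Type*} [CommRing K] (a : BoundaryType) (x : Coord n → K) : Set K :=
  {p | ∃ i j : ℤ, p = entry x i j - (a.sign : K) * daggerEntry x i j} ∪
  {p | ∃ i j : ℤ, j < i + 2 * (n : ℤ) ∧ p = sqEntry x i j} ∪
  {p | ∃ i : ℤ, p = entry x i i}

/-- The ideal of the closed subscheme `E^a_N` of the affine space `𝓜_N`, generated by the
equations above evaluated at the generic matrix. Thus `E^a_N` is the spectrum of the quotient of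
the polynomial ring by this ideal; the ideal is not replaced by its radical. -/
def brauerIdeal (a : BoundaryType) (n : ℕ) : Ideal (MvPolynomial (Coord n) ℂ) :=
  Ideal.span (equations a (fun c : Coord n => (MvPolynomial.X c : MvPolynomial (Coord n) ℂ)))

/-- The finite symplectic form `J_{ij} = δ_{i+j,N+1} ε_i`, `1 ≤ i, j ≤ N = 2n`. -/
def formJ (n : ℕ) : Matrix (Fin (2 * n)) (Fin (2 * n)) ℂ :=
  Matrix.of fun i j =>
    if (i : ℕ) + 1 + ((j : ℕ) + 1) = 2 * n + 1 then ((eps n ((i : ℤ) + 1) : ℤ) : ℂ) else 0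

/-- The Borel subgroup of upper triangular invertible `B` with `B⁻¹ = B† = J⁻¹ Bᵀ J`. -/
def borel (n : ℕ) : Set (GL (Fin (2 * n)) ℂ) :=
  {B | (∀ i j : Fin (2 * n), j < i → (B : Matrix (Fin (2 * n)) (Fin (2 * n)) ℂ) i j = 0) ∧
    ((B⁻¹ : GL (Fin (2 * n)) ℂ) : Matrix (Fin (2 * n)) (Fin (2 * n)) ℂ) =
      (formJ n)⁻¹ * (B : Matrix (Fin (2 * n)) (Fin (2 * n)) ℂ).transpose * formJ n}

/-- The upper triangular part `U` of `M = (U, Λ)`: rows and columns `1, …, N` of `M`. -/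
def upperPart {n : ℕ} (x : Coord n → ℂ) : Matrix (Fin (2 * n)) (Fin (2 * n)) ℂ :=
  Matrix.of fun i j => entry x ((i : ℤ) + 1) ((j : ℤ) + 1)

/-- Brauer link patterns on `n` points (stored as `Fin n`): an involution pairs two points joined by
a chord. For identified boundaries the points fixed by the involution are those connected to the
boundary, and there may be any number of them. For closed boundaries a fixed point is an unpaired
point, and at most one is allowed (so there is none if `n` is even, and one if `n` is odd). -/
structure LinkPattern (a : BoundaryType) (n : ℕ) where
  toFun : Fin n → Fin n
  involutive : Function.Involutive toFun
  unpaired : a = BoundaryType.closed → ∀ i j : Fin n, toFun i = i → toFun j = j → i = j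

/-- The partner, in the periodic diagram, of a point `j` of the first half. -/
def LinkPattern.half {a : BoundaryType} {n : ℕ} (π : LinkPattern a n) (j : Fin n) : Fin (2 * n) :=
  match a with
  | .identified =>
      if π.toFun j = j then (Fin.castLE (by omega) j : Fin (2 * n)).rev
      else Fin.castLE (by omega) (π.toFun j)
  | .closed => Fin.castLE (by omega) (π.toFun j)

/-- The periodic diagram of a link pattern, an involution of `{1, …, N}` (stored as `Fin N`)
symmetric under `j ↦ N - j + 1` (which is `Fin.rev`): a chord `j – k` also gives the mirror chord,
and a point `j` connected to the boundary is joined to its mirror image. -/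
def LinkPattern.periodic {a : BoundaryType} {n : ℕ} (π : LinkPattern a n) (j : Fin (2 * n)) :
    Fin (2 * n) :=
  if h : (j : ℕ) < n then π.half ⟨j, h⟩
  else (π.half ⟨(j.rev : ℕ), by rw [Fin.val_rev]; omega⟩).rev

/-- The strictly upper triangular matrix `π^a_<` attached to an involution `p` of `{1, …, N}`. With
`i, j` counted from `1`, its entry is `0` if `j ≤ i`. Otherwise, for identified boundaries it is
`-δ_{i,p(j)}` if `n < i` and `δ_{i,p(j)}` if not; for closed boundaries it is `0` if `i + j = N+1`,
`-δ_{i,p(j)}` if `N - j + 1 < i ≤ n`, and `δ_{i,p(j)}` in the other cases. -/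
def strictUpper (a : BoundaryType) {n : ℕ} (p : Fin (2 * n) → Fin (2 * n)) :
    Matrix (Fin (2 * n)) (Fin (2 * n)) ℂ :=
  Matrix.of fun i j =>
    if j ≤ i then 0
    else match a with
      | .identified =>
          if i = p j then (if n < (i : ℕ) + 1 then -1 else 1) else 0
      | .closed =>
          if (i : ℕ) + 1 + ((j : ℕ) + 1) = 2 * n + 1 then 0
          else if i = p j then
            (if 2 * n + 1 < (i : ℕ) + 1 + ((j : ℕ) + 1) ∧ (i : ℕ) + 1 ≤ n then -1 else 1)
          else 0

/-- The set `F^a_π` of the points `M = (U, Λ)` of `E^a_N` such that `U` is conjugate to `π^a_<`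
under the Borel subgroup. -/
def orbitStratum {a : BoundaryType} {n : ℕ} (π : LinkPattern a n) : Set (Coord n → ℂ) :=
  {x | x ∈ MvPolynomial.zeroLocus ℂ (brauerIdeal a n) ∧
    ∃ B ∈ borel n,
      (B : Matrix (Fin (2 * n)) (Fin (2 * n)) ℂ) * upperPart x *
        ((B⁻¹ : GL (Fin (2 * n)) ℂ) : Matrix (Fin (2 * n)) (Fin (2 * n)) ℂ) =
      strictUpper a π.periodic}

/-- The ideal of the reduced closed subvariety `E^a_π`, the Zariski closure of `F^a_π`. -/
def componentIdeal {a : BoundaryType} {n : ℕ} (π : LinkPattern a n) :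
    Ideal (MvPolynomial (Coord n) ℂ) :=
  MvPolynomial.vanishingIdeal ℂ (orbitStratum π)

/-- The closed subscheme of `Spec R` with ideal `I` is generically reduced along its irreducible
closed subset with prime ideal `P`: the local ring of `Spec (R ⧸ I)` at the generic point of that
subset is reduced. -/
def GenericallyReducedAlong {R : Type*} [CommRing R] (I P : Ideal R) : Prop :=
  ∃ _ : (P.map (Ideal.Quotient.mk I)).IsPrime,
    IsReduced (Localization.AtPrime (P.map (Ideal.Quotient.mk I)))

/-- The Zariski tangent space at the point `x` of the closed subscheme of affine space with
ideal `I`. -/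
def tangentSpace {σ : Type*} [Fintype σ] (I : Ideal (MvPolynomial σ ℂ)) (x : σ → ℂ) :
    Submodule ℂ (σ → ℂ) where
  carrier := {v | ∀ p ∈ I, ∑ c, MvPolynomial.eval x (MvPolynomial.pderiv c p) * v c = 0}
  zero_mem' := by
    intro p _
    simp
  add_mem' := by
    intro v w hv hw p hp
    simp only [Pi.add_apply, mul_add, Finset.sum_add_distrib, hv p hp, hw p hp, add_zero]
  smul_mem' := by
    intro r v hv p hp
    have h := hv p hp
    simp only [Pi.smul_apply, smul_eq_mul]
    rw [← mul_zero r, ← h, Finset.mul_sum]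
    exact Finset.sum_congr rfl fun c _ => by ring

end BrauerLoop

end

/-! Write a point as M = (U, Λ), where U is the strictly upper triangular N×N block and Λ, stored as
a strictly lower triangular matrix, holds the entries of the strip beyond column N. The equations
then say that U and Λ are of type a, that U² = 0, and that UΛ + ΛU is upper triangular
(`equations_eq_zero_iff`, `isSolution_iff`). So the scheme lies over the square-zero matrices U with
linear fibres, and the symplectic Borel group acts on it.

Let d(U) be the dimension of the commutators of U with the Borel Lie algebra (tangent directions of
the orbit) plus the dimension of the fibre over U. By trace duality the fibre is the annihilator of
the anticommutators of U with strictly upper triangular self-adjoint matrices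
(`ChordData.finrank_fibre_add`). Hence d(U) is a constant depending only on a and N, plus the excess
of commutators over anticommutators. For U monomial on the chords of an involution, an entrywise
weighting turns commutators into anticommutators, and the excess is at most the number of chord ends
in the first half, with equality for link patterns (`ChordData.finrank_orbitTangent_le`,
`ChordData.le_finrank_orbitTangent`). Link patterns have as many such ends as possible: no point is
free in the identified case, and in the closed case parity allows no improvement on one free point.
So d := d(π_<) is the maximum over monomial U.

It remains to feed `component_criterion`, which needs four facts.

Every irreducible closed subset of the scheme has dimension at most d (`ringKrullDim_le`). Over its
function field K the matrix U has a monomial normal form with entries 0 and 1 (`exists_chordData`).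
A derivation E of K kills that form, so E(U) is the commutator of U with an upper triangular matrix.
Derivations with E(U) = 0 move only Λ, inside the fibre. The values of derivations on the
coordinates span a space whose dimension is that of the subset.

The closure of the stratum has dimension at least d (`LinkPattern.le_ringKrullDim`): the orbit map
(X, Λ) ↦ exp(X)·(π_<, Λ) has a derivative of rank at least d at the origin.

The closure is irreducible (`LinkPattern.isPrime_componentIdeal`): any two points of the stratum lie
on an entire curve contained in it.

At one explicit point of the stratum the tangent space has dimension at most d
(`finrank_tangentSpace_le`). There Λ is the transposed pattern with coefficients that separate the
mirror pairs of chords, so the linearised equations force the upper part of a tangent vector to be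
tangent to the orbit.

Semicontinuity carries the last bound to the generic point. Together with the first two facts it
shows that every derivation of the local ring into its residue field kills the maximal ideal, so the
local ring is a field. -/

open MvPolynomial

namespace BrauerLoop

noncomputable section

/-! ### Krull dimension and differentials -/

section Dimension

/-- Integral extensions preserve the Krull dimension. -/
theorem ringKrullDim_eq_of_isIntegral {R S : Type*} [CommRing R] [CommRing S] [Algebra R S]
    [Algebra.IsIntegral R S] [FaithfulSMul R S] : ringKrullDim S = ringKrullDim R := by
  apply le_antisymm
  · refine Order.krullDim_le_of_strictMono (PrimeSpectrum.comap (algebraMap R S)) ?_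
    intro a b hab
    exact Ideal.IsIntegral.comap_lt_comap (R := R) (I := a.asIdeal) (J := b.asIdeal) hab
  · refine iSup_le fun l => ?_
    -- Lying over provides a prime above the head of the chain, and going up lifts the rest.
    obtain ⟨Q, hQ, hQ2⟩ := (Ideal.nonempty_primesOver (S := S) l.head.asIdeal)
    obtain ⟨L, hL, -⟩ := Ideal.exists_ltSeries_of_hasGoingUp (S := S) l Q
    rw [← hL]
    exact le_iSup (fun p : LTSeries (PrimeSpectrum S) => ((p.length : ℕ∞) : WithBot ℕ∞)) L

/-- The Krull dimension of a finitely generated domain over a field of characteristic zero is the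
dimension of the module of differentials of its fraction field, and it bounds the number of
algebraically independent elements. -/
theorem exists_ringKrullDim_eq_finrank_kaehler (k A K : Type*) [Field k] [CharZero k] [CommRing A]
    [IsDomain A] [Algebra k A] [Algebra.FiniteType k A] [Field K] [Algebra A K]
    [IsFractionRing A K] [Algebra k K] [IsScalarTower k A K] :
    ∃ s : ℕ, ringKrullDim A = s ∧ Module.finrank K (Ω[K⁄k]) = s ∧ Module.Finite K (Ω[K⁄k]) ∧
      ∀ (d : ℕ) (g : MvPolynomial (Fin d) k →ₐ[k] A), Function.Injective g → d ≤ s := by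
  -- Noether normalisation. In characteristic zero the fraction field is separable over the rational
  -- function field, hence formally étale over the polynomial ring, so the differentials of the s
  -- variables form a basis.
  obtain ⟨s, g, hg, hi⟩ := exists_integral_inj_algHom_of_fg k A
  let _ : Algebra (MvPolynomial (Fin s) k) A := g.toRingHom.toAlgebra
  let _ : Algebra (MvPolynomial (Fin s) k) K := ((algebraMap A K).comp g.toRingHom).toAlgebra
  have : IsScalarTower (MvPolynomial (Fin s) k) A K := IsScalarTower.of_algebraMap_eq fun _ => rfl
  have : IsScalarTower k (MvPolynomial (Fin s) k) A :=
    IsScalarTower.of_algebraMap_eq fun r => (g.commutes r).symm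
  have : IsScalarTower k (MvPolynomial (Fin s) k) K :=
    IsScalarTower.of_algebraMap_eq fun r => by
      rw [IsScalarTower.algebraMap_apply k A K]
      exact congrArg (algebraMap A K) (g.commutes r).symm
  have : Algebra.IsIntegral (MvPolynomial (Fin s) k) A := ⟨hi⟩
  have : FaithfulSMul (MvPolynomial (Fin s) k) A := (faithfulSMul_iff_algebraMap_injective _ _).2 hg
  have : FaithfulSMul (MvPolynomial (Fin s) k) K :=
    (faithfulSMul_iff_algebraMap_injective _ _).2
      ((IsFractionRing.injective A K).comp hg)
  let F := FractionRing (MvPolynomial (Fin s) k)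
  let _ : Algebra F K := FractionRing.liftAlgebra _ _
  have : IsScalarTower (MvPolynomial (Fin s) k) F K := FractionRing.isScalarTower_liftAlgebra _ _
  have : Algebra.IsAlgebraic (MvPolynomial (Fin s) k) A := inferInstance
  have : Algebra.IsAlgebraic A K := IsLocalization.isAlgebraic K (nonZeroDivisors A)
  have : Algebra.IsAlgebraic (MvPolynomial (Fin s) k) K := Algebra.IsAlgebraic.trans _ A K
  have : Algebra.IsAlgebraic F K := (IsFractionRing.comap_isAlgebraic_iff (A := MvPolynomial (Fin s) k)).1 inferInstance
  have : CharZero F := charZero_of_injective_algebraMap (algebraMap k F).injective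
  have : Algebra.FormallyEtale F K := Algebra.FormallyEtale.of_isSeparable F K
  have : Algebra.FormallyEtale (MvPolynomial (Fin s) k) F :=
    Algebra.FormallyEtale.of_isLocalization (nonZeroDivisors (MvPolynomial (Fin s) k))
  have : Algebra.FormallyEtale (MvPolynomial (Fin s) k) K := Algebra.FormallyEtale.comp _ F K
  let e := KaehlerDifferential.tensorKaehlerEquivOfFormallyEtale k (MvPolynomial (Fin s) k) K
  let b := (KaehlerDifferential.mvPolynomialBasis k (Fin s)).baseChange K
  refine ⟨s, ?_, ?_, ?_, ?_⟩
  · rw [ringKrullDim_eq_of_isIntegral (R := MvPolynomial (Fin s) k)]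
    simp
  · rw [← e.finrank_eq, Module.finrank_eq_card_basis b]
    simp
  · exact Module.Finite.of_basis (b.map e)
  · intro d g' hg'
    have h1 := lift_trdeg_le_of_injective g' hg'
    have h2 := lift_trdeg_add_eq k (MvPolynomial (Fin s) k) A
    rw [trdeg_eq_zero (R := MvPolynomial (Fin s) k) (A := A)] at h2
    simp only [MvPolynomial.trdeg_of_isDomain, Cardinal.mk_fin, Cardinal.lift_natCast,
      Cardinal.lift_zero, add_zero] at h1 h2
    rw [Cardinal.nat_le_lift_iff] at h1
    rw [eq_comm, Cardinal.lift_eq_nat_iff] at h2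
    rw [h2] at h1
    exact_mod_cast h1

end Dimension

/-! ### Tangent spaces and their semicontinuity -/

section Tangent
variable {σ : Type*} [Fintype σ]

/-- The Zariski tangent space of a closed subscheme of complex affine space at a point with
coordinates in an extension field of `ℂ`. -/
def tangentAt (I : Ideal (MvPolynomial σ ℂ)) {K : Type*} [Field K] [Algebra ℂ K] (y : σ → K) :
    Submodule K (σ → K) where
  carrier := {v | ∀ p ∈ I, ∑ c, aeval y (pderiv c p) * v c = 0}
  zero_mem' := by simp
  add_mem' := by
    intro v w hv hw p hp
    simp only [Pi.add_apply, mul_add, Finset.sum_add_distrib, hv p hp, hw p hp, add_zero]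
  smul_mem' := by
    intro r v hv p hp
    have h := hv p hp
    simp only [Pi.smul_apply, smul_eq_mul]
    rw [← mul_zero r, ← h, Finset.mul_sum]
    exact Finset.sum_congr rfl fun c _ => by ring

theorem tangentAt_complex (I : Ideal (MvPolynomial σ ℂ)) (x : σ → ℂ) :
    tangentAt I x = tangentSpace I x := by
  ext v
  simp [tangentAt, tangentSpace]

/-- The gradient of a polynomial at a point. -/
def gradient (x : σ → ℂ) : MvPolynomial σ ℂ →ₗ[ℂ] (σ → ℂ) :=
  LinearMap.pi fun c => (aeval x).toLinearMap.comp (pderiv c).toLinearMap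

/-- Upper semicontinuity of the dimension of the tangent space. -/
theorem exists_eval_ne_zero_finrank_tangentAt_le (I : Ideal (MvPolynomial σ ℂ)) (x : σ → ℂ) (e : ℕ)
    (he : Module.finrank ℂ (tangentSpace I x) ≤ e) :
    ∃ g : MvPolynomial σ ℂ, eval x g ≠ 0 ∧ ∀ (K : Type) [Field K] [Algebra ℂ K] (y : σ → K),
      aeval y g ≠ 0 → Module.finrank K (tangentAt I y) ≤ e := by
  classical
  let G : Submodule ℂ (σ → ℂ) := (I.restrictScalars ℂ).map (gradient x)
  let b := Module.finBasis ℂ G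
  have hb : ∀ i, ∃ p ∈ I, gradient x p = b i := fun i => by
    obtain ⟨p, hp, h⟩ := (b i).2
    exact ⟨p, hp, h⟩
  choose p hpI hp using hb
  have hli : LinearIndependent ℂ (fun i => (b i : σ → ℂ)) :=
    b.linearIndependent.map' G.subtype (Submodule.ker_subtype G)
  let B := Module.Basis.sumExtend hli
  let E := Module.Basis.sumExtendIndex hli
  have hfin : Finite (Fin (Module.finrank ℂ G) ⊕ E) :=
    @Finite.of_fintype _ (FiniteDimensional.fintypeBasisIndex B)
  have : Finite E := Finite.of_injective (Sum.inr : E → Fin (Module.finrank ℂ G) ⊕ E) Sum.inr_injective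
  have : Fintype E := Fintype.ofFinite E
  have hcard : Fintype.card σ = Fintype.card (Fin (Module.finrank ℂ G) ⊕ E) := by
    rw [← Module.finrank_eq_card_basis B, Module.finrank_fintype_fun_eq_card]
  let ε : σ ≃ Fin (Module.finrank ℂ G) ⊕ E := Fintype.equivOfCardEq hcard
  -- Gradients of elements of `I` that are a basis at `x`, completed by constant rows. Where the
  -- determinant of this polynomial matrix is nonzero, a tangent vector is determined by its
  -- products with the constant rows, and there are at most `e` of those.
  let row : Fin (Module.finrank ℂ G) ⊕ E → σ → MvPolynomial σ ℂ :=
    Sum.elim (fun i c => pderiv c (p i)) (fun j c => C (B (Sum.inr j) c))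
  let M : Matrix σ σ (MvPolynomial σ ℂ) := Matrix.of fun a c => row (ε a) c
  have hM : ∀ {K : Type} [Field K] [Algebra ℂ K] (y : σ → K), aeval y M.det =
      (M.map (aeval y)).det := fun y => by
    rw [← AlgHom.mapMatrix_apply, AlgHom.map_det]
  have hrow : M.map (aeval x) = Matrix.of fun a => B (ε a) := by
    ext a c
    simp only [Matrix.map_apply, M, Matrix.of_apply, row]
    rcases h : ε a with i | j
    · have := congrFun (hp i) c
      have hB : B (Sum.inl i) = b i := by
        simp only [B, Module.Basis.sumExtend, Module.Basis.reindex_apply, Module.Basis.extend_apply_self]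
        rfl
      simpa [gradient, hB] using this
    · simp
  have hE : Fintype.card E ≤ e := by
    refine le_trans ?_ he
    let A : Matrix (Fin (Module.finrank ℂ G)) σ ℂ := Matrix.of fun i => (b i : σ → ℂ)
    have h1 : A.rank = Module.finrank ℂ G := by
      simpa using LinearIndependent.rank_matrix (M := A) hli
    have h2 := LinearMap.finrank_range_add_finrank_ker A.mulVecLin
    rw [Module.finrank_fintype_fun_eq_card, hcard, Fintype.card_sum, Fintype.card_fin] at h2
    have h3 : LinearMap.ker A.mulVecLin ≤ tangentSpace I x := by
      intro v hv q hq
      have hq' : gradient x q ∈ G := ⟨q, hq, rfl⟩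
      have h4 := b.sum_repr ⟨_, hq'⟩
      have h5 : gradient x q = ∑ i, b.repr ⟨_, hq'⟩ i • (b i : σ → ℂ) := by
        have := congrArg G.subtype h4
        simp only [map_sum, map_smul, Submodule.subtype_apply] at this
        exact this.symm
      have h6 : gradient x q ⬝ᵥ v = 0 := by
        rw [h5, sum_dotProduct]
        refine Finset.sum_eq_zero fun i _ => ?_
        have : (b i : σ → ℂ) ⬝ᵥ v = 0 := congrFun (LinearMap.mem_ker.1 hv) i
        rw [smul_dotProduct, this, smul_zero]
      simpa [gradient, dotProduct, coe_aeval_eq_eval] using h6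
    have h4 := Submodule.finrank_mono h3
    have h5 : Module.finrank ℂ (LinearMap.range A.mulVecLin) = Module.finrank ℂ G := h1
    omega
  refine ⟨M.det, ?_, ?_⟩
  · have h1 : eval x M.det = _ := hM x
    rw [h1, hrow]
    have h2 : LinearIndependent ℂ (fun a => B (ε a)) := B.linearIndependent.comp _ ε.injective
    have h3 := (Matrix.linearIndependent_rows_iff_isUnit (A := Matrix.of fun a => B (ε a))).1 h2
    exact ((Matrix.isUnit_iff_isUnit_det _).1 h3).ne_zero
  · intro K _ _ y hy
    rw [hM] at hy
    let f : tangentAt I y →ₗ[K] (E → K) :=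
      (LinearMap.pi fun j => ∑ c, algebraMap ℂ K (B (Sum.inr j) c) • LinearMap.proj c).comp
        (tangentAt I y).subtype
    have hf : Function.Injective f := by
      rw [injective_iff_map_eq_zero]
      rintro ⟨v, hv⟩ hfv
      have h0 : (M.map (aeval y)).mulVec v = 0 := by
        ext a
        simp only [Matrix.mulVec, dotProduct, Matrix.map_apply, M, Matrix.of_apply, row,
          Pi.zero_apply]
        rcases h : ε a with i | j
        · exact hv (p i) (hpI i)
        · have := congrFun hfv j
          simpa [f, LinearMap.sum_apply, ← Algebra.smul_def] using this
      exact Subtype.ext (Matrix.eq_zero_of_mulVec_eq_zero hy h0)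
    refine (LinearMap.finrank_le_finrank_of_injective hf).trans ?_
    rw [Module.finrank_fintype_fun_eq_card]
    exact hE
end Tangent

/-! ### Derivations of the function field -/

section Derivations
variable {σ : Type*} [Fintype σ]

/-- A `ℂ`-linear map satisfying the Leibniz rule is the derivative along a vector. -/
theorem eq_sum_pderiv_mul {K : Type*} [Field K] [Algebra ℂ K] (y : σ → K)
    (D : MvPolynomial σ ℂ →ₗ[ℂ] K)
    (hD : ∀ p q, D (p * q) = aeval y p * D q + aeval y q * D p) (p : MvPolynomial σ ℂ) :
    D p = ∑ c, aeval y (pderiv c p) * D (X c) := by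
  classical
  have h1 : D 1 = 0 := by
    have := hD 1 1
    simpa using this
  induction p using MvPolynomial.induction_on with
  | C a =>
    have : (C a : MvPolynomial σ ℂ) = a • 1 := by rw [smul_eq_C_mul, mul_one]
    simp [this, h1]
  | add p q hp hq => simp [hp, hq, add_mul, Finset.sum_add_distrib]
  | mul_X p i hp =>
    simp only [hD, hp, Derivation.leibniz, pderiv_X, smul_eq_mul, map_add, map_mul, aeval_X,
      add_mul, Finset.sum_add_distrib]
    congr 1
    · rw [Finset.sum_eq_single i]
      · simp
      · intro c _ hc
        simp [hc.symm]
      · simp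
    · rw [Finset.mul_sum]
      exact Finset.sum_congr rfl fun c _ => by ring

/-- The values on the coordinate functions of the derivations of the function field of an affine
variety form a space of dimension equal to the Krull dimension of the variety. -/
theorem exists_submodule_derivations (A K : Type*) [CommRing A]
    [IsDomain A] [Algebra ℂ A] [Field K] [Algebra A K]
    [IsFractionRing A K] [Algebra ℂ K] [IsScalarTower ℂ A K] (π : MvPolynomial σ ℂ →ₐ[ℂ] A)
    (hπ : Function.Surjective π) :
    ∃ s : ℕ, ringKrullDim A = s ∧
      (∀ (d : ℕ) (g : MvPolynomial (Fin d) ℂ →ₐ[ℂ] A), Function.Injective g → d ≤ s) ∧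
      ∃ W : Submodule K (σ → K), Module.finrank K W = s ∧ ∀ v ∈ W, ∃ D : Derivation ℂ K K,
        ∀ c, v c = D (algebraMap A K (π (X c))) := by
  have : Algebra.FiniteType ℂ A := Algebra.FiniteType.of_surjective π hπ
  obtain ⟨s, h1, h2, h3, h4⟩ := exists_ringKrullDim_eq_finrank_kaehler ℂ A K
  let E : Derivation ℂ K K →ₗ[K] (σ → K) :=
    { toFun := fun D c => D (algebraMap A K (π (X c)))
      map_add' := fun _ _ => rfl
      map_smul' := fun _ _ => rfl }
  refine ⟨s, h1, h4, LinearMap.range E, ?_, ?_⟩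
  · have hE : Function.Injective E := by
      rw [injective_iff_map_eq_zero]
      intro D hD
      have hA : ∀ p : MvPolynomial σ ℂ, D (algebraMap A K (π p)) = 0 := by
        intro p
        induction p using MvPolynomial.induction_on with
        | C a =>
          have : algebraMap A K (π (C a)) = algebraMap ℂ K a := by
            rw [← algebraMap_eq, AlgHom.commutes, ← IsScalarTower.algebraMap_apply]
          rw [this, Derivation.map_algebraMap]
        | add p q hp hq => simp [hp, hq]
        | mul_X p i hp =>
          have : D (algebraMap A K (π (X i))) = 0 := congrFun hD i
          simp [hp, this]
      ext k
      obtain ⟨a, b, hb, rfl⟩ := IsFractionRing.div_surjective (A := A) k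
      obtain ⟨p, rfl⟩ := hπ a
      obtain ⟨q, rfl⟩ := hπ b
      simp [Derivation.leibniz_div, hA]
    rw [LinearMap.finrank_range_of_inj hE, ← (KaehlerDifferential.linearMapEquivDerivation ℂ K).finrank_eq]
    rw [← h2]
    exact Subspace.dual_finrank_eq
  · rintro _ ⟨D, rfl⟩
    exact ⟨D, fun c => rfl⟩

end Derivations

/-! ### Generically reduced components of the top dimension -/

section GenericallyReduced

/-- A Noetherian local `ℂ`-algebra whose maximal ideal is killed by all derivations to the residue
field is reduced. -/
theorem isReduced_of_derivations (S : Type*) [CommRing S] [IsLocalRing S]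
    [IsNoetherianRing S] [Algebra ℂ S] [Algebra.EssFiniteType ℂ S]
    (h : ∀ D : S →ₗ[ℂ] IsLocalRing.ResidueField S,
      (∀ a b, D (a * b) = IsLocalRing.residue S a * D b + IsLocalRing.residue S b * D a) →
      ∀ a ∈ IsLocalRing.maximalIdeal S, D a = 0) :
    IsReduced S := by
  suffices hm : IsLocalRing.maximalIdeal S = ⊥ by
    refine isReduced_of_injective (IsLocalRing.residue S) ?_
    rw [RingHom.injective_iff_ker_eq_bot, IsLocalRing.ker_residue, hm]
  let m := IsLocalRing.maximalIdeal S
  let K := IsLocalRing.ResidueField S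
  by_contra hne
  -- Nakayama: a nonzero maximal ideal is not contained in its square.
  have hsq : ¬ m ≤ m ^ 2 := by
    intro hle
    apply hne
    refine Submodule.eq_bot_of_le_smul_of_le_jacobson_bot m m (IsNoetherian.noetherian m) ?_ ?_
    · rw [smul_eq_mul, ← sq]; exact hle
    · exact (IsLocalRing.jacobson_eq_maximalIdeal ⊥ bot_ne_top).ge
  obtain ⟨a0, ha0, ha0'⟩ := SetLike.not_le_iff_exists.1 hsq
  let B := S ⧸ m ^ 2
  let q : S →ₐ[ℂ] B := Ideal.Quotient.mkₐ ℂ _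
  let ρ : S →ₐ[ℂ] K := IsScalarTower.toAlgHom ℂ S K
  have hρ : ∀ a, ρ a = 0 ↔ a ∈ m := fun a => IsLocalRing.residue_eq_zero_iff a
  let γ : B →ₐ[ℂ] K := Ideal.Quotient.liftₐ (m ^ 2) ρ fun a ha =>
    (hρ a).2 (Ideal.pow_le_self two_ne_zero ha)
  have hγq : ∀ a, γ (q a) = ρ a := fun a => rfl
  have hγ : Function.Surjective γ := by
    intro k
    obtain ⟨a, ha⟩ := IsLocalRing.residue_surjective k
    exact ⟨q a, ha⟩
  have hker : ∀ b b', γ b = 0 → γ b' = 0 → b * b' = 0 := by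
    intro b b' hb hb'
    obtain ⟨a, rfl⟩ := Ideal.Quotient.mk_surjective b
    obtain ⟨a', rfl⟩ := Ideal.Quotient.mk_surjective b'
    rw [← map_mul]
    refine Ideal.Quotient.eq_zero_iff_mem.2 ?_
    rw [sq]
    exact Ideal.mul_mem_mul ((hρ a).1 hb) ((hρ a').1 hb')
  have hnil : IsNilpotent (RingHom.ker (γ : B →+* K)) := by
    refine ⟨2, ?_⟩
    have h0 : RingHom.ker (γ : B →+* K) * RingHom.ker (γ : B →+* K) ≤ ⊥ :=
      Ideal.mul_le.2 fun b hb b' hb' => hker b b' hb hb'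
    exact (pow_two (RingHom.ker (γ : B →+* K))).trans (le_bot_iff.1 h0)
  have : Algebra.EssFiniteType ℂ K := Algebra.EssFiniteType.comp ℂ S K
  have : Algebra.FormallySmooth ℂ K := inferInstance
  -- The residue field is formally smooth over ℂ and `γ` has square-zero kernel, so `γ` splits. The
  -- splitting makes S/m² a vector space over the residue field.
  let sec : K →ₐ[ℂ] B := Algebra.FormallySmooth.liftOfSurjective (AlgHom.id ℂ K) γ hγ hnil
  have hsec : ∀ k, γ (sec k) = k := fun k =>
    Algebra.FormallySmooth.liftOfSurjective_apply (AlgHom.id ℂ K) γ hγ hnil k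
  let _ : Algebra K B := sec.toRingHom.toAlgebra
  have hsmul : ∀ (k : K) (b : B), k • b = sec k * b := fun k b => rfl
  have hqa0 : q a0 ≠ 0 := fun h => ha0' (Ideal.Quotient.eq_zero_iff_mem.1 h)
  obtain ⟨l, hl⟩ : ∃ l : B →ₗ[K] K, l (q a0) ≠ 0 := by
    by_contra hcon
    push Not at hcon
    exact hqa0 ((Module.forall_dual_apply_eq_zero_iff K (q a0)).1 hcon)
  -- The difference between the quotient map and the splitting takes values in m/m², where products
  -- vanish, so it is a derivation. Composed with `l` it is a derivation into the residue field that
  -- is nonzero at `a0`.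
  let δ : S →ₗ[ℂ] B := q.toLinearMap - (sec.comp ρ).toLinearMap
  have hδ : ∀ a, δ a = q a - sec (ρ a) := fun a => rfl
  have hmul : ∀ a b, δ (a * b) = ρ a • δ b + ρ b • δ a := by
    intro a b
    have h0 : δ a * δ b = 0 := hker _ _ (by simp [hδ, hγq, hsec]) (by simp [hδ, hγq, hsec])
    simp only [hδ, hsmul, map_mul] at h0 ⊢
    linear_combination h0
  have : IsScalarTower ℂ K B := IsScalarTower.of_algebraMap_eq fun r => (sec.commutes r).symm
  have := h ((l.restrictScalars ℂ).comp δ) (fun a b => by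
    simp only [LinearMap.comp_apply, hmul, map_add, LinearMap.restrictScalars_apply, map_smul,
      smul_eq_mul]
    rfl) a0 ha0
  apply hl
  have h0 : ρ a0 = 0 := (hρ a0).2 ha0
  simpa [hδ, h0] using this

/-- At the generic point y of `P` the derivations of the function field give a space W of tangent
vectors to `P` of dimension at least `d`, while the tangent space of `I` has dimension at most `d`.
So W is that whole tangent space: every derivation of `S` into its residue field is tangent to `P`,
hence kills the maximal ideal, and `isReduced_of_derivations` applies. The rings are kept abstract;
the intended case is a quotient of the polynomial ring localised at the image of `P`. -/
theorem isReduced_of_tangent {σ : Type} [Fintype σ]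
    (I P : Ideal (MvPolynomial σ ℂ)) (hIP : I ≤ P) (d : ℕ)
    (g : MvPolynomial σ ℂ) (hgP : g ∉ P)
    (hg : ∀ (K : Type) [Field K] [Algebra ℂ K] (y : σ → K),
      aeval y g ≠ 0 → Module.finrank K (tangentAt I y) ≤ d)
    (R : Type) [CommRing R] [Algebra ℂ R] (κ : MvPolynomial σ ℂ →ₐ[ℂ] R)
    (hκ : Function.Surjective κ) (hκI : ∀ p ∈ I, κ p = 0)
    (𝔭 : Ideal R) [𝔭.IsPrime] (h𝔭' : ∀ p, κ p ∈ 𝔭 ↔ p ∈ P)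
    (hd : (d : WithBot ℕ∞) ≤ ringKrullDim (R ⧸ 𝔭))
    (S : Type) [CommRing S] [IsLocalRing S] [Algebra ℂ S] [Algebra R S]
    [IsScalarTower ℂ R S] [IsLocalization.AtPrime S 𝔭]
    [Algebra (R ⧸ 𝔭) (IsLocalRing.ResidueField S)]
    [IsFractionRing (R ⧸ 𝔭) (IsLocalRing.ResidueField S)]
    [IsScalarTower ℂ (R ⧸ 𝔭) (IsLocalRing.ResidueField S)]
    (hcomp : ∀ b : R, algebraMap (R ⧸ 𝔭) (IsLocalRing.ResidueField S) (Ideal.Quotient.mk 𝔭 b) =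
      IsLocalRing.residue S (algebraMap R S b)) :
    IsReduced S := by
  have : Algebra.FiniteType ℂ R := Algebra.FiniteType.of_surjective κ hκ
  have : IsNoetherianRing R := isNoetherianRing_of_surjective _ _ κ.toRingHom hκ
  have : IsNoetherianRing S := IsLocalization.isNoetherianRing 𝔭.primeCompl S inferInstance
  have : Algebra.EssFiniteType ℂ S :=
    have : Algebra.EssFiniteType R S :=
      Algebra.EssFiniteType.of_isLocalization S 𝔭.primeCompl
    Algebra.EssFiniteType.comp ℂ R S
  refine isReduced_of_derivations S ?_
  intro D hD
  let K := IsLocalRing.ResidueField S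
  let ρ : S →ₐ[ℂ] K := IsScalarTower.toAlgHom ℂ _ K
  let τ : MvPolynomial σ ℂ →ₐ[ℂ] S :=
    (IsScalarTower.toAlgHom ℂ R _).comp (κ)
  let y : σ → K := fun c => ρ (τ (X c))
  have hy : ∀ p, aeval y p = ρ (τ p) := fun p => by
    have : aeval y = ρ.comp τ := by
      ext c
      simp [y]
    rw [this]; rfl
  have hyP : ∀ p, aeval y p = 0 ↔ p ∈ P := by
    intro p
    rw [hy]
    have h1 : ρ (τ p) = 0 ↔ τ p ∈ IsLocalRing.maximalIdeal S :=
      IsLocalRing.residue_eq_zero_iff _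
    rw [h1]
    exact (IsLocalization.AtPrime.to_map_mem_maximal_iff S 𝔭 _).trans (h𝔭' p)
  have key : ∀ p, D (τ p) = ∑ c, aeval y (pderiv c p) * D (τ (X c)) := by
    refine eq_sum_pderiv_mul y (D.comp τ.toLinearMap) ?_
    intro p p'
    simp only [LinearMap.comp_apply, AlgHom.toLinearMap_apply, map_mul, hD, hy]
    rfl
  have hvI : (fun c => D (τ (X c))) ∈ tangentAt I y := by
    intro p hp
    rw [← key]
    have : τ p = 0 := by
      simp only [τ, AlgHom.comp_apply, hκI p hp, map_zero]
    rw [this, map_zero]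
  obtain ⟨s, h1, -, W, hW, hWD⟩ := exists_submodule_derivations (σ := σ)
    (R ⧸ 𝔭) K ((Ideal.Quotient.mkₐ ℂ 𝔭).comp (κ))
    (Ideal.Quotient.mk_surjective.comp hκ)
  have hds : d ≤ s := by
    rw [h1] at hd
    exact_mod_cast hd
  have hWP : W ≤ tangentAt P y := by
    intro v hv p hp
    obtain ⟨E, hE⟩ := hWD v hv
    have h2 := eq_sum_pderiv_mul y (E.toLinearMap.comp (aeval y).toLinearMap) (fun p p' => by
      simp) p
    have h3 : ∀ c, v c = E (y c) := fun c => (hE c).trans (congrArg E (hcomp _))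
    simp only [LinearMap.comp_apply, AlgHom.toLinearMap_apply, aeval_X, Derivation.coeFn_coe, (hyP p).2 hp, map_zero, ← h3] at h2
    exact h2.symm
  have hPI : tangentAt P y ≤ tangentAt I y := fun v hv p hp => hv p (hIP hp)
  have heq : W = tangentAt I y := by
    apply Submodule.eq_of_le_of_finrank_le (hWP.trans hPI)
    rw [hW]
    exact (hg K y fun h => hgP ((hyP g).1 h)).trans hds
  have hvP : (fun c => D (τ (X c))) ∈ tangentAt P y := hWP (heq ▸ hvI)
  intro a ha
  -- An element of the maximal ideal is a fraction p / r with p in `P` and r outside. The Leibniz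
  -- rule for its product with r reduces the claim to D(p) = 0.
  obtain ⟨⟨b, t⟩, hbt⟩ := IsLocalization.surj 𝔭.primeCompl a
  obtain ⟨p, rfl⟩ := hκ b
  obtain ⟨r, hr⟩ := hκ (t : R)
  have hbt' : a * τ r = τ p := by
    rw [← hr] at hbt
    exact hbt
  have ha0 : ρ a = 0 := (IsLocalRing.residue_eq_zero_iff a).2 ha
  have hp : p ∈ P := by
    rw [← hyP, hy, ← hbt', map_mul, ha0, zero_mul]
  have hrP : r ∉ P := by
    rw [← h𝔭', hr]
    exact t.2
  have h2 : D (τ p) = 0 := by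
    rw [key]
    exact hvP p hp
  rw [← hbt', hD] at h2
  have h3 : IsLocalRing.residue _ a = 0 := ha0
  rw [h3, zero_mul, zero_add] at h2
  refine (mul_eq_zero.1 h2).resolve_left fun h => hrP ?_
  rw [← hyP, hy]
  exact h

/-- A closed subscheme of complex affine space whose tangent spaces are generically along an
irreducible subset of dimension at most that of the subset is generically reduced along it. -/
theorem generically_reduced_of_tangent {σ : Type} [Fintype σ]
    (I P : Ideal (MvPolynomial σ ℂ)) [P.IsPrime] (hIP : I ≤ P) (d : ℕ)
    (hd : (d : WithBot ℕ∞) ≤ ringKrullDim (MvPolynomial σ ℂ ⧸ P))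
    (g : MvPolynomial σ ℂ) (hgP : g ∉ P)
    (hg : ∀ (K : Type) [Field K] [Algebra ℂ K] (y : σ → K),
      aeval y g ≠ 0 → Module.finrank K (tangentAt I y) ≤ d) :
    GenericallyReducedAlong I P := by
  have hprime : (P.map (Ideal.Quotient.mk I)).IsPrime :=
    Ideal.map_isPrime_of_surjective Ideal.Quotient.mk_surjective (by rwa [Ideal.mk_ker])
  refine ⟨hprime, ?_⟩
  have h := isReduced_of_tangent I P hIP d g hgP hg (MvPolynomial σ ℂ ⧸ I)
    (Ideal.Quotient.mkₐ ℂ I) Ideal.Quotient.mk_surjective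
    (fun p hp => Ideal.Quotient.eq_zero_iff_mem.2 hp) (P.map (Ideal.Quotient.mk I))
    (fun p => Ideal.mem_quotient_iff_mem hIP)
    (hd.trans (ringKrullDim_eq_of_ringEquiv (DoubleQuot.quotQuotEquivQuotOfLE hIP)).ge)
    (Localization.AtPrime (P.map (Ideal.Quotient.mk I))) (fun b => rfl)
  exact h

/-- The generic point of an irreducible affine variety, and the derivations of its function
field. -/
theorem exists_generic_point {σ : Type} [Fintype σ] (Q : Ideal (MvPolynomial σ ℂ)) [Q.IsPrime] :
    ∃ (K : Type) (_ : Field K) (_ : Algebra ℂ K) (y : σ → K) (s : ℕ) (W : Submodule K (σ → K)),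
      (∀ p : MvPolynomial σ ℂ, aeval y p = 0 ↔ p ∈ Q) ∧
      ringKrullDim (MvPolynomial σ ℂ ⧸ Q) = s ∧ Module.finrank K W = s ∧
      ∀ v ∈ W, ∃ D : Derivation ℂ K K, ∀ c, v c = D (y c) := by
  let A := MvPolynomial σ ℂ ⧸ Q
  let K := FractionRing A
  obtain ⟨s, h1, -, W, hW, hWD⟩ := exists_submodule_derivations (σ := σ) A K
    (Ideal.Quotient.mkₐ ℂ Q) Ideal.Quotient.mk_surjective
  refine ⟨K, inferInstance, inferInstance,
    fun c => algebraMap A K (Ideal.Quotient.mkₐ ℂ Q (X c)), s, W, fun p => ?_, h1, hW, hWD⟩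
  have h2 : aeval (fun c => algebraMap A K (Ideal.Quotient.mkₐ ℂ Q (X c))) =
      (IsScalarTower.toAlgHom ℂ A K).comp (Ideal.Quotient.mkₐ ℂ Q) := by
    ext c
    simp [K]
    rfl
  rw [h2]
  change algebraMap A K (Ideal.Quotient.mk Q p) = 0 ↔ _
  rw [map_eq_zero_iff _ (IsFractionRing.injective A K), Ideal.Quotient.eq_zero_iff_mem]

/-- Apply `D` to the relation p(y) = 0 and use the chain rule. -/
theorem derivation_mem_tangentAt {σ : Type} [Fintype σ] {K : Type*} [Field K] [Algebra ℂ K]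
    (I : Ideal (MvPolynomial σ ℂ)) (y : σ → K) (hI : ∀ p ∈ I, aeval y p = 0)
    (D : Derivation ℂ K K) : (fun c => D (y c)) ∈ tangentAt I y := by
  intro p hp
  have h2 := eq_sum_pderiv_mul y (D.toLinearMap.comp (aeval y).toLinearMap) (fun p p' => by
    simp) p
  simp only [LinearMap.comp_apply, AlgHom.toLinearMap_apply, aeval_X, Derivation.coeFn_coe,
    hI p hp, map_zero] at h2
  exact h2.symm

/-- By semicontinuity the tangent space at `x` is at least as large as the one at the generic point,
and the latter contains the values of the derivations of the function field. -/
theorem le_finrank_tangentSpace {σ : Type} [Fintype σ] (I P : Ideal (MvPolynomial σ ℂ))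
    [P.IsPrime] (hIP : I ≤ P) (d : ℕ) (hd : (d : WithBot ℕ∞) ≤ ringKrullDim (MvPolynomial σ ℂ ⧸ P))
    (x : σ → ℂ) (hx : x ∈ zeroLocus ℂ P) : d ≤ Module.finrank ℂ (tangentSpace I x) := by
  obtain ⟨f, hf, hfT⟩ := exists_eval_ne_zero_finrank_tangentAt_le I x _ le_rfl
  obtain ⟨K, _, _, y, s, W, hy, hs, hW, hWD⟩ := exists_generic_point P
  have hle : W ≤ tangentAt I y := by
    intro v hv
    obtain ⟨D, hD⟩ := hWD v hv
    rw [show v = fun c => D (y c) from funext hD]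
    exact derivation_mem_tangentAt I y (fun p hp => (hy p).2 (hIP hp)) D
  have h1 : d ≤ s := by
    rw [hs] at hd
    exact_mod_cast hd
  rw [← hW] at h1
  refine h1.trans ((Submodule.finrank_mono hle).trans (hfT K y fun h => hf ?_))
  exact hx f ((hy f).1 h)

/-- Geometric criterion for the closure of a set of points to be a generically reduced
top-dimensional component of an affine scheme. -/
theorem component_criterion {σ : Type} [Fintype σ] (I : Ideal (MvPolynomial σ ℂ))
    (F : Set (σ → ℂ)) (hF : F ⊆ zeroLocus ℂ I) (hprime : (vanishingIdeal ℂ F).IsPrime) (d : ℕ)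
    (h1 : (d : WithBot ℕ∞) ≤ ringKrullDim (MvPolynomial σ ℂ ⧸ vanishingIdeal ℂ F))
    (h2 : ∀ Q : Ideal (MvPolynomial σ ℂ), Q.IsPrime → I ≤ Q →
      ringKrullDim (MvPolynomial σ ℂ ⧸ Q) ≤ d)
    (x₀ : σ → ℂ) (hx₀ : x₀ ∈ F) (h3 : Module.finrank ℂ (tangentSpace I x₀) ≤ d) :
    vanishingIdeal ℂ F ∈ I.minimalPrimes ∧
    ringKrullDim (MvPolynomial σ ℂ ⧸ vanishingIdeal ℂ F) = ringKrullDim (MvPolynomial σ ℂ ⧸ I) ∧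
    GenericallyReducedAlong I (vanishingIdeal ℂ F) ∧
    ∃ f : MvPolynomial σ ℂ, f ∉ vanishingIdeal ℂ F ∧
      ∀ x ∈ zeroLocus ℂ (vanishingIdeal ℂ F), eval x f ≠ 0 →
        ((Module.finrank ℂ (tangentSpace I x) : ℕ) : WithBot ℕ∞) =
          ringKrullDim (MvPolynomial σ ℂ ⧸ vanishingIdeal ℂ F) := by
  have hIP : I ≤ vanishingIdeal ℂ F := by
    intro p hp
    exact mem_vanishingIdeal_iff.2 fun x hx => hF hx p hp
  have hdim : ringKrullDim (MvPolynomial σ ℂ ⧸ vanishingIdeal ℂ F) = d :=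
    le_antisymm (h2 _ hprime hIP) h1
  have hnot : ∀ (f : MvPolynomial σ ℂ) (x), x ∈ zeroLocus ℂ (vanishingIdeal ℂ F) →
      eval x f ≠ 0 → f ∉ vanishingIdeal ℂ F := by
    intro f x hx hf hfF
    exact hf (hx f hfF)
  obtain ⟨g, hg, hgT⟩ := exists_eval_ne_zero_finrank_tangentAt_le I x₀ d h3
  have hgP : g ∉ vanishingIdeal ℂ F := by
    intro h
    exact hg (mem_vanishingIdeal_iff.1 h x₀ hx₀)
  refine ⟨⟨⟨hprime, hIP⟩, ?_⟩, ?_, generically_reduced_of_tangent I _ hIP d h1 g hgP hgT,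
    g, hgP, ?_⟩
  -- A prime over `I` strictly below the vanishing ideal would have a quotient of dimension at least
  -- d + 1.
  · rintro Q ⟨hQ, hIQ⟩ hQP
    by_contra hcon
    have hlt : Q < vanishingIdeal ℂ F := lt_of_le_not_ge hQP hcon
    obtain ⟨r, hr, hrQ⟩ := SetLike.exists_of_lt hlt
    have h5 := ringKrullDim_succ_le_of_surjective (Ideal.Quotient.factor hQP)
      (Ideal.Quotient.factor_surjective hQP) (r := Ideal.Quotient.mk Q r)
      (mem_nonZeroDivisors_of_ne_zero fun h => hrQ (Ideal.Quotient.eq_zero_iff_mem.1 h))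
      (by simpa using Ideal.Quotient.eq_zero_iff_mem.2 hr)
    rw [hdim] at h5
    have h6 := h5.trans (h2 Q hQ hIQ)
    norm_cast at h6
    omega
  · apply le_antisymm
    · exact ringKrullDim_le_of_surjective (Ideal.Quotient.factor hIP)
        (Ideal.Quotient.factor_surjective hIP)
    · rw [hdim, ringKrullDim_quotient]
      -- A chain of primes over `I` lies over its smallest member, whose quotient has dimension at
      -- most `d`.
      refine iSup_le fun l => ?_
      refine le_trans ?_ (h2 l.head.1.asIdeal l.head.1.isPrime l.head.2)
      rw [ringKrullDim_quotient]
      exact le_iSup (fun p : LTSeries (PrimeSpectrum.zeroLocus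
          (l.head.1.asIdeal : Set (MvPolynomial σ ℂ))) => ((p.length : ℕ∞) : WithBot ℕ∞))
        { length := l.length
          toFun := fun i => ⟨(l i).1, LTSeries.head_le l i⟩
          step := fun i => l.step i }
  · intro x hx hxg
    rw [hdim]
    congr 1
    apply le_antisymm
    · rw [← tangentAt_complex]
      exact hgT ℂ x hxg
    · exact le_finrank_tangentSpace I _ hIP d h1 x hx

end GenericallyReduced

/-! ### Triangular and self-adjoint matrices, commutators and anticommutators -/

section Linear
variable {N : ℕ} {K : Type*} [Field K]

/-- The matrices `X` with `Xᵀ J = s J X`, that is `X† = s X` for the adjoint defined by `J`. -/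
def selfAdj (J : Matrix (Fin N) (Fin N) K) (s : K) : Submodule K (Matrix (Fin N) (Fin N) K) where
  carrier := {X | X.transpose * J = s • (J * X)}
  zero_mem' := by simp
  add_mem' := by
    intro X Y hX hY
    simp only [Set.mem_ofPred_eq, Matrix.transpose_add, add_mul, mul_add, smul_add] at *
    rw [hX, hY]
  smul_mem' := by
    intro r X hX
    simp only [Set.mem_ofPred_eq, Matrix.transpose_smul, smul_mul_assoc, mul_smul_comm] at *
    rw [hX, smul_comm]

variable (N K) in
/-- Upper triangular matrices. -/
def upperTri : Submodule K (Matrix (Fin N) (Fin N) K) where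
  carrier := {X | ∀ i j, j < i → X i j = 0}
  zero_mem' := by simp
  add_mem' := by
    intro X Y hX hY i j h
    simp [hX i j h, hY i j h]
  smul_mem' := by
    intro r X hX i j h
    simp [hX i j h]

variable (N K) in
/-- Strictly upper triangular matrices. -/
def strictUpperTri : Submodule K (Matrix (Fin N) (Fin N) K) where
  carrier := {X | ∀ i j, j ≤ i → X i j = 0}
  zero_mem' := by simp
  add_mem' := by
    intro X Y hX hY i j h
    simp [hX i j h, hY i j h]
  smul_mem' := by
    intro r X hX i j h
    simp [hX i j h]

variable (N K) in
/-- Strictly lower triangular matrices. -/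
def strictLowerTri : Submodule K (Matrix (Fin N) (Fin N) K) where
  carrier := {X | ∀ i j, i ≤ j → X i j = 0}
  zero_mem' := by simp
  add_mem' := by
    intro X Y hX hY i j h
    simp [hX i j h, hY i j h]
  smul_mem' := by
    intro r X hX i j h
    simp [hX i j h]

/-- The commutator with `U`. -/
def adMap (U : Matrix (Fin N) (Fin N) K) :
    Matrix (Fin N) (Fin N) K →ₗ[K] Matrix (Fin N) (Fin N) K :=
  LinearMap.mulRight K U - LinearMap.mulLeft K U

/-- The anticommutator with `U`. -/
def antiMap (U : Matrix (Fin N) (Fin N) K) :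
    Matrix (Fin N) (Fin N) K →ₗ[K] Matrix (Fin N) (Fin N) K :=
  LinearMap.mulRight K U + LinearMap.mulLeft K U

theorem adMap_apply (U X : Matrix (Fin N) (Fin N) K) : adMap U X = X * U - U * X := rfl

theorem antiMap_apply (U X : Matrix (Fin N) (Fin N) K) : antiMap U X = X * U + U * X := rfl

theorem adMap_mem_selfAdj {J U X : Matrix (Fin N) (Fin N) K} {s : K} (hU : U ∈ selfAdj J s)
    (hX : X ∈ selfAdj J (-1)) : adMap U X ∈ selfAdj J s := by
  have hU' : U.transpose * J = s • (J * U) := hU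
  have hX' : X.transpose * J = (-1 : K) • (J * X) := hX
  change (adMap U X).transpose * J = s • (J * adMap U X)
  rw [adMap_apply, Matrix.transpose_sub, Matrix.transpose_mul, Matrix.transpose_mul, sub_mul,
    Matrix.mul_assoc, hX', Matrix.mul_assoc, hU', mul_sub, Matrix.mul_smul, Matrix.mul_smul,
    ← Matrix.mul_assoc, hU', ← Matrix.mul_assoc, hX', Matrix.smul_mul, Matrix.smul_mul,
    Matrix.mul_assoc, Matrix.mul_assoc]
  module

theorem finrank_prod_top {V W : Type*} [AddCommGroup V] [Module K V] [AddCommGroup W] [Module K W]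
    [FiniteDimensional K V] [FiniteDimensional K W] (p : Submodule K V) :
    Module.finrank K (p.prod (⊤ : Submodule K W)) = Module.finrank K p + Module.finrank K W := by
  have h := LinearMap.finrank_range_of_inj (f := p.subtype.prodMap (LinearMap.id : W →ₗ[K] W))
    (fun x y hxy => by
      have h' := Prod.mk.inj hxy
      exact Prod.ext (Subtype.ext h'.1) h'.2)
  rw [LinearMap.range_prodMap, Submodule.range_subtype, LinearMap.range_id,
    Module.finrank_prod] at h
  exact h

/-- The Lie algebra of the symplectic Borel group. -/
def borelLie (J : Matrix (Fin N) (Fin N) K) : Submodule K (Matrix (Fin N) (Fin N) K) :=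
  upperTri N K ⊓ selfAdj J (-1)

/-- The tangent space at `U` of the orbit of `U` under the symplectic Borel group. -/
def orbitTangent (J U : Matrix (Fin N) (Fin N) K) : Submodule K (Matrix (Fin N) (Fin N) K) :=
  (borelLie J).map (adMap U)

/-- The anticommutators of `U` with the strictly upper triangular self-adjoint matrices. -/
def antiImage (J U : Matrix (Fin N) (Fin N) K) : Submodule K (Matrix (Fin N) (Fin N) K) :=
  (strictUpperTri N K ⊓ selfAdj J 1).map (antiMap U)

end Linear

/-! ### Monomial matrices: commutators compared with anticommutators -/

/-- A monomial strictly upper triangular matrix attached to an involution, together with an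
antidiagonal symplectic form. -/
structure ChordData (N : ℕ) (K : Type*) [Field K] where
  σ : Fin N → Fin N
  invol : Function.Involutive σ
  rev_comm : ∀ k, σ k.rev = (σ k).rev
  u : Fin N → K
  u_ne : ∀ k, k < σ k → u k ≠ 0
  J : Matrix (Fin N) (Fin N) K
  J_eq_zero : ∀ i j, j ≠ i.rev → J i j = 0
  J_ne : ∀ i, J i i.rev ≠ 0
  J_anti : ∀ i, J i.rev i = - J i i.rev

namespace ChordData
variable {N : ℕ} {K : Type*} [Field K] (D : ChordData N K)

/-- The monomial matrix. -/
def U : Matrix (Fin N) (Fin N) K :=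
  Matrix.of fun i j => if i < j ∧ D.σ j = i then D.u i else 0

theorem mul_U (X : Matrix (Fin N) (Fin N) K) (k l : Fin N) :
    (X * D.U) k l = if D.σ l < l then X k (D.σ l) * D.u (D.σ l) else 0 := by
  rw [Matrix.mul_apply, Finset.sum_eq_single (D.σ l)]
  · simp [U]
  · intro b _ hb
    simp [U, hb.symm]
  · simp

theorem U_mul (X : Matrix (Fin N) (Fin N) K) (k l : Fin N) :
    (D.U * X) k l = if k < D.σ k then D.u k * X (D.σ k) l else 0 := by
  rw [Matrix.mul_apply, Finset.sum_eq_single (D.σ k)]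
  · simp [U, D.invol k]
  · intro b _ hb
    have : D.σ b ≠ k := by
      rintro rfl
      exact hb (D.invol b).symm
    simp [U, this]
  · simp

theorem ad_apply (X : Matrix (Fin N) (Fin N) K) (k l : Fin N) :
    adMap D.U X k l = (if D.σ l < l then X k (D.σ l) * D.u (D.σ l) else 0) -
      (if k < D.σ k then D.u k * X (D.σ k) l else 0) := by
  rw [adMap_apply, Matrix.sub_apply, mul_U, U_mul]

theorem anti_apply (X : Matrix (Fin N) (Fin N) K) (k l : Fin N) :
    antiMap D.U X k l = (if D.σ l < l then X k (D.σ l) * D.u (D.σ l) else 0) +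
      (if k < D.σ k then D.u k * X (D.σ k) l else 0) := by
  rw [antiMap_apply, Matrix.add_apply, mul_U, U_mul]

theorem mem_selfAdj {X : Matrix (Fin N) (Fin N) K} {s : K} :
    X ∈ selfAdj D.J s ↔ ∀ a b : Fin N, X a b * D.J a a.rev = s * D.J b b.rev * X b.rev a.rev := by
  have h1 : ∀ k l, (X.transpose * D.J) k l = X l.rev k * D.J l.rev l := by
    intro k l
    rw [Matrix.mul_apply, Finset.sum_eq_single l.rev]
    · rfl
    · intro b _ hb
      rw [D.J_eq_zero b l, mul_zero]
      rintro rfl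
      simp at hb
    · simp
  have h2 : ∀ k l, (D.J * X) k l = D.J k k.rev * X k.rev l := by
    intro k l
    rw [Matrix.mul_apply, Finset.sum_eq_single k.rev]
    · intro b _ hb
      rw [D.J_eq_zero k b hb, zero_mul]
    · simp
  change X.transpose * D.J = s • (D.J * X) ↔ _
  constructor
  · intro h a b
    have := congrFun (congrFun h b) a.rev
    rw [h1, Matrix.smul_apply, h2, Fin.rev_rev, smul_eq_mul] at this
    rw [this, mul_assoc]
  · intro h
    ext k l
    have := h l.rev k
    rw [h1, Matrix.smul_apply, h2, smul_eq_mul]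
    rw [Fin.rev_rev] at this
    rw [this, mul_assoc]

/-- `1`, `-1`, `0` at the left end, at the right end and outside of the chords. -/
def side (k : Fin N) : K := if k < D.σ k then 1 else if D.σ k < k then -1 else 0

/-- The weights relating the commutator and the anticommutator with `U`. -/
def wt (k l : Fin N) : K :=
  if k = l then 0 else
  if D.σ k < k ∧ l < D.σ l then (if k < l.rev then 1 else if l.rev < k then -1 else 0)
  else D.side k + D.side l

theorem side_rev (k : Fin N) : D.side k.rev = - D.side k := by
  unfold side
  simp only [D.rev_comm, Fin.rev_lt_rev]
  split_ifs with h1 h2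
  · exact absurd h1 h2.asymm
  · simp
  · simp
  · simp

theorem wt_rev (k l : Fin N) : D.wt l.rev k.rev = - D.wt k l := by
  unfold wt
  simp only [D.rev_comm, Fin.rev_lt_rev, Fin.rev_inj, side_rev, Fin.rev_rev]
  by_cases h : k = l
  · simp [h]
  rw [if_neg h, if_neg (Ne.symm h)]
  by_cases h2 : D.σ k < k ∧ l < D.σ l
  · rw [if_pos h2, if_pos h2.symm]
    rcases lt_trichotomy k l.rev with h3 | h3 | h3
    · have h4 : l < k.rev := by rw [← Fin.rev_lt_rev]; simpa using h3
      have h5 := h3.asymm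
      simp [h3, h5]
    · have h4 : l = k.rev := by rw [h3]; simp
      simp [h3]
    · have h4 : k.rev < l := by rw [← Fin.rev_lt_rev]; simpa using h3
      simp [h3, h3.asymm]
  · rw [if_neg h2, if_neg fun h3 => h2 h3.symm]
    ring

/-- Entrywise ratio of the weighted anticommutator to the commutator. -/
def ratio (k l : Fin N) : K :=
  if k < D.σ k ∧ ¬ D.σ l < l then - D.wt (D.σ k) l else D.wt k (D.σ l)

/-- Multiplication of the entries by the weights. -/
def weigh (X : Matrix (Fin N) (Fin N) K) : Matrix (Fin N) (Fin N) K :=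
  Matrix.of fun k l => D.wt k l * X k l

/-- Each entry has at most two terms, one for `l` a right end and one for `k` a left end. If only
one term occurs, the ratio is its weight up to sign. If both occur, the two weights are opposite, so
the anticommutator of the weighted matrix is a multiple of the commutator; `wt` is designed to make
this true. -/
theorem anti_weigh (X : Matrix (Fin N) (Fin N) K) (k l : Fin N) :
    antiMap D.U (D.weigh X) k l = D.ratio k l * adMap D.U X k l := by
  rw [anti_apply, ad_apply]
  unfold ratio
  simp only [weigh, Matrix.of_apply]
  by_cases hk : k < D.σ k <;> by_cases hl : D.σ l < l
  · have : D.wt (D.σ k) l = - D.wt k (D.σ l) := by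
      unfold wt
      have h1 : D.σ k = l ↔ k = D.σ l := by
        constructor
        · rintro rfl; exact (D.invol k).symm
        · rintro rfl; exact D.invol l
      simp only [h1, D.invol k, D.invol l, side, hk, hl, hk.asymm, hl.asymm]
      split_ifs <;> simp_all
    simp only [hk, hl, this, if_true, not_true, and_false, if_false]
    ring
  · simp only [hk, hl, if_true, not_false_eq_true, and_self, if_false]
    ring
  · simp only [hk, hl, if_true, not_true, and_false, if_false]
    ring
  · simp only [hk, hl, if_false]
    ring

theorem mem_selfAdj_zero {X : Matrix (Fin N) (Fin N) K} {s : K}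
    (hX : X ∈ selfAdj D.J s) {a b : Fin N} (h : X b.rev a.rev = 0) : X a b = 0 := by
  have := D.mem_selfAdj.1 hX a b
  rw [h, mul_zero] at this
  exact (mul_eq_zero.1 this).resolve_right (D.J_ne a)

/-- The weights vanish on the diagonal, which makes the result strictly upper triangular, and they
change sign under (k, l) ↦ (rev l, rev k), which turns X† = -X into X† = X. -/
theorem weigh_mem {X : Matrix (Fin N) (Fin N) K} (hX : X ∈ borelLie D.J) :
    D.weigh X ∈ strictUpperTri N K ⊓ selfAdj D.J 1 := by
  refine ⟨fun i j h => ?_, D.mem_selfAdj.2 fun a b => ?_⟩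
  · rcases h.lt_or_eq with h | rfl
    · simp [weigh, hX.1 i j h]
    · simp [weigh, wt]
  · have := D.mem_selfAdj.1 hX.2 a b
    simp only [weigh, Matrix.of_apply, D.wt_rev]
    rw [mul_assoc, this]
    ring

/-- The points of the first half that are ends of chords. -/
abbrev HalfEnds : Type := {k : Fin N // k < k.rev ∧ D.σ k ≠ k}

/-- The entries of the commutator that are not determined by the anticommutator. -/
def extra : Matrix (Fin N) (Fin N) K →ₗ[K] (D.HalfEnds → K) :=
  LinearMap.pi fun k => if k.1 < D.σ k.1 then Matrix.entryLinearMap K K k.1 (D.σ k.1)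
    else Matrix.entryLinearMap K K (D.σ k.1) k.1.rev

theorem extra_apply (Z : Matrix (Fin N) (Fin N) K) (k : D.HalfEnds) :
    D.extra Z k = if k.1 < D.σ k.1 then Z k.1 (D.σ k.1) else Z (D.σ k.1) k.1.rev := by
  unfold extra
  rw [LinearMap.pi_apply]
  split_ifs <;> rfl

/-- Entrywise multiplication by the ratios. -/
def scale : Matrix (Fin N) (Fin N) K →ₗ[K] Matrix (Fin N) (Fin N) K where
  toFun Z := Matrix.of fun k l => D.ratio k l * Z k l
  map_add' Z Z' := by ext; simp [mul_add]
  map_smul' r Z := by ext; simp [mul_left_comm]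

theorem scale_ad (X : Matrix (Fin N) (Fin N) K) :
    D.scale (adMap D.U X) = antiMap D.U (D.weigh X) := by
  ext k l
  rw [anti_weigh]
  rfl

/-- What has to be checked is where the ratios vanish. Self-adjointness reduces to rows at a left
end k. There the ratio is zero only in column σ k and, when that column is a left end, in column rev
(σ k). Entries of both kinds are recorded by `extra`, directly or at the mirror position, except
those in column rev (σ k) that vanish because `X` is upper triangular. -/
theorem ad_eq_zero [CharZero K] {s : K} (hU : D.U ∈ selfAdj D.J s)
    {X : Matrix (Fin N) (Fin N) K} (hX : X ∈ borelLie D.J)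
    (h1 : D.scale (adMap D.U X) = 0) (h2 : D.extra (adMap D.U X) = 0) : adMap D.U X = 0 := by
  have hsym : adMap D.U X ∈ selfAdj D.J s := adMap_mem_selfAdj hU hX.2
  have h1' : ∀ k l, D.ratio k l = 0 ∨ adMap D.U X k l = 0 := fun k l => by
    have := congrFun (congrFun h1 k) l
    exact mul_eq_zero.1 this
  have h2' : ∀ k, k < k.rev → D.σ k ≠ k →
      (if k < D.σ k then adMap D.U X k (D.σ k) else adMap D.U X (D.σ k) k.rev) = 0 := by
    intro k hk hk'
    rw [← D.extra_apply _ ⟨k, hk, hk'⟩, h2]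
    rfl
  have key : ∀ k l, k < D.σ k → adMap D.U X k l = 0 := by
    intro k l hk
    refine (h1' k l).elim (fun h => ?_) id
    by_cases hl : D.σ l < l
    · have hkl : l = D.σ k := by
        by_contra hne
        have hne' : k ≠ D.σ l := by
          rintro rfl
          exact hne (D.invol l).symm
        simp only [ratio, hl, not_true, and_false, if_false, wt, hne', side, D.invol l, hk, hk.asymm,
          false_and, if_true] at h
        norm_num at h
      subst hkl
      by_cases hkr : k < k.rev
      · have := h2' k hkr hk.ne'
        rwa [if_pos hk] at this
      · apply D.mem_selfAdj_zero hsym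
        have h3 : D.σ (D.σ k).rev = k.rev := by rw [D.rev_comm, D.invol]
        have h4 : (D.σ k).rev < k.rev := Fin.rev_lt_rev.2 hk
        have h5 := h2' (D.σ k).rev (by
          rw [Fin.rev_rev]
          exact h4.trans_le ((not_lt.1 hkr).trans hk.le)) (by rw [h3]; exact h4.ne')
        rwa [h3, if_pos h4] at h5
    · simp only [ratio, hl, hk, not_false_eq_true, and_self, if_true, neg_eq_zero] at h
      have hkl : D.σ k ≠ l := by
        rintro rfl
        exact hl (by rwa [D.invol])
      by_cases hl' : l < D.σ l
      · have h3 : D.σ k = l.rev := by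
          simp only [wt, hkl, D.invol k, hk, hl', and_self, if_true, if_false] at h
          by_contra hne
          rcases lt_or_gt_of_ne hne with h3 | h3
          · simp [h3] at h
          · simp [h3, h3.asymm] at h
        have h4 : l = (D.σ k).rev := by rw [h3, Fin.rev_rev]
        by_cases h5 : D.σ k < (D.σ k).rev
        · have := h2' (D.σ k) h5 (by rw [D.invol]; exact hk.ne)
          rwa [D.invol, if_neg hk.asymm, ← h4] at this
        · have h6 : l < D.σ k := lt_of_le_of_ne (h4 ▸ not_lt.1 h5) (Ne.symm hkl)
          rw [ad_apply, if_neg hl, if_pos hk, hX.1 _ _ h6]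
          simp
      · simp [wt, hkl, D.invol k, side, hk, hl', hl, hk.asymm] at h
  ext k l
  by_cases hk : k < D.σ k
  · exact key k l hk
  · by_cases hl : D.σ l < l
    · apply D.mem_selfAdj_zero hsym
      apply key
      rw [D.rev_comm]
      exact Fin.rev_lt_rev.2 hl
    · rw [ad_apply, if_neg hl, if_neg hk]
      simp

/-- Commutators and anticommutators with a monomial matrix. -/
theorem finrank_orbitTangent_le [CharZero K] {s : K} (hU : D.U ∈ selfAdj D.J s) :
    Module.finrank K (orbitTangent D.J D.U) ≤
      Module.finrank K (antiImage D.J D.U) + Fintype.card D.HalfEnds := by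
  let Φ := D.scale.prod D.extra
  have hinj : Function.Injective (Φ.domRestrict (orbitTangent D.J D.U)) := by
    rw [injective_iff_map_eq_zero]
    rintro ⟨_, X, hX, rfl⟩ h
    have h' := Prod.mk.inj h
    exact Subtype.ext (D.ad_eq_zero hU hX h'.1 h'.2)
  have hle : LinearMap.range (Φ.domRestrict (orbitTangent D.J D.U)) ≤
      (antiImage D.J D.U).prod ⊤ := by
    rintro _ ⟨⟨_, X, hX, rfl⟩, rfl⟩
    exact ⟨⟨_, D.weigh_mem hX, (D.scale_ad X).symm⟩, trivial⟩
  rw [← LinearMap.finrank_range_of_inj hinj]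
  refine (Submodule.finrank_mono hle).trans ?_
  rw [finrank_prod_top, Module.finrank_fintype_fun_eq_card]

theorem anti_congr {X Y : Matrix (Fin N) (Fin N) K}
    (h : ∀ k l, D.σ k < k ∨ l < D.σ l → X k l = Y k l) : antiMap D.U X = antiMap D.U Y := by
  ext k l
  rw [anti_apply, anti_apply]
  congr 1
  · by_cases hl : D.σ l < l
    · rw [if_pos hl, if_pos hl, h k (D.σ l) (Or.inr (by rwa [D.invol]))]
    · rw [if_neg hl, if_neg hl]
  · by_cases hk : k < D.σ k
    · rw [if_pos hk, if_pos hk, h (D.σ k) l (Or.inl (by rwa [D.invol]))]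
    · rw [if_neg hk, if_neg hk]

theorem J_rev (k : Fin N) : D.J k.rev k = - D.J k k.rev := D.J_anti k

/-- The form changes sign under reversal, so self-adjointness at an antidiagonal position reads y =
-y. -/
theorem selfAdj_one_antidiag [CharZero K] {Y : Matrix (Fin N) (Fin N) K}
    (hY : Y ∈ selfAdj D.J 1) (a : Fin N) : Y a a.rev = 0 := by
  have h := D.mem_selfAdj.1 hY a a.rev
  rw [Fin.rev_rev, D.J_rev, one_mul] at h
  have h2 : (2 * D.J a a.rev) * Y a a.rev = 0 := by linear_combination h
  exact (mul_eq_zero.1 h2).resolve_left (mul_ne_zero two_ne_zero (D.J_ne a))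

/-- Divide by the weights. The anticommutator sees only rows at right ends and columns at left ends.
Among those positions a weight vanishes only on the diagonal or the antidiagonal, where `Y` itself
vanishes. -/
theorem exists_weigh_eq [CharZero K] {Y : Matrix (Fin N) (Fin N) K}
    (hY : Y ∈ strictUpperTri N K ⊓ selfAdj D.J 1) :
    ∃ X ∈ borelLie D.J, antiMap D.U (D.weigh X) = antiMap D.U Y := by
  refine ⟨Matrix.of fun k l => (D.wt k l)⁻¹ * Y k l, ⟨fun i j h => ?_, D.mem_selfAdj.2 fun a b => ?_⟩,
    D.anti_congr fun k l hkl => ?_⟩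
  · simp [hY.1 i j h.le]
  · have := D.mem_selfAdj.1 hY.2 a b
    simp only [Matrix.of_apply, D.wt_rev, inv_neg]
    linear_combination (D.wt a b)⁻¹ * this
  · simp only [weigh, Matrix.of_apply]
    by_cases h : D.wt k l = 0
    · rw [h, zero_mul, eq_comm]
      by_cases hne : k = l
      · exact hY.1 k l hne.symm.le
      by_cases h2 : D.σ k < k ∧ l < D.σ l
      · have h3 : k = l.rev := by
          simp only [wt, hne, h2, and_self, if_true, if_false] at h
          by_contra hc
          rcases lt_or_gt_of_ne hc with h3 | h3
          · simp [h3] at h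
          · simp [h3, h3.asymm] at h
        have h4 : l = k.rev := by rw [h3, Fin.rev_rev]
        rw [h4]
        exact D.selfAdj_one_antidiag hY.2 k
      · exfalso
        simp only [wt, hne, h2, if_false, side] at h
        rcases hkl with h3 | h3
        · have h4 : ¬ l < D.σ l := fun h4 => h2 ⟨h3, h4⟩
          simp only [h3, h3.asymm, h4, if_true, if_false] at h
          split_ifs at h <;> norm_num at h
        · have h4 : ¬ D.σ k < k := fun h4 => h2 ⟨h4, h3⟩
          simp only [h3, h4, if_true, if_false] at h
          split_ifs at h <;> norm_num at h
    · rw [mul_inv_cancel_left₀ h]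

/-- A matrix supported on the diagonal and on the antidiagonal at right ends of the first half is
killed by the weights. Its diagonal prescribes the recorded entries at left ends, its antidiagonal
those at right ends. By `hlink` a chord starting in the first half stays there or is its own mirror
image, so the prescriptions do not interfere. -/
theorem exists_extra_eq [CharZero K]
    (hlink : ∀ k, k < k.rev → D.σ k ≠ k → D.σ k < (D.σ k).rev ∨ D.σ k = k.rev)
    (r : D.HalfEnds → K) :
    ∃ X ∈ borelLie D.J, D.weigh X = 0 ∧ D.extra (adMap D.U X) = r := by
  classical
  let ρ : Fin N → K := fun k => if h : k < k.rev ∧ D.σ k ≠ k then r ⟨k, h⟩ else 0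
  -- On a chord equal to its own mirror image both ends contribute, with opposite diagonal entries,
  -- hence the factor 2.
  let γ : Fin N → K := fun k =>
    if k < D.σ k then (if D.σ k = k.rev then (2 * D.u k)⁻¹ * ρ k else (D.u k)⁻¹ * ρ k) else 0
  let α : Fin N → K := fun k => if k < k.rev then γ k else if k.rev < k then - γ k.rev else 0
  let β : Fin N → K := fun k => if k < k.rev ∧ D.σ k < k then - (D.u (D.σ k))⁻¹ * ρ k else 0
  let X : Matrix (Fin N) (Fin N) K := Matrix.of fun a b =>
    if a = b then α a else if b = a.rev then β a else 0
  have hα : ∀ k, α k.rev = - α k := by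
    intro k
    simp only [α, Fin.rev_rev]
    rcases lt_trichotomy k k.rev with h | h | h
    · simp [h, h.asymm]
    · simp only [← h, lt_irrefl, if_false, neg_zero]
    · simp [h, h.asymm]
  have hX1 : ∀ a, X a a = α a := fun a => by simp [X]
  have hX2 : ∀ a, a < a.rev → X a a.rev = β a := fun a h => by simp [X, h.ne]
  refine ⟨X, ⟨fun i j h => ?_, D.mem_selfAdj.2 fun a b => ?_⟩, ?_, ?_⟩
  · have hne : i ≠ j := h.ne'
    simp only [X, Matrix.of_apply, hne, if_false]
    split_ifs with h2
    · subst h2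
      simp [β, h.asymm]
    · rfl
  · by_cases h1 : a = b
    · subst h1
      rw [hX1, hX1, hα]
      ring
    · have h1' : b.rev ≠ a.rev := fun h => h1 (Fin.rev_inj.1 h).symm
      by_cases h2 : b = a.rev
      · subst h2
        rw [Fin.rev_rev, D.J_rev]
        ring
      · have h2' : a.rev ≠ b := Ne.symm h2
        simp [X, h1, h1', h2, h2']
  · ext a b
    simp only [weigh, X, Matrix.of_apply, Matrix.zero_apply]
    by_cases h1 : a = b
    · simp [wt, h1]
    · rw [if_neg h1]
      by_cases h2 : b = a.rev
      · rw [if_pos h2]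
        by_cases h3 : a < a.rev ∧ D.σ a < a
        · have h4 : a.rev < (D.σ a).rev := Fin.rev_lt_rev.2 h3.2
          simp [wt, h2, h3, D.rev_comm, h3.1.ne]
        · simp [β, h3]
      · simp [h2]
  · ext k
    obtain ⟨k, hk1, hk2⟩ := k
    have hρ : ρ k = r ⟨k, hk1, hk2⟩ := dif_pos ⟨hk1, hk2⟩
    rw [extra_apply, ← hρ]
    simp only
    by_cases hk : k < D.σ k
    · have hu := D.u_ne k hk
      rw [if_pos hk, ad_apply, D.invol, if_pos hk, if_pos hk, hX1, hX1]
      rcases hlink k hk1 hk2 with h | h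
      · have h3 : D.σ k ≠ k.rev := by
          intro h4
          rw [h4, Fin.rev_rev] at h
          exact h.asymm hk1
        have h4 : ¬ D.σ k < D.σ (D.σ k) := by rw [D.invol]; exact hk.asymm
        simp only [α, γ, hk1, h, hk, h4, h3, if_true, if_false]
        field_simp
        ring
      · rw [h, hα]
        simp only [α, γ, hk1, h, if_true]
        field_simp
        ring
    · have hk' : D.σ k < k := lt_of_le_of_ne (not_lt.1 hk) hk2
      have hu := D.u_ne (D.σ k) (by rwa [D.invol])
      have h3 : k.rev < (D.σ k).rev := Fin.rev_lt_rev.2 hk'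
      rw [if_neg hk, ad_apply, D.rev_comm, if_neg h3.asymm, D.invol, if_pos hk', hX2 k hk1]
      simp only [β, hk1, hk', and_self, if_true]
      field_simp
      ring

/-- The pair (`scale`, `extra`) maps the commutators onto the anticommutators times all values at
the half ends: first lift the anticommutator, then correct `extra` by an element whose weighted
matrix is zero. -/
theorem le_finrank_orbitTangent [CharZero K]
    (hlink : ∀ k, k < k.rev → D.σ k ≠ k → D.σ k < (D.σ k).rev ∨ D.σ k = k.rev) :
    Module.finrank K (antiImage D.J D.U) + Fintype.card D.HalfEnds ≤
      Module.finrank K (orbitTangent D.J D.U) := by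
  rw [← Module.finrank_fintype_fun_eq_card K (η := D.HalfEnds), ← finrank_prod_top]
  refine le_trans (Submodule.finrank_mono ?_)
    (Submodule.finrank_map_le (D.scale.prod D.extra) (orbitTangent D.J D.U))
  rintro ⟨_, r⟩ ⟨⟨Y, hY, rfl⟩, -⟩
  obtain ⟨X, hX, hXY⟩ := D.exists_weigh_eq hY
  obtain ⟨X', hX', h1, h2⟩ := D.exists_extra_eq hlink (r - D.extra (adMap D.U X))
  refine ⟨_, ⟨X + X', add_mem hX hX', rfl⟩, Prod.ext ?_ ?_⟩
  · change D.scale (adMap D.U (X + X')) = _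
    rw [map_add, map_add, scale_ad, scale_ad, h1, hXY, map_zero, add_zero]
  · change D.extra (adMap D.U (X + X')) = _
    rw [map_add, map_add, h2, add_sub_cancel]

end ChordData

/-! ### The linear fibre over an upper part -/

section Fibre
variable {N : ℕ} {K : Type*} [Field K]

/-- The lower parts `Λ` of the points `(U, Λ)` of the Brauer loop scheme with given `U`. -/
def fibre (J : Matrix (Fin N) (Fin N) K) (s : K) (U : Matrix (Fin N) (Fin N) K) :
    Submodule K (Matrix (Fin N) (Fin N) K) :=
  strictLowerTri N K ⊓ selfAdj J s ⊓ (upperTri N K).comap (antiMap U)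

theorem antiMap_mem_selfAdj {J U X : Matrix (Fin N) (Fin N) K} {s t : K} (hU : U ∈ selfAdj J s)
    (hX : X ∈ selfAdj J t) : antiMap U X ∈ selfAdj J (s * t) := by
  have hU' : U.transpose * J = s • (J * U) := hU
  have hX' : X.transpose * J = t • (J * X) := hX
  change (antiMap U X).transpose * J = (s * t) • (J * antiMap U X)
  rw [antiMap_apply, Matrix.transpose_add, Matrix.transpose_mul, Matrix.transpose_mul, add_mul,
    Matrix.mul_assoc, hX', Matrix.mul_assoc, hU', mul_add, Matrix.mul_smul, Matrix.mul_smul,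
    ← Matrix.mul_assoc, hU', ← Matrix.mul_assoc, hX', Matrix.smul_mul, Matrix.smul_mul,
    Matrix.mul_assoc, Matrix.mul_assoc]
  module

theorem mul_mem_strictUpperTri {X Y : Matrix (Fin N) (Fin N) K} (hX : X ∈ strictUpperTri N K)
    (hY : Y ∈ strictUpperTri N K) : X * Y ∈ strictUpperTri N K := by
  intro i j h
  rw [Matrix.mul_apply]
  refine Finset.sum_eq_zero fun k _ => ?_
  by_cases h1 : k ≤ i
  · rw [hX i k h1, zero_mul]
  · rw [hY k j (h.trans (not_le.1 h1).le), mul_zero]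

/-- The index set of coordinates on the strictly upper triangular matrices of type `a`. -/
abbrev FundIndex (a : BoundaryType) (N : ℕ) : Type :=
  {p : Fin N × Fin N // p.1 < p.2 ∧ (p.2 < p.1.rev ∨ (p.2 = p.1.rev ∧ a = .identified))}

instance (a : BoundaryType) (N : ℕ) : Fintype (FundIndex a N) := Fintype.ofFinite _

end Fibre

/-! ### Trace duality and the dimension count -/

namespace ChordData
variable {N : ℕ} {K : Type*} [Field K] (D : ChordData N K)

/-- The adjoint with respect to the form. -/
def dagger (X : Matrix (Fin N) (Fin N) K) : Matrix (Fin N) (Fin N) K :=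
  Matrix.of fun a b => D.J b b.rev * X b.rev a.rev * (D.J a a.rev)⁻¹

theorem mem_selfAdj_iff_dagger {X : Matrix (Fin N) (Fin N) K} {s : K} :
    X ∈ selfAdj D.J s ↔ X = s • D.dagger X := by
  rw [D.mem_selfAdj]
  constructor
  · intro h
    ext a b
    rw [← mul_left_inj' (D.J_ne a), h a b]
    simp only [dagger, Matrix.smul_apply, Matrix.of_apply, smul_eq_mul]
    have := D.J_ne a
    field_simp
  · intro h a b
    have h2 := congrFun (congrFun h a) b
    simp only [dagger, Matrix.smul_apply, Matrix.of_apply, smul_eq_mul] at h2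
    rw [h2]
    have := D.J_ne a
    field_simp

theorem dagger_dagger (X : Matrix (Fin N) (Fin N) K) : D.dagger (D.dagger X) = X := by
  ext a b
  have h1 := D.J_ne a
  have h2 := D.J_ne b
  simp only [dagger, Matrix.of_apply, Fin.rev_rev, D.J_rev]
  field_simp

theorem dagger_add (X Y : Matrix (Fin N) (Fin N) K) :
    D.dagger (X + Y) = D.dagger X + D.dagger Y := by
  ext a b
  simp [dagger, mul_add, add_mul]

theorem dagger_smul (r : K) (X : Matrix (Fin N) (Fin N) K) :
    D.dagger (r • X) = r • D.dagger X := by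
  ext a b
  simp only [dagger, Matrix.smul_apply, Matrix.of_apply, smul_eq_mul]
  ring

theorem symm_mem_selfAdj (X : Matrix (Fin N) (Fin N) K) {s : K} (hs : s * s = 1) :
    X + s • D.dagger X ∈ selfAdj D.J s := by
  rw [mem_selfAdj_iff_dagger, dagger_add, dagger_smul, dagger_dagger, smul_add, smul_smul, hs,
    one_smul, add_comm]

theorem dagger_mem_strictUpperTri {X : Matrix (Fin N) (Fin N) K} (hX : X ∈ strictUpperTri N K) :
    D.dagger X ∈ strictUpperTri N K := by
  intro i j h
  simp [dagger, hX _ _ (Fin.rev_le_rev.2 h)]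

theorem dagger_mem_upperTri {X : Matrix (Fin N) (Fin N) K} (hX : X ∈ upperTri N K) :
    D.dagger X ∈ upperTri N K := by
  intro i j h
  simp [dagger, hX _ _ (Fin.rev_lt_rev.2 h)]

theorem trace_mul_dagger (X Y : Matrix (Fin N) (Fin N) K) :
    (X * D.dagger Y).trace = (D.dagger X * Y).trace := by
  simp only [Matrix.trace, Matrix.diag_apply, Matrix.mul_apply]
  rw [Finset.sum_comm, ← Equiv.sum_comp Fin.revPerm]
  refine Finset.sum_congr rfl fun a _ => ?_
  rw [← Equiv.sum_comp Fin.revPerm]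
  refine Finset.sum_congr rfl fun b _ => ?_
  have h1 := D.J_ne a
  have h2 := D.J_ne b
  simp only [dagger, Matrix.of_apply, Fin.revPerm_apply, Fin.rev_rev, D.J_rev]
  field_simp

theorem trace_mul_symm {X : Matrix (Fin N) (Fin N) K} {s : K} (hs : s * s = 1)
    (hX : X ∈ selfAdj D.J s) (Y : Matrix (Fin N) (Fin N) K) :
    (X * (Y + s • D.dagger Y)).trace = 2 * (X * Y).trace := by
  have h : D.dagger X = s • X := by
    conv_rhs => rw [D.mem_selfAdj_iff_dagger.1 hX, smul_smul, hs, one_smul]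
  rw [mul_add, Matrix.trace_add, Matrix.mul_smul, Matrix.trace_smul, trace_mul_dagger, h,
    Matrix.smul_mul, Matrix.trace_smul, smul_smul, hs, one_smul, two_mul]

/-- Test against symmetrised elementary matrices: the trace against one of them is twice an entry of
`X`. -/
theorem apply_eq_zero_of_trace [CharZero K] {X : Matrix (Fin N) (Fin N) K} {s : K}
    (hs : s * s = 1) (hX : X ∈ selfAdj D.J s)
    (h : ∀ Y ∈ strictUpperTri N K ⊓ selfAdj D.J s, (X * Y).trace = 0) : X ∈ upperTri N K := by
  intro i j hij
  have h1 : Matrix.single j i (1 : K) ∈ strictUpperTri N K := by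
    intro a b hab
    rw [Matrix.single_apply]
    split_ifs with h2
    · rw [← h2.1, ← h2.2] at hab
      exact absurd hij hab.not_gt
    · rfl
  have h2 := h _ ⟨add_mem h1 (Submodule.smul_mem _ s (D.dagger_mem_strictUpperTri h1)),
    D.symm_mem_selfAdj _ hs⟩
  rw [D.trace_mul_symm hs hX, Matrix.trace_mul_single] at h2
  simpa using h2

/-- The trace form between strictly lower and strictly upper triangular matrices. -/
def pairing (s : K) : ↥(strictLowerTri N K ⊓ selfAdj D.J s) →ₗ[K]
    Module.Dual K ↥(strictUpperTri N K ⊓ selfAdj D.J s) where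
  toFun X := ((Matrix.traceLinearMap (Fin N) K K).comp
    (LinearMap.mulLeft K (X : Matrix (Fin N) (Fin N) K))).comp (Submodule.subtype _)
  map_add' X Y := by ext; simp [add_mul]
  map_smul' r X := by ext; simp

theorem pairing_apply (s : K) (X : ↥(strictLowerTri N K ⊓ selfAdj D.J s))
    (Y : ↥(strictUpperTri N K ⊓ selfAdj D.J s)) :
    D.pairing s X Y = ((X : Matrix (Fin N) (Fin N) K) * Y).trace := rfl

theorem pairing_injective [CharZero K] {s : K} (hs : s * s = 1) :
    Function.Injective (D.pairing s) := by
  rw [injective_iff_map_eq_zero]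
  rintro ⟨X, hX⟩ h
  have h1 := D.apply_eq_zero_of_trace hs hX.2 fun Y hY => by
    rw [← D.pairing_apply s ⟨X, hX⟩ ⟨Y, hY⟩, h]
    rfl
  apply Subtype.ext
  ext i j
  rcases lt_or_ge j i with h2 | h2
  · exact h1 i j h2
  · exact hX.1 i j h2

theorem trace_antiMap_mul (U X Y : Matrix (Fin N) (Fin N) K) :
    (antiMap U X * Y).trace = (X * antiMap U Y).trace := by
  simp only [antiMap_apply, mul_add, add_mul, Matrix.trace_add]
  rw [Matrix.mul_assoc U X Y, Matrix.trace_mul_comm U, Matrix.mul_assoc, Matrix.mul_assoc, add_comm]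

/-- Reversing the order of the rows and of the columns exchanges upper and lower triangular and
keeps the type, because the form changes sign on both sides. The other inequality comes from
`pairing_injective`. -/
theorem finrank_lower_eq (s : K) :
    Module.finrank K ↥(strictUpperTri N K ⊓ selfAdj D.J s) ≤
      Module.finrank K ↥(strictLowerTri N K ⊓ selfAdj D.J s) := by
  let f := (Matrix.reindexLinearEquiv K K (Fin.revPerm (n := N)) (Fin.revPerm (n := N)))
  rw [← f.finrank_map_eq]
  refine Submodule.finrank_mono ?_
  rintro _ ⟨X, hX, rfl⟩
  refine ⟨fun i j h => ?_, D.mem_selfAdj.2 fun a b => ?_⟩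
  · exact hX.1 _ _ (Fin.rev_le_rev.2 h)
  · have h1 := D.mem_selfAdj.1 hX.2 a.rev b.rev
    have h2 := D.J_rev a
    have h3 := D.J_rev b
    rw [Fin.rev_rev, Fin.rev_rev, h2, h3] at h1
    change X a.rev b.rev * _ = _ * X b.rev.rev a.rev.rev
    rw [Fin.rev_rev, Fin.rev_rev]
    linear_combination - h1

theorem antiImage_le {s : K} (hU : D.U ∈ selfAdj D.J s) :
    antiImage D.J D.U ≤ strictUpperTri N K ⊓ selfAdj D.J s := by
  rintro _ ⟨X, hX, rfl⟩
  have h : D.U ∈ strictUpperTri N K := by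
    intro i j h
    simp [U, h.not_gt]
  refine ⟨add_mem (mul_mem_strictUpperTri hX.1 h) (mul_mem_strictUpperTri h hX.1), ?_⟩
  have := antiMap_mem_selfAdj hU hX.2
  rwa [mul_one] at this

/-- The trace form identifies lower matrices of type s with the dual of the upper ones, and the
anticommutator with U is its own transpose for this form. So UΛ + ΛU is upper triangular exactly
when Λ annihilates the anticommutators of U with strictly upper triangular self-adjoint matrices. -/
theorem finrank_fibre_add [CharZero K] {s : K} (hs : s * s = 1) (hU : D.U ∈ selfAdj D.J s) :
    Module.finrank K (fibre D.J s D.U) + Module.finrank K (antiImage D.J D.U) =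
      Module.finrank K ↥(strictUpperTri N K ⊓ selfAdj D.J s) := by
  let V := strictUpperTri N K ⊓ selfAdj D.J s
  let V' := strictLowerTri N K ⊓ selfAdj D.J s
  have hle : antiImage D.J D.U ≤ V := D.antiImage_le hU
  let A : Submodule K V := (antiImage D.J D.U).comap V.subtype
  have hA : Module.finrank K A = Module.finrank K (antiImage D.J D.U) :=
    (Submodule.comapSubtypeEquivOfLe hle).finrank_eq
  have hdim : Module.finrank K V' = Module.finrank K (Module.Dual K V) := by
    apply le_antisymm
    · exact LinearMap.finrank_le_finrank_of_injective (D.pairing_injective hs)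
    · rw [Subspace.dual_finrank_eq]
      exact D.finrank_lower_eq s
  let e : V' ≃ₗ[K] Module.Dual K V :=
    LinearEquiv.ofInjectiveOfFinrankEq (D.pairing s) (D.pairing_injective hs) hdim
  have hfib : fibre D.J s D.U = ((A.dualAnnihilator).comap (D.pairing s)).map V'.subtype := by
    ext X
    constructor
    · rintro ⟨hX, hX'⟩
      refine ⟨⟨X, hX⟩, ?_, rfl⟩
      rw [SetLike.mem_coe, Submodule.mem_comap, Submodule.mem_dualAnnihilator]
      rintro ⟨_, hZ⟩ ⟨Y, hY, rfl⟩
      rw [pairing_apply]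
      have h1 : antiMap D.U X * Y ∈ strictUpperTri N K := by
        intro i j h
        rw [Matrix.mul_apply]
        refine Finset.sum_eq_zero fun k _ => ?_
        by_cases h1 : k < i
        · rw [hX' i k h1, zero_mul]
        · rw [hY.1 k j (h.trans (not_lt.1 h1)), mul_zero]
      have h2 : (antiMap D.U X * Y).trace = 0 := Finset.sum_eq_zero fun i _ => h1 i i le_rfl
      rwa [trace_antiMap_mul] at h2
    · rintro ⟨⟨X, hX⟩, hX', rfl⟩
      refine ⟨hX, ?_⟩
      have h1 := antiMap_mem_selfAdj hU hX.2
      rw [hs] at h1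
      refine D.apply_eq_zero_of_trace (one_mul 1) h1 fun Y hY => ?_
      rw [trace_antiMap_mul]
      rw [SetLike.mem_coe, Submodule.mem_comap, Submodule.mem_dualAnnihilator] at hX'
      exact hX' ⟨antiMap D.U Y, hle ⟨Y, hY, rfl⟩⟩ ⟨Y, hY, rfl⟩
  rw [hfib, ← hA, ← Subspace.finrank_add_finrank_dualAnnihilator_eq A, add_comm]
  congr 1
  rw [Submodule.finrank_map_subtype_eq]
  have h : A.dualAnnihilator.comap (D.pairing s) =
      A.dualAnnihilator.map (e.symm : Module.Dual K V →ₗ[K] V') :=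
    A.dualAnnihilator.comap_equiv_eq_map_symm e
  rw [h, LinearEquiv.finrank_map_eq]

/-- The entries before the antidiagonal are free coordinates. Those on it are free for s = -1 and
zero for s = 1. The count does not involve the field, which allows dimensions over different fields
to be compared. -/
theorem finrank_strictUpperTri [CharZero K] (a : BoundaryType) :
    Module.finrank K ↥(strictUpperTri N K ⊓ selfAdj D.J ((a.sign : ℤ) : K)) =
      Fintype.card (FundIndex a N) := by
  let V := strictUpperTri N K ⊓ selfAdj D.J ((a.sign : ℤ) : K)
  have hs : ((a.sign : ℤ) : K) * ((a.sign : ℤ) : K) = 1 := by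
    cases a <;> simp [BoundaryType.sign]
  let R : V →ₗ[K] (FundIndex a N → K) :=
    LinearMap.pi fun p => (Matrix.entryLinearMap K K p.1.1 p.1.2).comp V.subtype
  have hR : ∀ (X : V) p, R X p = (X : Matrix (Fin N) (Fin N) K) p.1.1 p.1.2 := fun X p => rfl
  have hinj : Function.Injective R := by
    rw [injective_iff_map_eq_zero]
    rintro ⟨X, hX⟩ h
    have h1 : ∀ i j, i < j → (j < i.rev ∨ (j = i.rev ∧ a = .identified)) → X i j = 0 :=
      fun i j h1 h2 => congrFun h ⟨(i, j), h1, h2⟩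
    apply Subtype.ext
    ext i j
    change X i j = 0
    rcases le_or_gt j i with h2 | h2
    · exact hX.1 i j h2
    rcases lt_trichotomy j i.rev with h3 | h3 | h3
    · exact h1 i j h2 (Or.inl h3)
    · cases a with
      | identified => exact h1 i j h2 (Or.inr ⟨h3, rfl⟩)
      | closed =>
        have h4 : X ∈ selfAdj D.J 1 := by simpa [BoundaryType.sign] using hX.2
        rw [h3]
        exact D.selfAdj_one_antidiag h4 i
    · apply D.mem_selfAdj_zero hX.2
      exact h1 _ _ (Fin.rev_lt_rev.2 h2) (Or.inl (by rwa [Fin.rev_rev]))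
  have hsurj : Function.Surjective R := by
    classical
    intro f
    -- Symmetrising doubles the antidiagonal entries, hence the factor 1/2.
    let M : Matrix (Fin N) (Fin N) K := Matrix.of fun i j =>
      if h : i < j ∧ (j < i.rev ∨ (j = i.rev ∧ a = .identified)) then
        (if j = i.rev then 2⁻¹ * f ⟨(i, j), h⟩ else f ⟨(i, j), h⟩) else 0
    have hM : M ∈ strictUpperTri N K := by
      intro i j h
      simp [M, h.not_gt]
    refine ⟨⟨M + ((a.sign : ℤ) : K) • D.dagger M,
      add_mem hM (Submodule.smul_mem _ _ (D.dagger_mem_strictUpperTri hM)),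
      D.symm_mem_selfAdj M hs⟩, ?_⟩
    ext ⟨⟨i, j⟩, h⟩
    rw [hR]
    simp only [Matrix.add_apply, Matrix.smul_apply, smul_eq_mul, dagger, Matrix.of_apply]
    have hMij : M i j = if j = i.rev then 2⁻¹ * f ⟨(i, j), h⟩ else f ⟨(i, j), h⟩ := dif_pos h
    rcases h.2 with h2 | ⟨h2, h3⟩
    · have h3 : M j.rev i.rev = 0 := by
        refine dif_neg ?_
        rintro ⟨-, h3 | h3⟩
        · rw [Fin.rev_rev] at h3
          exact h2.asymm h3
        · rw [Fin.rev_rev] at h3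
          exact h2.ne h3.1.symm
      rw [h3, hMij, if_neg h2.ne]
      ring
    · subst h3
      simp only at h2
      have h4 := D.J_ne i
      rw [hMij, if_pos h2]
      subst h2
      rw [Fin.rev_rev, hMij, if_pos rfl, D.J_rev]
      simp only [BoundaryType.sign]
      push_cast
      field_simp
      ring
  rw [(LinearEquiv.ofBijective R ⟨hinj, hsurj⟩).finrank_eq, Module.finrank_fintype_fun_eq_card]

theorem rev_ne [CharZero K] (D : ChordData N K) (k : Fin N) : k.rev ≠ k := by
  intro h
  have h1 := D.J_rev k
  have h2 := D.J_ne k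
  rw [h] at h1 h2
  exact h2 (self_eq_neg.1 h1)

/-- A chord between mirror points would put a nonzero entry on the antidiagonal. -/
theorem invol_ne_rev [CharZero K] (hU : D.U ∈ selfAdj D.J 1) (k : Fin N) : D.σ k ≠ k.rev := by
  have key : ∀ k : Fin N, k < k.rev → D.σ k ≠ k.rev := by
    intro k h hk
    have h1 := D.selfAdj_one_antidiag hU k
    rw [← hk] at h h1
    simp only [U, Matrix.of_apply, D.invol k, h, and_self, if_true] at h1
    exact D.u_ne k h h1
  rcases lt_or_gt_of_ne (D.rev_ne k) with h | h
  · intro hk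
    apply key k.rev (by rwa [Fin.rev_rev])
    rw [D.rev_comm, hk]
  · exact key k h

theorem card_halfEnds_add :
    Fintype.card D.HalfEnds + Fintype.card {k : Fin N // k < k.rev ∧ D.σ k = k} =
      Fintype.card {k : Fin N // k < k.rev} := by
  classical
  simp only [Fintype.card_subtype]
  rw [add_comm, ← Finset.card_filter_add_card_filter_not (fun k => D.σ k = k)
    (s := Finset.univ.filter fun k : Fin N => k < k.rev), Finset.filter_filter,
    Finset.filter_filter]

/-- Folding the second half onto the first turns σ into an involution of the ends in the first half.
It has no fixed point, since σ k is neither k nor its mirror image. -/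
theorem even_card_halfEnds [CharZero K] (hU : D.U ∈ selfAdj D.J 1) :
    Even (Fintype.card D.HalfEnds) := by
  have hfold : ∀ k : Fin N, k < k.rev ∨ k.rev < k := fun k => (lt_or_gt_of_ne (D.rev_ne k)).symm
  let f : D.HalfEnds → D.HalfEnds := fun k =>
    if h : D.σ k.1 < (D.σ k.1).rev then ⟨D.σ k.1, h, by rw [D.invol]; exact k.2.2.symm⟩
    else ⟨(D.σ k.1).rev, by rw [Fin.rev_rev]; exact (hfold _).resolve_left h,
      by rw [D.rev_comm, D.invol, Ne, Fin.rev_inj]; exact k.2.2.symm⟩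
  have hf1 : ∀ k : D.HalfEnds, (f k).1 = if D.σ k.1 < (D.σ k.1).rev then D.σ k.1
      else (D.σ k.1).rev := by
    intro k
    simp only [f]
    split_ifs <;> rfl
  have hff : Function.Involutive f := by
    intro k
    apply Subtype.ext
    rw [hf1]
    by_cases h : D.σ k.1 < (D.σ k.1).rev
    · rw [hf1, if_pos h, D.invol, if_pos k.2.1]
    · rw [hf1, if_neg h, D.rev_comm, D.invol, Fin.rev_rev, if_neg k.2.1.asymm]
  have hne : ∀ k, f k ≠ k := by
    intro k hk
    have h1 := congrArg Subtype.val hk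
    rw [hf1] at h1
    split_ifs at h1 with h
    · exact k.2.2 h1
    · exact D.invol_ne_rev hU k.1 (by rw [← Fin.rev_rev (D.σ k.1), h1])
  classical
  let F : Function.End D.HalfEnds := f
  have hF : F ^ 2 ^ 1 = 1 := by
    rw [pow_one, pow_two]
    exact funext hff
  have h1 := Equiv.Perm.card_fixedPoints_modEq hF
  have h2 : Fintype.card (Function.fixedPoints f) = 0 :=
    Fintype.card_eq_zero_iff.2 ⟨fun k => hne k.1 k.2⟩
  rw [Nat.even_iff]
  rw [h2] at h1
  exact h1

/-- The commutator space is the largest for involutions with the fewest fixed points. -/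
theorem card_halfEnds_le [CharZero K] {K' : Type*} [Field K'] [CharZero K'] (D' : ChordData N K')
    (a : BoundaryType) (hU : D.U ∈ selfAdj D.J ((a.sign : ℤ) : K))
    (hU' : D'.U ∈ selfAdj D'.J ((a.sign : ℤ) : K'))
    (h1 : a = .identified → ∀ k, k < k.rev → D'.σ k ≠ k)
    (h2 : a = .closed → ∀ k l, k < k.rev → l < l.rev → D'.σ k = k → D'.σ l = l → k = l) :
    Fintype.card D.HalfEnds ≤ Fintype.card D'.HalfEnds := by
  have h3 := D.card_halfEnds_add
  have h4 := D'.card_halfEnds_add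
  cases a with
  | identified =>
    have h5 : Fintype.card {k : Fin N // k < k.rev ∧ D'.σ k = k} = 0 :=
      Fintype.card_eq_zero_iff.2 ⟨fun k => h1 rfl k.1 k.2.1 k.2.2⟩
    omega
  | closed =>
    have h5 : Fintype.card {k : Fin N // k < k.rev ∧ D'.σ k = k} ≤ 1 :=
      Fintype.card_le_one_iff.2 fun k l => Subtype.ext (h2 rfl _ _ k.2.1 l.2.1 k.2.2 l.2.2)
    -- Both counts are even and at most the size of the first half, while the count for `D'` misses
    -- that size by at most one. Parity then gives the inequality.
    obtain ⟨p, hp⟩ := D.even_card_halfEnds (by simpa [BoundaryType.sign] using hU)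
    obtain ⟨q, hq⟩ := D'.even_card_halfEnds (by simpa [BoundaryType.sign] using hU')
    omega

/-- By duality the sum is the dimension of the strictly upper triangular matrices of type a plus the
excess of commutators over anticommutators. The excess is at most the number of half ends, it equals
or exceeds that number for `D'`, and `D'` has the most half ends. -/
theorem finrank_orbitTangent_add_fibre_le [CharZero K] {K' : Type*} [Field K'] [CharZero K']
    (D' : ChordData N K')
    (a : BoundaryType) (hU : D.U ∈ selfAdj D.J ((a.sign : ℤ) : K))
    (hU' : D'.U ∈ selfAdj D'.J ((a.sign : ℤ) : K'))
    (h1 : a = .identified → ∀ k, k < k.rev → D'.σ k ≠ k)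
    (h2 : a = .closed → ∀ k l, k < k.rev → l < l.rev → D'.σ k = k → D'.σ l = l → k = l)
    (hlink : ∀ k, k < k.rev → D'.σ k ≠ k → D'.σ k < (D'.σ k).rev ∨ D'.σ k = k.rev) :
    Module.finrank K (orbitTangent D.J D.U) +
        Module.finrank K (fibre D.J ((a.sign : ℤ) : K) D.U) ≤
      Module.finrank K' (orbitTangent D'.J D'.U) +
        Module.finrank K' (fibre D'.J ((a.sign : ℤ) : K') D'.U) := by
  have hs : ((a.sign : ℤ) : K) * ((a.sign : ℤ) : K) = 1 := by
    cases a <;> simp [BoundaryType.sign]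
  have hs' : ((a.sign : ℤ) : K') * ((a.sign : ℤ) : K') = 1 := by
    cases a <;> simp [BoundaryType.sign]
  have h3 := D.finrank_fibre_add hs hU
  have h4 := D'.finrank_fibre_add hs' hU'
  rw [finrank_strictUpperTri] at h3 h4
  have h5 := D.finrank_orbitTangent_le hU
  have h6 := D'.le_finrank_orbitTangent hlink
  have h7 := D.card_halfEnds_le D' a hU hU' h1 h2
  omega

end ChordData

/-! ### Normal form of square-zero triangular matrices -/

section NormalForm
variable {N : ℕ} {K : Type*} [Field K]

theorem mul_mem_upperTri {X Y : Matrix (Fin N) (Fin N) K} (hX : X ∈ upperTri N K)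
    (hY : Y ∈ upperTri N K) : X * Y ∈ upperTri N K :=
  Matrix.BlockTriangular.mul (b := id) hX hY

theorem one_mem_upperTri : (1 : Matrix (Fin N) (Fin N) K) ∈ upperTri N K :=
  Matrix.blockTriangular_one

theorem inv_mem_upperTri {X : Matrix (Fin N) (Fin N) K} (hX : X ∈ upperTri N K)
    (hdet : IsUnit X.det) : X⁻¹ ∈ upperTri N K := by
  let _ := X.invertibleOfIsUnitDet hdet
  exact Matrix.blockTriangular_inv_of_blockTriangular (b := id) hX

theorem isUnit_det_of_upperTri {X : Matrix (Fin N) (Fin N) K} (hX : X ∈ upperTri N K)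
    (h : ∀ i, X i i ≠ 0) : IsUnit X.det := by
  rw [Matrix.det_of_isUpperTriangular hX, isUnit_iff_ne_zero, Finset.prod_ne_zero_iff]
  exact fun i _ => h i

theorem diag_ne_zero_of_upperTri {X : Matrix (Fin N) (Fin N) K} (hX : X ∈ upperTri N K)
    (hdet : IsUnit X.det) (i : Fin N) : X i i ≠ 0 := by
  rw [Matrix.det_of_isUpperTriangular hX, isUnit_iff_ne_zero, Finset.prod_ne_zero_iff] at hdet
  exact hdet i (Finset.mem_univ i)

theorem pow_eq_zero_of_strictUpperTri {X : Matrix (Fin N) (Fin N) K}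
    (hX : X ∈ strictUpperTri N K) : X ^ N = 0 := by
  have key : ∀ k : ℕ, ∀ i j : Fin N, (j : ℕ) < i + k → (X ^ k) i j = 0 := by
    intro k
    induction k with
    | zero =>
      intro i j h
      rw [pow_zero, Matrix.one_apply_ne]
      rintro rfl
      omega
    | succ k ih =>
      intro i j h
      rw [pow_succ, Matrix.mul_apply]
      refine Finset.sum_eq_zero fun l _ => ?_
      by_cases h1 : (l : ℕ) < i + k
      · rw [ih i l h1, zero_mul]
      · rw [hX l j (Fin.le_def.2 (by omega)), mul_zero]
  ext i j
  exact key N i j (by omega)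

/-- A partial normal form of a square-zero strictly upper triangular matrix. -/
structure PartialForm (U : Matrix (Fin N) (Fin N) K) (m : ℕ) where
  σ : Fin N → Fin N
  invol : Function.Involutive σ
  g : Matrix (Fin N) (Fin N) K
  upper : g ∈ upperTri N K
  diag : ∀ i, g i i ≠ 0
  fix : ∀ k : Fin N, m ≤ k → σ k = k
  col : ∀ j : Fin N, (j : ℕ) < m → ∀ i, (U * g) i j = if σ j < j then g i (σ j) else 0

/-- One column at a time. Expand the next column of `U` in the basis `g`. The condition U² = 0 kills
the coefficients at right ends, and a change of the new basis vector removes those at left ends. The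
remainder `b` involves only unpaired vectors. If it vanishes the new index stays unpaired; otherwise
`b` replaces the last unpaired vector that occurs in it, and that index becomes the partner of the
new one. -/
theorem exists_partialForm {U : Matrix (Fin N) (Fin N) K} (hU : U ∈ strictUpperTri N K)
    (hUU : U * U = 0) (m : ℕ) (hm : m ≤ N) : Nonempty (PartialForm U m) := by
  classical
  induction m with
  | zero =>
    exact ⟨⟨id, fun _ => rfl, 1, one_mem_upperTri, fun i => by simp, fun _ _ => rfl,
      fun j hj => absurd hj (Nat.not_lt_zero _)⟩⟩
  | succ m ih =>
    obtain ⟨F⟩ := ih (by omega)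
    obtain ⟨σ, invol, g, upper, diag, fix, col⟩ := F
    let μ : Fin N := ⟨m, hm⟩
    have hσμ : σ μ = μ := fix μ le_rfl
    have hdet : IsUnit g.det := isUnit_det_of_upperTri upper diag
    -- the coordinates of the column of `U`
    let c : Fin N → K := fun i => (g⁻¹ * U) i μ
    have hUc : ∀ i, U i μ = ∑ j, g i j * c j := by
      intro i
      have : U = g * (g⁻¹ * U) := by rw [← mul_assoc, Matrix.mul_nonsing_inv _ hdet, one_mul]
      conv_lhs => rw [this, Matrix.mul_apply]
    have hc : ∀ j : Fin N, m ≤ j → c j = 0 := by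
      intro j hj
      change (g⁻¹ * U) j μ = 0
      rw [Matrix.mul_apply]
      refine Finset.sum_eq_zero fun k _ => ?_
      by_cases h : k < j
      · rw [inv_mem_upperTri upper hdet j k h, zero_mul]
      · rw [hU k μ (Fin.le_def.2 (hj.trans (Fin.le_def.1 (not_lt.1 h)))), mul_zero]
    have hinj : ∀ v : Fin N → K, (∀ i, ∑ j, g i j * v j = 0) → v = 0 := by
      intro v hv
      have h1 : g.mulVec v = 0 := funext hv
      have h2 : g⁻¹.mulVec (g.mulVec v) = v := by
        rw [Matrix.mulVec_mulVec, Matrix.nonsing_inv_mul _ hdet, Matrix.one_mulVec]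
      rw [← h2, h1, Matrix.mulVec_zero]
    have hlt : ∀ j : Fin N, σ j ≠ j → (j : ℕ) < m := by
      intro j hj
      by_contra h
      exact hj (fix j (not_lt.1 h))
    -- Since `U` moves the basis vector at a right end to the one at its partner, applying `U` twice
    -- to the new unit vector gives a combination of vectors at left ends with these coefficients.
    have hclose : ∀ j, σ j < j → c j = 0 := by
      have h1 : (fun i => if i < σ i then c (σ i) else 0) = (0 : Fin N → K) := by
        apply hinj
        intro i
        have h2 : (U * U) i μ = 0 := by rw [hUU]; rfl
        rw [Matrix.mul_apply] at h2
        simp only [hUc, Finset.mul_sum] at h2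
        rw [Finset.sum_comm] at h2
        have h3 : ∀ j, ∑ k, U i k * (g k j * c j) = (if σ j < j then g i (σ j) * c j else 0) := by
          intro j
          by_cases hj : (j : ℕ) < m
          · have h4 := col j hj i
            rw [Matrix.mul_apply] at h4
            simp only [← mul_assoc]
            rw [← Finset.sum_mul, h4, ite_mul, zero_mul]
          · simp [hc j (not_lt.1 hj)]
        simp only [h3] at h2
        refine Eq.trans ?_ h2
        rw [← Equiv.sum_comp invol.toPerm]
        refine Finset.sum_congr rfl fun j _ => ?_
        simp only [Function.Involutive.coe_toPerm, invol j, mul_ite, mul_zero]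
      intro j hj
      have h2 := congrFun h1 (σ j)
      simpa [invol j, hj] using h2
    let d : Fin N → K := fun j => if σ j = j then c j else 0
    -- The new basis vector: the unit vector corrected by vectors at right ends, so that its image
    -- under `U` has no component at left ends.
    let w : Fin N → K := fun i => (if i = μ then 1 else 0) - ∑ k, g i k * (if σ k < k then c (σ k) else 0)
    let b : Fin N → K := fun i => ∑ j, g i j * d j
    have hw1 : w μ = 1 := by
      simp only [w, if_true, sub_eq_self]
      refine Finset.sum_eq_zero fun k _ => ?_
      split_ifs with h
      · rw [upper μ k (Fin.lt_def.2 (hlt k h.ne)), zero_mul]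
      · simp
    have hw2 : ∀ i, μ < i → w i = 0 := by
      intro i hi
      simp only [w, hi.ne', if_false, zero_sub, neg_eq_zero]
      refine Finset.sum_eq_zero fun k _ => ?_
      split_ifs with h
      · rw [upper i k (lt_trans (Fin.lt_def.2 (hlt k h.ne)) hi), zero_mul]
      · simp
    have hUw : ∀ i, ∑ k, U i k * w k = b i := by
      intro i
      simp only [w, mul_sub, Finset.sum_sub_distrib, mul_ite, mul_one, mul_zero,
        Finset.sum_ite_eq', Finset.mem_univ, if_true, hUc, Finset.mul_sum]
      rw [Finset.sum_comm, ← sub_eq_zero]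
      have h3 : ∀ j, ∑ k, (if σ j < j then U i k * (g k j * c (σ j)) else 0) =
          (if σ j < j then g i (σ j) * c (σ j) else 0) := by
        intro j
        split_ifs with h
        · have h4 := col j (hlt j h.ne) i
          rw [Matrix.mul_apply, if_pos h] at h4
          simp only [← mul_assoc]
          rw [← Finset.sum_mul, h4]
        · simp
      simp only [h3]
      rw [← Equiv.sum_comp invol.toPerm (fun j => if σ j < j then g i (σ j) * c (σ j) else 0)]
      simp only [Function.Involutive.coe_toPerm, invol _, b]
      rw [← Finset.sum_sub_distrib, ← Finset.sum_sub_distrib]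
      refine Finset.sum_eq_zero fun j _ => ?_
      rcases lt_trichotomy (σ j) j with h | h | h
      · simp [hclose j h, d]
      · simp [d, h]
      · simp [d, h.ne', h]
    by_cases hd : ∀ j, d j = 0
    · have hb : ∀ i, b i = 0 := fun i => by simp [b, hd]
      refine ⟨⟨σ, invol, g.updateCol μ w, ?_, ?_, fun k hk => fix k (by omega), ?_⟩⟩
      · intro i j hij
        rw [Matrix.updateCol_apply]
        split_ifs with h
        · exact hw2 i (h ▸ hij)
        · exact upper i j hij
      · intro i
        rw [Matrix.updateCol_apply]
        split_ifs with h
        · rw [h, hw1]; exact one_ne_zero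
        · exact diag i
      · intro j hj i
        rw [Matrix.mul_apply]
        simp only [Matrix.updateCol_apply]
        by_cases h : j = μ
        · simp only [h, if_true, hσμ, lt_irrefl, if_false, hUw, hb]
        · have h1 : (j : ℕ) < m := by
            have : (j : ℕ) ≠ m := fun h2 => h (Fin.ext h2)
            omega
          have h2 := col j h1 i
          rw [Matrix.mul_apply] at h2
          simp only [h, if_false, h2]
          split_ifs with h3 h4
          · exact absurd h3 (by rw [h4, Fin.lt_def]; exact h1.not_gt)
          · rfl
          · rfl
    · push Not at hd
      obtain ⟨j0, hj0⟩ := hd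
      -- Taking the largest index keeps `g` upper triangular with nonzero diagonal after column ι is
      -- replaced by `b`.
      obtain ⟨ι, hι, hmax⟩ := (Finset.univ.filter fun j => d j ≠ 0).exists_max_image id
        ⟨j0, by simpa using hj0⟩
      have hι' : d ι ≠ 0 := by simpa using hι
      have hmax' : ∀ j, ι < j → d j = 0 := by
        intro j hj
        by_contra h
        exact absurd (hmax j (by simpa using h)) (not_le.2 hj)
      have hσι : σ ι = ι := by
        by_contra h
        exact hι' (by simp [d, h])
      have hιm : (ι : ℕ) < m := by
        by_contra h
        exact hι' (by simp [d, hc ι (not_lt.1 h)])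
      have hιμ : ι < μ := Fin.lt_def.2 hιm
      have hb1 : b ι ≠ 0 := by
        have : b ι = g ι ι * d ι := by
          refine Finset.sum_eq_single ι (fun j _ hj => ?_) (by simp)
          rcases lt_or_gt_of_ne hj with h | h
          · rw [upper ι j h, zero_mul]
          · rw [hmax' j h, mul_zero]
        rw [this]
        exact mul_ne_zero (diag ι) hι'
      have hb2 : ∀ i, ι < i → b i = 0 := by
        intro i hi
        refine Finset.sum_eq_zero fun j _ => ?_
        rcases le_or_gt j ι with h | h
        · rw [upper i j (h.trans_lt hi), zero_mul]
        · rw [hmax' j h, mul_zero]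
      have hUb : ∀ i, ∑ k, U i k * b k = 0 := by
        intro i
        simp only [← hUw, Finset.mul_sum]
        rw [Finset.sum_comm]
        refine Finset.sum_eq_zero fun k _ => ?_
        have h2 : (U * U) i k = 0 := by rw [hUU]; rfl
        rw [Matrix.mul_apply] at h2
        simp only [← mul_assoc]
        rw [← Finset.sum_mul, h2, zero_mul]
      let τ : Fin N → Fin N := fun k => if k = ι then μ else if k = μ then ι else σ k
      have hσne1 : ∀ k, k ≠ ι → σ k ≠ ι := fun k h h2 => h (by rw [← invol k, h2, hσι])
      have hσne2 : ∀ k, k ≠ μ → σ k ≠ μ := fun k h h2 => h (by rw [← invol k, h2, hσμ])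
      have hg : ∀ i j, ((g.updateCol μ w).updateCol ι b) i j =
          if j = ι then b i else if j = μ then w i else g i j := by
        intro i j
        rw [Matrix.updateCol_apply, Matrix.updateCol_apply]
      refine ⟨⟨τ, ?_, (g.updateCol μ w).updateCol ι b, ?_, ?_, ?_, ?_⟩⟩
      · intro k
        by_cases h1 : k = ι
        · simp [τ, h1, hιμ.ne']
        · by_cases h2 : k = μ
          · simp [τ, h2, hιμ.ne']
          · simp [τ, h1, h2, hσne1, hσne2, invol k]
      · intro i j hij
        rw [hg]
        split_ifs with h1 h2
        · exact hb2 i (h1 ▸ hij)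
        · exact hw2 i (h2 ▸ hij)
        · exact upper i j hij
      · intro i
        rw [hg]
        split_ifs with h1 h2
        · rw [h1]; exact hb1
        · rw [h2, hw1]; exact one_ne_zero
        · exact diag i
      · intro k hk
        have h1 : k ≠ ι := by rintro rfl; omega
        have h2 : k ≠ μ := by
          rintro rfl
          exact absurd hk (by simp [μ])
        simp only [τ, h1, h2, if_false]
        exact fix k (by omega)
      · intro j hj i
        rw [Matrix.mul_apply]
        simp only [hg]
        by_cases h1 : j = ι
        · simp only [h1, if_true, hUb, τ, hιμ.asymm, if_false]
        · by_cases h2 : j = μ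
          · simp only [h2, hιμ.ne', if_true, if_false, hUw, τ, hιμ]
          · have h3 : (j : ℕ) < m := by
              have : (j : ℕ) ≠ m := fun h2' => h2 (Fin.ext h2')
              omega
            have h4 := col j h3 i
            rw [Matrix.mul_apply] at h4
            simp only [h1, h2, if_false, τ, h4, hσne1 j h1, hσne2 j h2]


/-- Square roots of unipotent elements are polynomials in them. -/
theorem exists_polynomial_sq (K : Type*) [Field K] [CharZero K] (N : ℕ) :
    ∃ p : Polynomial K, (Polynomial.X - 1) ^ N ∣ p ^ 2 - Polynomial.X := by
  let I : Ideal (Polynomial K) := Ideal.span {(Polynomial.X - 1) ^ N}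
  let S := Polynomial K ⧸ I
  let x : S := Ideal.Quotient.mk I Polynomial.X
  have hx : IsNilpotent (1 - x) := by
    refine ⟨N, ?_⟩
    have : (1 - x) ^ N = Ideal.Quotient.mk I ((1 - Polynomial.X) ^ N) := by simp [x]
    rw [this, Ideal.Quotient.eq_zero_iff_mem, Ideal.mem_span_singleton]
    exact pow_dvd_pow_of_dvd ⟨-1, by ring⟩ N
  -- Newton lifting of the approximate root 1 of T² - x, which is valid because 1 - x is nilpotent
  -- and 2 is invertible.
  obtain ⟨r, ⟨-, hr⟩, -⟩ := Polynomial.existsUnique_nilpotent_sub_and_aeval_eq_zero (R := S)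
    (S := S) (P := Polynomial.X ^ 2 - Polynomial.C x) (x := 1) (by simpa using hx) (by
      have h2 : IsUnit (2 : K) := isUnit_iff_ne_zero.2 two_ne_zero
      have h3 := h2.map (algebraMap K S)
      rw [map_ofNat] at h3
      simpa [one_add_one_eq_two] using h3)
  obtain ⟨p, rfl⟩ := Ideal.Quotient.mk_surjective r
  refine ⟨p, ?_⟩
  rw [← Ideal.mem_span_singleton, ← Ideal.Quotient.eq_zero_iff_mem]
  simpa using hr

/-- The normal form of square-zero strictly upper triangular self-adjoint matrices under upper
triangular changes of basis: the symplectic form becomes antidiagonal. -/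
theorem exists_chordData [CharZero K] {J U : Matrix (Fin N) (Fin N) K} {s : K} (hs : s * s = 1)
    (hJ0 : ∀ i j, j ≠ i.rev → J i j = 0) (hJ1 : ∀ i, J i i.rev ≠ 0)
    (hJ2 : ∀ i, J i.rev i = - J i i.rev) (hU : U ∈ strictUpperTri N K) (hUU : U * U = 0)
    (hUJ : U ∈ selfAdj J s) :
    ∃ (D : ChordData N K) (g : Matrix (Fin N) (Fin N) K), g ∈ upperTri N K ∧ IsUnit g.det ∧
      g.transpose * J * g = D.J ∧ U * g = g * D.U ∧ (∀ k, D.u k = 1) ∧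
      D.U ∈ selfAdj D.J s := by
  obtain ⟨⟨σ, invol, g, upper, diag, fix, col⟩⟩ := exists_partialForm hU hUU N le_rfl
  have hs0 : s ≠ 0 := by
    rintro rfl
    simp at hs
  have hdet : IsUnit g.det := isUnit_det_of_upperTri upper diag
  let R : Matrix (Fin N) (Fin N) K := Matrix.of fun i j => if i < j ∧ σ j = i then 1 else 0
  have hmulR : ∀ (X : Matrix (Fin N) (Fin N) K) k l,
      (X * R) k l = if σ l < l then X k (σ l) else 0 := by
    intro X k l
    rw [Matrix.mul_apply, Finset.sum_eq_single (σ l)]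
    · simp [R]
    · intro b _ hb
      simp [R, hb.symm]
    · simp
  have hRmul : ∀ (X : Matrix (Fin N) (Fin N) K) k l,
      (R.transpose * X) k l = if σ k < k then X (σ k) l else 0 := by
    intro X k l
    rw [Matrix.mul_apply, Finset.sum_eq_single (σ k)]
    · simp [R]
    · intro b _ hb
      simp [R, hb.symm]
    · simp
  have hUg : U * g = g * R := by
    ext i j
    rw [hmulR, col j j.2]
  obtain ⟨J', hJdef⟩ : ∃ J', J' = g.transpose * J * g := ⟨_, rfl⟩
  have hJ' : J'.transpose = - J' := by
    have h1 : J.transpose = - J := by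
      ext i j
      rw [Matrix.transpose_apply, Matrix.neg_apply]
      by_cases h : j = i.rev
      · rw [h, hJ2]
      · rw [hJ0 i j h, hJ0 j i, neg_zero]
        rintro rfl
        simp at h
    simp only [hJdef, Matrix.transpose_mul, Matrix.transpose_transpose, h1, Matrix.mul_assoc,
      Matrix.neg_mul, Matrix.mul_neg]
  have hRJ : R.transpose * J' = s • (J' * R) := by
    have h1 : U.transpose * J = s • (J * U) := hUJ
    calc R.transpose * J' = (g * R).transpose * J * g := by
          simp only [hJdef, Matrix.transpose_mul, Matrix.mul_assoc]
      _ = g.transpose * (U.transpose * J) * g := by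
          rw [← hUg, Matrix.transpose_mul, Matrix.mul_assoc g.transpose]
      _ = s • (g.transpose * J * (U * g)) := by
          rw [h1]
          simp only [Matrix.mul_smul, Matrix.smul_mul, Matrix.mul_assoc]
      _ = s • (J' * R) := by
          rw [hUg]
          simp only [hJdef, Matrix.mul_assoc]
  have hJsum : ∀ a b, J' a b = ∑ k, g k a * J k k.rev * g k.rev b := by
    intro a b
    rw [hJdef, Matrix.mul_assoc, Matrix.mul_apply]
    refine Finset.sum_congr rfl fun k _ => ?_
    rw [Matrix.mul_apply, Finset.sum_eq_single k.rev]
    · rw [Matrix.transpose_apply, mul_assoc]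
    · intro c _ hc
      rw [hJ0 k c hc, zero_mul]
    · simp
  -- In the new basis the form is zero before the antidiagonal and nonzero on it; entries beyond it
  -- may survive and are removed below.
  have hJlow : ∀ a b, b < a.rev → J' a b = 0 := by
    intro a b hab
    rw [hJsum]
    refine Finset.sum_eq_zero fun k _ => ?_
    rcases lt_or_ge a k with h | h
    · rw [upper k a h, zero_mul, zero_mul]
    · rw [upper k.rev b (hab.trans_le (Fin.rev_le_rev.2 h)), mul_zero]
  have hJanti : ∀ a, J' a a.rev ≠ 0 := by
    intro a
    rw [hJsum, Finset.sum_eq_single a]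
    · exact mul_ne_zero (mul_ne_zero (diag a) (hJ1 a)) (diag a.rev)
    · intro k _ hk
      rcases lt_or_gt_of_ne hk with h | h
      · rw [upper k.rev a.rev (Fin.rev_lt_rev.2 h), mul_zero]
      · rw [upper k a h, zero_mul, zero_mul]
    · simp
  have hJle : ∀ a b, J' a b ≠ 0 → a.rev ≤ b := fun a b h => not_lt.1 fun h2 => h (hJlow a b h2)
  have hRJ' : ∀ k l, (if σ k < k then J' (σ k) l else 0) =
      s * (if σ l < l then J' k (σ l) else 0) := by
    intro k l
    have := congrFun (congrFun hRJ k) l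
    rwa [hRmul, Matrix.smul_apply, hmulR] at this
  -- Compare the two sides of the self-adjointness relation at (k, rev (σ k)): on the left stands a
  -- nonzero antidiagonal entry of `J'`.
  have hclosing : ∀ k, σ k < k → σ (σ k).rev < (σ k).rev ∧ k.rev ≤ σ (σ k).rev := by
    intro k hk
    have h1 := hRJ' k (σ k).rev
    rw [if_pos hk] at h1
    have h2 := hJanti (σ k)
    rw [h1] at h2
    split_ifs at h2 with h3
    · exact ⟨h3, hJle _ _ (right_ne_zero_of_mul h2)⟩
    · simp at h2
  -- The map k ↦ rev (σ k) on right ends is injective and its square does not increase k. By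
  -- well-founded induction the square is the identity, so σ commutes with reversal.
  have hclosing' : ∀ k, σ k < k → σ (σ k).rev = k.rev := by
    let C := {k : Fin N // σ k < k}
    let ψ : C → C := fun k => ⟨(σ k.1).rev, (hclosing k.1 k.2).1⟩
    have hψ : Function.Injective ψ := by
      intro k l h
      have h1 : (σ k.1).rev = (σ l.1).rev := congrArg Subtype.val h
      exact Subtype.ext (invol.injective (Fin.rev_inj.1 h1))
    have hψ2 : ∀ k, ψ (ψ k) ≤ k := by
      intro k
      change (σ (σ k.1).rev).rev ≤ k.1
      rw [← Fin.rev_rev k.1]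
      simpa using Fin.rev_le_rev.2 (hclosing k.1 k.2).2
    have hfix : ∀ k, ψ (ψ k) = k := by
      intro k
      induction k using WellFoundedLT.induction with
      | ind k ih =>
        rcases (hψ2 k).lt_or_eq with h | h
        · exact absurd (hψ (hψ (ih _ h))) h.ne
        · exact h
    intro k hk
    have h1 : (σ (σ k).rev).rev = k := congrArg Subtype.val (hfix ⟨k, hk⟩)
    rw [← Fin.rev_rev (σ (σ k).rev), h1]
  have hrev : ∀ k, σ k.rev = (σ k).rev := by
    have h1 : ∀ k, σ k < k → σ k.rev = (σ k).rev := fun k hk => by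
      rw [← hclosing' k hk, invol]
    have h2 : ∀ k, k < σ k → σ k.rev = (σ k).rev := fun k hk => by
      have h3 := hclosing' (σ k) (by rwa [invol])
      rwa [invol] at h3
    have h3 : ∀ k, σ k ≠ k → σ k.rev = (σ k).rev := fun k hk =>
      (lt_or_gt_of_ne hk).elim (h1 k) (h2 k)
    intro k
    by_cases h : σ k = k
    · rw [h]
      by_contra h4
      have h5 := h3 k.rev h4
      rw [Fin.rev_rev, h] at h5
      rw [← Fin.rev_rev (σ k.rev), ← h5] at h4
      exact h4 rfl
    · exact h3 k h
  let J0 : Matrix (Fin N) (Fin N) K := Matrix.of fun a b => if b = a.rev then J' a b else 0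
  have hJ0a : ∀ a, J0 a a.rev = J' a a.rev := fun a => by simp [J0]
  have hJ'anti : ∀ a b, J' b a = - J' a b := fun a b => congrFun (congrFun hJ' a) b
  let D : ChordData N K :=
    { σ := σ
      invol := invol
      rev_comm := hrev
      u := fun _ => 1
      u_ne := fun _ _ => one_ne_zero
      J := J0
      J_eq_zero := fun i j h => by simp [J0, h]
      J_ne := fun i => by rw [hJ0a]; exact hJanti i
      J_anti := fun i => by
        simp only [J0, Matrix.of_apply, Fin.rev_rev, if_true]
        exact hJ'anti _ _ }
  have hDU : D.U = R := rfl
  have hRJ0 : R.transpose * J0 = s • (J0 * R) := by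
    ext k l
    rw [hRmul, Matrix.smul_apply, hmulR, smul_eq_mul]
    by_cases h : l = (σ k).rev
    · have h1 : σ l = k.rev := by rw [h, hrev, invol]
      have h2 := hRJ' k l
      have h3 : σ l < l ↔ σ k < k := by
        rw [h1, h, Fin.rev_lt_rev]
      simp only [h3] at h2 ⊢
      rw [h1] at h2 ⊢
      simp only [J0, Matrix.of_apply, if_true]
      rw [if_pos h]
      exact h2
    · have h1 : σ l ≠ k.rev := by
        intro h1
        apply h
        rw [← hrev, ← h1, invol]
      simp [J0, h, h1]
  have hJ0det : IsUnit J0.det := by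
    let Q : Matrix (Fin N) (Fin N) K := Matrix.of fun a b => if b = a.rev then (J0 b a)⁻¹ else 0
    refine Matrix.isUnit_det_of_right_inverse (B := Q) ?_
    ext a b
    rw [Matrix.mul_apply, Finset.sum_eq_single a.rev, hJ0a, Matrix.one_apply]
    · by_cases h : a = b
      · subst h
        simp [Q, hJ0a, hJanti]
      · have : b ≠ a := Ne.symm h
        simp [Q, h, this]
    · intro c _ hc
      simp [J0, hc]
    · simp
  have hJ0t : J0.transpose = - J0 := by
    ext a b
    by_cases h : b = a.rev
    · subst h
      rw [Matrix.transpose_apply, Matrix.neg_apply]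
      exact D.J_anti a
    · have : a ≠ b.rev := by
        rintro rfl
        simp at h
      simp [J0, h, this]
  -- The quotient of `J'` by its antidiagonal part is unipotent, commutes with `R` and is
  -- self-adjoint for `J0`. A square root y that is a polynomial in it shares the last two
  -- properties, so yᵀ J0 y = J' and g y⁻¹ makes the form antidiagonal without changing `R`.
  obtain ⟨h, hJh⟩ : ∃ h, J0 * h = J' := ⟨J0⁻¹ * J', Matrix.mul_nonsing_inv_cancel_left _ _ hJ0det⟩
  have hcomm : h * R = R * h := by
    have h1 : J0 * (h * R) = J0 * (R * h) := by
      have h2 : s • (J0 * (h * R)) = s • (J0 * (R * h)) := by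
        rw [← mul_assoc, hJh, ← hRJ, ← mul_assoc J0 R, ← Matrix.smul_mul, ← hRJ0, mul_assoc, hJh]
      exact smul_right_injective _ hs0 h2
    rw [← Matrix.nonsing_inv_mul_cancel_left J0 (h * R) hJ0det, h1,
      Matrix.nonsing_inv_mul_cancel_left J0 _ hJ0det]
  have hsym : h.transpose * J0 = J0 * h := by
    have h1 := congrArg Matrix.transpose hJh
    rw [Matrix.transpose_mul, hJ0t, hJ', mul_neg, neg_inj] at h1
    rw [h1, hJh]
  have hentry : ∀ a b, J0 a a.rev * h a.rev b = J' a b := by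
    intro a b
    rw [← hJh, Matrix.mul_apply, Finset.sum_eq_single a.rev]
    · intro c _ hc
      simp [J0, hc]
    · simp
  have hup : h ∈ upperTri N K := by
    intro a b hab
    have h1 := hentry a.rev b
    rw [Fin.rev_rev, hJlow a.rev b (by rwa [Fin.rev_rev])] at h1
    refine (mul_eq_zero.1 h1).resolve_left ?_
    have := D.J_ne a.rev
    rwa [Fin.rev_rev] at this
  have hunip : ∀ a, h a a = 1 := by
    intro a
    have h1 := hentry a.rev a
    have h2 := hJ0a a.rev
    have h3 := hJanti a.rev
    rw [Fin.rev_rev] at h1 h2 h3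
    rw [h2] at h1
    exact mul_left_cancel₀ h3 (h1.trans (mul_one _).symm)
  have hnil : (h - 1) ^ N = 0 := by
    refine pow_eq_zero_of_strictUpperTri fun a b hab => ?_
    rw [Matrix.sub_apply]
    rcases hab.lt_or_eq with h1 | rfl
    · rw [hup a b h1, Matrix.one_apply_ne h1.ne', sub_zero]
    · rw [hunip, Matrix.one_apply_eq, sub_self]
  obtain ⟨p, q, hpq⟩ := exists_polynomial_sq K N
  let y := Polynomial.aeval h p
  have hyy : y * y = h := by
    have h1 := congrArg (Polynomial.aeval h) hpq
    simp only [map_sub, map_pow, Polynomial.aeval_X, map_mul, map_one, hnil, zero_mul] at h1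
    rw [← pow_two]
    exact sub_eq_zero.1 h1
  have hhdet : IsUnit h.det := isUnit_det_of_upperTri hup fun i => by simp [hunip]
  have hydet : IsUnit y.det := by
    rw [← hyy, Matrix.det_mul] at hhdet
    exact isUnit_of_mul_isUnit_left hhdet
  have hypow : ∀ k : ℕ, (h ^ k) ∈ upperTri N K ∧ (h ^ k).transpose * J0 = J0 * h ^ k := by
    intro k
    induction k with
    | zero => exact ⟨by simpa using one_mem_upperTri, by simp⟩
    | succ k ih =>
      refine ⟨by rw [pow_succ]; exact mul_mem_upperTri ih.1 hup, ?_⟩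
      rw [pow_succ, Matrix.transpose_mul, mul_assoc, ih.2, ← mul_assoc, hsym, mul_assoc,
        ← pow_succ', ← pow_succ]
  have hysum : y = p.sum fun e c => c • h ^ e := Polynomial.aeval_eq_sum_range' (lt_add_one _) h |>.trans (by
    rw [Polynomial.sum_over_range]
    simp)
  have hyup : y ∈ upperTri N K := by
    rw [hysum]
    exact Submodule.sum_mem _ fun e _ => Submodule.smul_mem _ _ (hypow e).1
  have hysym : y.transpose * J0 = J0 * y := by
    rw [hysum]
    simp only [Polynomial.sum, Matrix.transpose_sum, Matrix.transpose_smul, Finset.sum_mul,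
      Finset.mul_sum, Matrix.smul_mul, Matrix.mul_smul, (hypow _).2]
  have hycomm : y * R = R * y := by
    have h1 : Commute h R := hcomm
    rw [hysum]
    simp only [Polynomial.sum, Finset.sum_mul, Finset.mul_sum, Matrix.smul_mul, Matrix.mul_smul,
      (h1.pow_left _).eq]
  refine ⟨D, g * y⁻¹, mul_mem_upperTri upper (inv_mem_upperTri hyup hydet), ?_, ?_, ?_, fun _ => rfl,
    hRJ0⟩
  · rw [Matrix.det_mul]
    exact hdet.mul (Matrix.isUnit_nonsing_inv_det y hydet)
  · have h1 : J' = y.transpose * J0 * y := by rw [hysym, mul_assoc, hyy, hJh]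
    calc (g * y⁻¹).transpose * J * (g * y⁻¹) = (y⁻¹).transpose * J' * y⁻¹ := by
          rw [hJdef, Matrix.transpose_mul]
          simp only [mul_assoc]
      _ = (y * y⁻¹).transpose * J0 * (y * y⁻¹) := by
          rw [h1, Matrix.transpose_mul]
          simp only [mul_assoc]
      _ = J0 := by
          rw [Matrix.mul_nonsing_inv _ hydet, Matrix.transpose_one, one_mul, mul_one]
  · rw [hDU, ← mul_assoc, hUg, mul_assoc, mul_assoc]
    congr 1
    rw [← Matrix.nonsing_inv_mul_cancel_left y (R * y⁻¹) hydet, ← mul_assoc y R, hycomm, mul_assoc R,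
      Matrix.mul_nonsing_inv _ hydet, mul_one]


/-- Conjugation by an upper triangular `g` carries one Borel Lie algebra into the other, and
commutators to commutators. -/
theorem finrank_orbitTangent_le_of_conj {J J' U U' g : Matrix (Fin N) (Fin N) K}
    (hg : g ∈ upperTri N K) (hdet : IsUnit g.det) (hJ : g.transpose * J * g = J')
    (hU : U * g = g * U') :
    Module.finrank K (orbitTangent J U) ≤ Module.finrank K (orbitTangent J' U') := by
  let f : Matrix (Fin N) (Fin N) K →ₗ[K] Matrix (Fin N) (Fin N) K :=
    LinearMap.mulLeft K g ∘ₗ LinearMap.mulRight K g⁻¹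
  have hf : ∀ X, f X = g * (X * g⁻¹) := fun X => rfl
  have hU' : U = g * (U' * g⁻¹) := by
    rw [← mul_assoc, ← hU, mul_assoc, Matrix.mul_nonsing_inv _ hdet, mul_one]
  refine (Submodule.finrank_mono (t := (orbitTangent J' U').map f) ?_).trans
    (Submodule.finrank_map_le _ _)
  rintro _ ⟨X, hX, rfl⟩
  refine ⟨_, ⟨g⁻¹ * X * g, ⟨?_, ?_⟩, rfl⟩, ?_⟩
  · exact mul_mem_upperTri (mul_mem_upperTri (inv_mem_upperTri hg hdet) hX.1) hg
  · have h1 : X.transpose * J = (-1 : K) • (J * X) := hX.2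
    change (g⁻¹ * X * g).transpose * J' = (-1 : K) • (J' * (g⁻¹ * X * g))
    have h2 : (g⁻¹).transpose * g.transpose = 1 := by
      rw [← Matrix.transpose_mul, Matrix.mul_nonsing_inv _ hdet, Matrix.transpose_one]
    have h3 : g * g⁻¹ = 1 := Matrix.mul_nonsing_inv _ hdet
    calc (g⁻¹ * X * g).transpose * J'
        = g.transpose * (X.transpose * (((g⁻¹).transpose * g.transpose) * J)) * g := by
          rw [← hJ, Matrix.transpose_mul, Matrix.transpose_mul]
          simp only [mul_assoc]
      _ = (-1 : K) • (g.transpose * J * ((g * g⁻¹) * X * g)) := by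
          rw [h2, one_mul, h1, h3]
          simp only [Matrix.mul_smul, Matrix.smul_mul, mul_assoc, one_mul]
      _ = _ := by
          rw [← hJ]
          simp only [mul_assoc]
  · have h3 : g * g⁻¹ = 1 := Matrix.mul_nonsing_inv _ hdet
    have h4 : g⁻¹ * g = 1 := Matrix.nonsing_inv_mul _ hdet
    rw [hf, adMap_apply, adMap_apply]
    calc g * ((g⁻¹ * X * g * U' - U' * (g⁻¹ * X * g)) * g⁻¹)
        = (g * g⁻¹) * X * (g * (U' * g⁻¹)) - g * (U' * g⁻¹) * X * (g * g⁻¹) := by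
          simp only [mul_sub, sub_mul, mul_assoc]
      _ = X * U - U * X := by rw [← hU', h3, one_mul, mul_one]

/-- The strictly lower triangular part. -/
def lowerPart {R : Type*} [CommRing R] : Matrix (Fin N) (Fin N) R →ₗ[R] Matrix (Fin N) (Fin N) R where
  toFun X := Matrix.of fun i j => if j < i then X i j else 0
  map_add' X Y := by
    ext i j
    by_cases h : j < i <;> simp [h]
  map_smul' r X := by
    ext i j
    by_cases h : j < i <;> simp [h]

theorem lowerPart_apply {R : Type*} [CommRing R] (X : Matrix (Fin N) (Fin N) R) (i j : Fin N) :
    lowerPart X i j = if j < i then X i j else 0 := rfl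

theorem sub_lowerPart_mem (X : Matrix (Fin N) (Fin N) K) : X - lowerPart X ∈ upperTri N K := by
  intro i j h
  simp [lowerPart_apply, h]

theorem lowerPart_mem (X : Matrix (Fin N) (Fin N) K) : lowerPart X ∈ strictLowerTri N K := by
  intro i j h
  simp [lowerPart_apply, h.not_gt]

theorem ChordData.lowerPart_mem_selfAdj (D : ChordData N K) {s : K}
    {X : Matrix (Fin N) (Fin N) K} (hX : X ∈ selfAdj D.J s) : lowerPart X ∈ selfAdj D.J s := by
  rw [D.mem_selfAdj] at hX ⊢
  intro a b
  simp only [lowerPart_apply, Fin.rev_lt_rev]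
  split_ifs
  · exact hX a b
  · simp

/-- A lower part matters only modulo upper triangular matrices, and these are stable under
conjugation by `g`. So conjugating and then truncating is injective, and the truncation changes the
anticommutator by an upper triangular matrix only. -/
theorem finrank_fibre_le_of_conj (D : ChordData N K) {J U g : Matrix (Fin N) (Fin N) K} {s : K}
    (hg : g ∈ upperTri N K) (hdet : IsUnit g.det) (hJ : g.transpose * J * g = D.J)
    (hU : U * g = g * D.U) :
    Module.finrank K (fibre J s U) ≤ Module.finrank K (fibre D.J s D.U) := by
  have h2 : (g⁻¹).transpose * g.transpose = 1 := by
    rw [← Matrix.transpose_mul, Matrix.mul_nonsing_inv _ hdet, Matrix.transpose_one]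
  have h3 : g * g⁻¹ = 1 := Matrix.mul_nonsing_inv _ hdet
  have h4 : g⁻¹ * g = 1 := Matrix.nonsing_inv_mul _ hdet
  have hg' : g⁻¹ ∈ upperTri N K := inv_mem_upperTri hg hdet
  have hUup : D.U ∈ upperTri N K := by
    intro i j h
    simp [ChordData.U, h.asymm]
  let f : Matrix (Fin N) (Fin N) K →ₗ[K] Matrix (Fin N) (Fin N) K :=
    LinearMap.mulLeft K g⁻¹ ∘ₗ LinearMap.mulRight K g
  have hf : ∀ X, f X = g⁻¹ * (X * g) := fun X => rfl
  have hinj : Function.Injective ((lowerPart ∘ₗ f).domRestrict (fibre J s U)) := by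
    rw [injective_iff_map_eq_zero]
    rintro ⟨X, hX⟩ h
    have h5 : f X ∈ upperTri N K := by
      have h6 : lowerPart (f X) = 0 := h
      have h7 := sub_lowerPart_mem (f X)
      rwa [h6, sub_zero] at h7
    have h6 : X = g * f X * g⁻¹ := by
      rw [hf]
      calc X = (g * g⁻¹) * X * (g * g⁻¹) := by rw [h3, one_mul, mul_one]
        _ = _ := by simp only [mul_assoc]
    have h7 : X ∈ upperTri N K := by
      rw [h6]
      exact mul_mem_upperTri (mul_mem_upperTri hg h5) hg'
    apply Subtype.ext
    ext i j
    rcases lt_or_ge j i with h8 | h8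
    · exact h7 i j h8
    · exact hX.1.1 i j h8
  rw [← LinearMap.finrank_range_of_inj hinj]
  refine Submodule.finrank_mono ?_
  rintro _ ⟨⟨X, hX⟩, rfl⟩
  have hfJ : f X ∈ selfAdj D.J s := by
    have h1 : X.transpose * J = s • (J * X) := hX.1.2
    change (f X).transpose * D.J = s • (D.J * f X)
    calc (f X).transpose * D.J
        = g.transpose * (X.transpose * (((g⁻¹).transpose * g.transpose) * J)) * g := by
          rw [← hJ, hf, Matrix.transpose_mul, Matrix.transpose_mul]
          simp only [mul_assoc]
      _ = s • (g.transpose * J * ((g * g⁻¹) * X * g)) := by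
          rw [h2, one_mul, h1, h3]
          simp only [Matrix.mul_smul, Matrix.smul_mul, mul_assoc, one_mul]
      _ = _ := by
          rw [← hJ, hf]
          simp only [mul_assoc]
  refine ⟨⟨lowerPart_mem _, D.lowerPart_mem_selfAdj hfJ⟩, ?_⟩
  have h5 : antiMap D.U (f X) = g⁻¹ * antiMap U X * g := by
    rw [antiMap_apply, antiMap_apply, hf]
    have h6 : D.U = g⁻¹ * (U * g) := by rw [hU, ← mul_assoc, h4, one_mul]
    calc g⁻¹ * (X * g) * D.U + D.U * (g⁻¹ * (X * g))
        = g⁻¹ * X * ((g * g⁻¹) * U * g) + g⁻¹ * U * ((g * g⁻¹) * X * g) := by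
          rw [h6]
          simp only [mul_assoc]
      _ = _ := by
          rw [h3]
          simp only [one_mul, mul_add, add_mul, mul_assoc]
  have h6 : antiMap D.U (lowerPart (f X)) =
      antiMap D.U (f X) - antiMap D.U (f X - lowerPart (f X)) := by
    rw [← map_sub, sub_sub_cancel]
  change antiMap D.U (lowerPart (f X)) ∈ upperTri N K
  rw [h6, h5]
  refine sub_mem (mul_mem_upperTri (mul_mem_upperTri hg' hX.2) hg) ?_
  have h7 := sub_lowerPart_mem (f X)
  exact add_mem (mul_mem_upperTri h7 hUup) (mul_mem_upperTri hUup h7)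

end NormalForm

/-! ### From the periodic strip to block matrices -/

section Translation
variable {n : ℕ}

/-- The signs of the symplectic form. -/
def epsSign (r : Fin (2 * n)) : ℤ := if (r : ℕ) < n then 1 else -1

/-- The equations of the Brauer loop scheme for the matrix `U + Λ`, with `U` the upper triangular
and `Λ` the strictly lower triangular part. -/
structure IsSolution {K : Type*} [CommRing K] (a : BoundaryType)
    (M : Matrix (Fin (2 * n)) (Fin (2 * n)) K) : Prop where
  diag : ∀ r, M r r = 0
  symm : ∀ r c, M r c = ((a.sign * (epsSign r * epsSign c) : ℤ) : K) * M c.rev r.rev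
  up : ∀ r c, r ≤ c → ((M - lowerPart M) * (M - lowerPart M)) r c = 0
  low : ∀ r c, c < r → ((M - lowerPart M) * lowerPart M + lowerPart M * (M - lowerPart M)) r c = 0

theorem residue_val (hn : 0 < n) (i : ℤ) : ((residue hn i : ℕ) : ℤ) = (i - 1) % (2 * (n : ℤ)) := by
  have h1 := Int.emod_nonneg (i - 1) (show (2 * (n : ℤ)) ≠ 0 by omega)
  simp only [residue]
  omega

theorem residue_eq_iff (hn : 0 < n) (i : ℤ) (r : Fin (2 * n)) :
    residue hn i = r ↔ (2 * (n : ℤ)) ∣ i - 1 - r := by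
  have hr : ((r : ℕ) : ℤ) % (2 * (n : ℤ)) = r := Int.emod_eq_of_lt (by omega) (by omega)
  rw [Fin.ext_iff, ← Nat.cast_inj (R := ℤ), residue_val, Int.dvd_iff_emod_eq_zero,
    ← Int.emod_eq_emod_iff_emod_sub_eq_zero, hr]

theorem residue_rev (hn : 0 < n) (i : ℤ) :
    residue hn (2 * (n : ℤ) - i + 1) = (residue hn i).rev := by
  rw [residue_eq_iff, Fin.val_rev]
  have h := (residue_eq_iff hn i _).1 rfl
  have h2 : ((2 * n - ((residue hn i : ℕ) + 1) : ℕ) : ℤ) = 2 * (n : ℤ) - (residue hn i : ℕ) - 1 := by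
    have := (residue hn i).2
    omega
  rw [h2]
  have h3 : 2 * (n : ℤ) - i + 1 - 1 - (2 * (n : ℤ) - (residue hn i : ℕ) - 1) =
    -(i - 1 - (residue hn i : ℕ)) := by ring
  rw [h3]
  exact (dvd_neg).2 h

theorem residue_add_one (hn : 0 < n) (r : Fin (2 * n)) : residue hn ((r : ℤ) + 1) = r := by
  rw [residue_eq_iff]
  simp

theorem residue_add_period (hn : 0 < n) (r : Fin (2 * n)) :
    residue hn ((r : ℤ) + 1 + 2 * n) = r := by
  rw [residue_eq_iff]
  exact ⟨1, by ring⟩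

theorem eps_eq (hn : 0 < n) (i : ℤ) : eps n i = epsSign (residue hn i) := by
  unfold eps epsSign
  rw [← residue_val hn]
  simp only [Nat.cast_lt]

variable {K : Type*} [CommRing K]

theorem entry_eq (hn : 0 < n) (x : Coord n → K) (i j : ℤ) :
    entry x i j = if 0 ≤ j - i ∧ j - i < 2 * (n : ℤ) then x (residue hn i, residue hn j) else 0 := by
  unfold entry
  split_ifs <;> rfl

theorem exists_index (hn : 0 < n) (r c : Fin (2 * n)) :
    ∃ i j : ℤ, 0 ≤ j - i ∧ j - i < 2 * (n : ℤ) ∧ residue hn i = r ∧ residue hn j = c := by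
  rcases le_or_gt r c with h | h
  · refine ⟨r + 1, c + 1, ?_, ?_, residue_add_one hn r, residue_add_one hn c⟩
    · have := Fin.le_def.1 h
      omega
    · omega
  · refine ⟨r + 1, c + 1 + 2 * n, ?_, ?_, residue_add_one hn r, residue_add_period hn c⟩
    · omega
    · have := Fin.lt_def.1 h
      omega

/-- `k` lies between `r` and `c` in the cyclic order. -/
def CyclicBetween (r k c : Fin (2 * n)) : Prop :=
  (r ≤ c ∧ r ≤ k ∧ k ≤ c) ∨ (c < r ∧ (r ≤ k ∨ k ≤ c))

instance (r k c : Fin (2 * n)) : Decidable (CyclicBetween r k c) := by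
  unfold CyclicBetween
  infer_instance

/-- An interval shorter than a period either stays within one block of residues or crosses one block
boundary; the two cases are told apart by the order of the end residues. -/
theorem cyclicBetween_iff (hn : 0 < n) {i j : ℤ} (h1 : 0 ≤ j - i) (h2 : j - i < 2 * (n : ℤ))
    (k : Fin (2 * n)) : CyclicBetween (residue hn i) k (residue hn j) ↔
      ∃ m : ℤ, i ≤ m ∧ m ≤ j ∧ residue hn m = k := by
  obtain ⟨q, hq⟩ := (residue_eq_iff hn i _).1 rfl
  obtain ⟨q', hq'⟩ := (residue_eq_iff hn j _).1 rfl
  have hr := (residue hn i).2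
  have hc := (residue hn j).2
  generalize residue hn i = r at *
  generalize residue hn j = c at *
  have hk := k.2
  simp only [CyclicBetween, Fin.le_def, Fin.lt_def]
  have hqq : (r ≤ c ∧ q' = q) ∨ (c < r ∧ q' = q + 1) := by
    have e1 : 2 * (n : ℤ) * (q' - q) < 2 * (n : ℤ) * 2 := by nlinarith
    have e2 : 2 * (n : ℤ) * (-1) < 2 * (n : ℤ) * (q' - q) := by nlinarith
    have e3 := lt_of_mul_lt_mul_left e1 (by omega)
    have e4 := lt_of_mul_lt_mul_left e2 (by omega)
    have e5 : q' = q ∨ q' = q + 1 := by omega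
    rcases e5 with rfl | rfl
    · left
      exact ⟨Fin.le_def.2 (by omega), rfl⟩
    · right
      rw [mul_add] at hq'
      exact ⟨Fin.lt_def.2 (by omega), rfl⟩
  constructor
  · rintro (⟨h3, h4, h5⟩ | ⟨h3, h4 | h4⟩)
    · refine ⟨2 * (n : ℤ) * q + k + 1, by omega, ?_, (residue_eq_iff hn _ _).2 ⟨q, by ring⟩⟩
      rcases hqq with ⟨_, rfl⟩ | ⟨h, _⟩
      · omega
      · exact absurd (Fin.lt_def.1 h) (by omega)
    · refine ⟨2 * (n : ℤ) * q + k + 1, by omega, ?_, (residue_eq_iff hn _ _).2 ⟨q, by ring⟩⟩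
      rcases hqq with ⟨h, _⟩ | ⟨_, rfl⟩
      · exact absurd (Fin.le_def.1 h) (by omega)
      · rw [mul_add] at hq'
        omega
    · refine ⟨2 * (n : ℤ) * q' + k + 1, ?_, by omega, (residue_eq_iff hn _ _).2 ⟨q', by ring⟩⟩
      rcases hqq with ⟨h, _⟩ | ⟨_, rfl⟩
      · exact absurd (Fin.le_def.1 h) (by omega)
      · rw [mul_add] at hq' ⊢
        omega
  · rintro ⟨m, h3, h4, h5⟩
    obtain ⟨t, ht⟩ := (residue_eq_iff hn m _).1 h5
    have e1 : 2 * (n : ℤ) * (q - 1) < 2 * (n : ℤ) * t := by nlinarith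
    have e2 : 2 * (n : ℤ) * t < 2 * (n : ℤ) * (q' + 1) := by nlinarith
    have e3 := lt_of_mul_lt_mul_left e1 (by omega)
    have e4 := lt_of_mul_lt_mul_left e2 (by omega)
    rcases hqq with ⟨h, rfl⟩ | ⟨h, rfl⟩
    · have : t = q' := by omega
      subst this
      left
      exact ⟨Fin.le_def.1 h, by omega, by omega⟩
    · right
      refine ⟨Fin.lt_def.1 h, ?_⟩
      have : t = q ∨ t = q + 1 := by omega
      rcases this with rfl | rfl
      · left; omega
      · right
        omega

theorem residue_inj (hn : 0 < n) {i m m' : ℤ} (h1 : i ≤ m) (h2 : m < i + 2 * n) (h3 : i ≤ m')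
    (h4 : m' < i + 2 * n) (h : residue hn m = residue hn m') : m = m' := by
  obtain ⟨q, hq⟩ := (residue_eq_iff hn m _).1 rfl
  obtain ⟨q', hq'⟩ := (residue_eq_iff hn m' _).1 rfl
  rw [h] at hq
  have e1 : 2 * (n : ℤ) * (q' - q) < 2 * (n : ℤ) * 1 := by nlinarith
  have e2 : 2 * (n : ℤ) * (-1) < 2 * (n : ℤ) * (q' - q) := by nlinarith
  have e3 := lt_of_mul_lt_mul_left e1 (by omega)
  have e4 := lt_of_mul_lt_mul_left e2 (by omega)
  have : q' = q := by omega
  subst this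
  omega

theorem sqEntry_eq (hn : 0 < n) (x : Coord n → K) {i j : ℤ} (h1 : 0 ≤ j - i)
    (h2 : j - i < 2 * (n : ℤ)) :
    sqEntry x i j = ∑ k, if CyclicBetween (residue hn i) k (residue hn j) then
      x (residue hn i, k) * x (k, residue hn j) else 0 := by
  rw [← Finset.sum_filter]
  unfold sqEntry
  refine Finset.sum_bij (fun m _ => residue hn m) ?_ ?_ ?_ ?_
  · intro m hm
    rw [Finset.mem_Icc] at hm
    rw [Finset.mem_filter]
    exact ⟨Finset.mem_univ _, (cyclicBetween_iff hn h1 h2 _).2 ⟨m, hm.1, hm.2, rfl⟩⟩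
  · intro m hm m' hm' h
    rw [Finset.mem_Icc] at hm hm'
    exact residue_inj hn hm.1 (by omega) hm'.1 (by omega) h
  · intro k hk
    rw [Finset.mem_filter] at hk
    obtain ⟨m, h3, h4, h5⟩ := (cyclicBetween_iff hn h1 h2 k).1 hk.2
    exact ⟨m, Finset.mem_Icc.2 ⟨h3, h4⟩, h5⟩
  · intro m hm
    rw [Finset.mem_Icc] at hm
    rw [entry_eq hn, entry_eq hn, if_pos (by omega), if_pos (by omega)]

theorem sum_cyclic_of_le (M : Matrix (Fin (2 * n)) (Fin (2 * n)) K) {r c : Fin (2 * n)} (h : r ≤ c) :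
    (∑ k, if CyclicBetween r k c then M r k * M k c else 0) =
      ((M - lowerPart M) * (M - lowerPart M)) r c := by
  rw [Matrix.mul_apply]
  refine Finset.sum_congr rfl fun k _ => ?_
  simp only [CyclicBetween, Matrix.sub_apply, lowerPart_apply, h, h.not_gt, true_and, false_and,
    or_false]
  by_cases h1 : r ≤ k
  · by_cases h2 : k ≤ c
    · simp [h1, h2, h1.not_gt, h2.not_gt]
    · simp [h2, not_le.1 h2]
  · simp [h1, not_le.1 h1]

theorem sum_cyclic_of_lt (M : Matrix (Fin (2 * n)) (Fin (2 * n)) K) {r c : Fin (2 * n)} (h : c < r) :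
    (∑ k, if CyclicBetween r k c then M r k * M k c else 0) =
      ((M - lowerPart M) * lowerPart M + lowerPart M * (M - lowerPart M)) r c := by
  rw [Matrix.add_apply, Matrix.mul_apply, Matrix.mul_apply, ← Finset.sum_add_distrib]
  refine Finset.sum_congr rfl fun k _ => ?_
  simp only [CyclicBetween, Matrix.sub_apply, lowerPart_apply, h, h.not_ge, true_and, false_and,
    false_or]
  rcases le_or_gt r k with h1 | h1
  · simp [h1, h1.not_gt, h.trans_le h1]
  · rcases le_or_gt k c with h2 | h2
    · simp [h2, h1, h2.not_gt]
    · simp [h1, h2, h1.not_ge, h2.not_ge]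

/-- The matrix of the coordinates of a point. -/
def toMatrix {R : Type*} (x : Coord n → R) : Matrix (Fin (2 * n)) (Fin (2 * n)) R :=
  Matrix.of fun r c => x (r, c)

/-- An entry of M² on the strip is a sum over a cyclic interval. For r ≤ c it involves the upper
part alone and gives U². For c < r the interval wraps once, so exactly one factor of each term comes
from Λ, and the sum is UΛ + ΛU. Positions outside the strip carry no condition. -/
theorem equations_eq_zero_iff (hn : 0 < n) (a : BoundaryType) (x : Coord n → K) :
    (∀ p ∈ equations a x, p = 0) ↔ IsSolution a (toMatrix x) := by
  constructor
  · intro h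
    have hsq : ∀ r c, (∑ k, if CyclicBetween r k c then toMatrix x r k * toMatrix x k c else 0) = 0 := by
      intro r c
      obtain ⟨i, j, h1, h2, rfl, rfl⟩ := exists_index hn r c
      refine (sqEntry_eq hn x h1 h2).symm.trans ?_
      exact h _ (Or.inl (Or.inr ⟨i, j, by omega, rfl⟩))
    refine ⟨fun r => ?_, fun r c => ?_, fun r c hrc => ?_, fun r c hrc => ?_⟩
    · have h1 := h _ (Or.inr ⟨(r : ℤ) + 1, rfl⟩)
      rw [entry_eq hn, residue_add_one, if_pos (by omega)] at h1
      exact h1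
    · obtain ⟨i, j, h1, h2, rfl, rfl⟩ := exists_index hn r c
      have h3 := h _ (Or.inl (Or.inl ⟨i, j, rfl⟩))
      rw [daggerEntry, entry_eq hn, entry_eq hn, if_pos ⟨h1, h2⟩, if_pos (by omega), residue_rev,
        residue_rev, eps_eq hn, eps_eq hn, sub_eq_zero] at h3
      rw [Int.cast_mul, mul_assoc]
      exact h3
    · rw [← sum_cyclic_of_le _ hrc, hsq]
    · rw [← sum_cyclic_of_lt _ hrc, hsq]
  · intro h
    rintro p ((⟨i, j, rfl⟩ | ⟨i, j, hij, rfl⟩) | ⟨i, rfl⟩)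
    · rw [daggerEntry, entry_eq hn, entry_eq hn]
      by_cases h1 : 0 ≤ j - i ∧ j - i < 2 * (n : ℤ)
      · rw [if_pos h1, if_pos (by omega), residue_rev, residue_rev, eps_eq hn, eps_eq hn,
          sub_eq_zero, ← mul_assoc, ← Int.cast_mul]
        exact h.symm _ _
      · rw [if_neg h1, if_neg (by omega)]
        simp
    · by_cases h1 : 0 ≤ j - i
      · rw [sqEntry_eq hn x h1 (by omega)]
        rcases le_or_gt (residue hn i) (residue hn j) with h2 | h2
        · exact (sum_cyclic_of_le (toMatrix x) h2).trans (h.up _ _ h2)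
        · exact (sum_cyclic_of_lt (toMatrix x) h2).trans (h.low _ _ h2)
      · unfold sqEntry
        rw [Finset.Icc_eq_empty (by omega), Finset.sum_empty]
    · rw [entry_eq hn, if_pos (by omega)]
      exact h.diag _

end Translation

/-! ### A distinguished point of the stratum -/

namespace ChordData
variable {N : ℕ} {K : Type*} [Field K] (D : ChordData N K)

theorem inv (k : Fin N) : D.σ (D.σ k) = k := D.invol k

theorem dagger_sub (X Y : Matrix (Fin N) (Fin N) K) :
    D.dagger (X - Y) = D.dagger X - D.dagger Y := by
  ext a b
  simp [dagger, mul_sub, sub_mul]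

theorem dagger_mul (X Y : Matrix (Fin N) (Fin N) K) :
    D.dagger (X * Y) = D.dagger Y * D.dagger X := by
  ext a b
  simp only [dagger, Matrix.of_apply, Matrix.mul_apply]
  rw [Finset.mul_sum, Finset.sum_mul, ← Equiv.sum_comp Fin.revPerm]
  refine Finset.sum_congr rfl fun k _ => ?_
  have := D.J_ne k
  simp only [Fin.revPerm_apply]
  field_simp

/-- Commutators with upper triangular matrices that are self-adjoint are commutators with elements
of the symplectic Borel algebra. -/
theorem mem_orbitTangent [CharZero K] {s : K} (hs : s * s = 1) {U X : Matrix (Fin N) (Fin N) K}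
    (hU : U ∈ selfAdj D.J s) (hX : X ∈ upperTri N K) (hXU : adMap U X ∈ selfAdj D.J s) :
    adMap U X ∈ orbitTangent D.J U := by
  have h1 : D.dagger U = s • U := by
    conv_rhs => rw [D.mem_selfAdj_iff_dagger.1 hU, smul_smul, hs, one_smul]
  have h2 : adMap U (D.dagger X) = - adMap U X := by
    have h3 := D.mem_selfAdj_iff_dagger.1 hXU
    have h4 : D.dagger (adMap U X) = - s • adMap U (D.dagger X) := by
      rw [adMap_apply, dagger_sub, dagger_mul, dagger_mul, h1, adMap_apply]
      simp only [Matrix.smul_mul, Matrix.mul_smul, neg_smul, smul_sub]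
      abel
    rw [h4, smul_smul, mul_neg, hs, neg_one_smul] at h3
    rw [h3, neg_neg]
  -- The adjoint of `X` has the opposite commutator with `U`, so the anti-self-adjoint half of `X`
  -- has the same commutator as `X`.
  refine ⟨(2⁻¹ : K) • (X - D.dagger X), ⟨Submodule.smul_mem _ _
    (sub_mem hX (D.dagger_mem_upperTri hX)), ?_⟩, ?_⟩
  · refine Submodule.smul_mem _ _ ?_
    have := D.symm_mem_selfAdj X (s := -1) (by ring)
    rwa [neg_one_smul, ← sub_eq_add_neg] at this
  · rw [map_smul, map_sub, h2, sub_neg_eq_add, ← two_smul K, smul_smul,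
      inv_mul_cancel₀ two_ne_zero, one_smul]

/-- Labels of the chords, which are equal for mirror images. -/
def label (i : Fin N) : ℕ := min (i : ℕ) ((D.σ i).rev : ℕ) + 1

theorem label_rev (i : Fin N) : D.label (D.σ i).rev = D.label i := by
  unfold label
  rw [D.rev_comm, D.invol, Fin.rev_rev, min_comm]

theorem eq_or_eq_of_label {i j : Fin N} (h : D.label i = D.label j) :
    i = j ∨ i = (D.σ j).rev ∨ (D.σ i).rev = (D.σ j).rev := by
  unfold label at h
  rcases min_choice (i : ℕ) ((D.σ i).rev : ℕ) with h1 | h1 <;>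
  rcases min_choice (j : ℕ) ((D.σ j).rev : ℕ) with h2 | h2 <;> rw [h1, h2] at h
  · exact Or.inl (Fin.ext (by omega))
  · exact Or.inr (Or.inl (Fin.ext (by omega)))
  · right; left
    have h3 : (D.σ i).rev = j := Fin.ext (by omega)
    rw [← h3, D.rev_comm, D.invol, Fin.rev_rev]
  · exact Or.inr (Or.inr (Fin.ext (by omega)))

theorem eq_or_eq_rev_of_label {i j : Fin N} (h : D.label i = D.label j) :
    i = j ∨ i = (D.σ j).rev := by
  rcases D.eq_or_eq_of_label h with h | h | h
  · exact Or.inl h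
  · exact Or.inr h
  · exact Or.inl (D.invol.injective (Fin.rev_inj.1 h))

/-- The lower part of a point of the component at which the scheme is smooth. -/
def lowerU : Matrix (Fin N) (Fin N) K :=
  Matrix.of fun i j => if j < i ∧ D.σ j = i then (D.label j : K) / D.u j else 0

theorem mul_lowerU (X : Matrix (Fin N) (Fin N) K) (k l : Fin N) :
    (X * D.lowerU) k l = if l < D.σ l then X k (D.σ l) * (D.label l / D.u l) else 0 := by
  rw [Matrix.mul_apply, Finset.sum_eq_single (D.σ l)]
  · simp [lowerU]
  · intro b _ hb
    simp [lowerU, hb.symm]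
  · simp

theorem lowerU_mul (X : Matrix (Fin N) (Fin N) K) (k l : Fin N) :
    (D.lowerU * X) k l =
      if D.σ k < k then (D.label (D.σ k) / D.u (D.σ k)) * X (D.σ k) l else 0 := by
  rw [Matrix.mul_apply, Finset.sum_eq_single (D.σ k)]
  · simp [lowerU, D.invol k]
  · intro b _ hb
    have : D.σ b ≠ k := by
      rintro rfl
      exact hb (D.invol b).symm
    simp [lowerU, this]
  · simp

theorem lowerU_mem_strictLowerTri : D.lowerU ∈ strictLowerTri N K := by
  intro i j h
  simp [lowerU, h.not_gt]

theorem U_mem_strictUpperTri : D.U ∈ strictUpperTri N K := by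
  intro i j h
  simp [U, h.not_gt]

theorem u_rev {s : K} (hU : D.U ∈ selfAdj D.J s) {i : Fin N} (hi : i < D.σ i) :
    D.u i * D.J i i.rev = s * D.J (D.σ i) (D.σ i).rev * D.u (D.σ i).rev := by
  have h := D.mem_selfAdj.1 hU i (D.σ i)
  have h2 : (D.σ i).rev < i.rev := Fin.rev_lt_rev.2 hi
  simpa only [U, Matrix.of_apply, hi, D.inv, D.rev_comm, h2, and_self, if_true] using h

/-- Mirror chords have equal labels, and the inverse coefficients of `U` at the transposed positions
satisfy the same symmetry because s² = 1. -/
theorem lowerU_mem_selfAdj {s : K} (hs : s * s = 1) (hU : D.U ∈ selfAdj D.J s) :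
    D.lowerU ∈ selfAdj D.J s := by
  rw [mem_selfAdj]
  intro a b
  by_cases h : b < a ∧ D.σ b = a
  · obtain ⟨h1, rfl⟩ := h
    have h2 : (D.σ b).rev < b.rev := Fin.rev_lt_rev.2 h1
    have h3 : D.σ (D.σ b).rev = b.rev := by rw [D.rev_comm, D.invol]
    have h4 := D.u_rev hU h1
    have h5 := D.u_ne b h1
    have h6 := D.u_ne (D.σ b).rev (by rwa [h3])
    simp only [lowerU, Matrix.of_apply, h1, h2, h3, and_self, if_true, D.label_rev]
    field_simp
    linear_combination (-(D.label b : K) * s) * h4 -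
      (D.label b : K) * D.J (D.σ b) (D.σ b).rev * D.u (D.σ b).rev * hs
  · have h' : ¬ (a.rev < b.rev ∧ D.σ a.rev = b.rev) := by
      rintro ⟨h1, h2⟩
      rw [D.rev_comm, Fin.rev_inj] at h2
      exact h ⟨Fin.rev_lt_rev.1 h1, by rw [← h2, D.invol]⟩
    simp only [lowerU, Matrix.of_apply, if_neg h, if_neg h', zero_mul, mul_zero]

/-- As σ is injective, both products of `U` and `lowerU` are diagonal. -/
theorem anti_lowerU_upper : antiMap D.U D.lowerU ∈ upperTri N K := by
  intro i j h
  rw [antiMap_apply, Matrix.add_apply, lowerU_mul, U_mul]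
  have h1 : D.U (D.σ i) j = 0 := by
    simp only [U, Matrix.of_apply]
    refine if_neg fun h2 => h.ne (D.invol.injective h2.2)
  have h2 : D.lowerU (D.σ i) j = 0 := by
    simp only [lowerU, Matrix.of_apply]
    refine if_neg fun h2 => h.ne (D.invol.injective h2.2)
  simp [h1, h2]

theorem U_mul_U : D.U * D.U = 0 := by
  ext i j
  rw [U_mul]
  split_ifs with h
  · simp only [U, Matrix.of_apply]
    rw [if_neg, mul_zero]
    · rfl
    · rintro ⟨h1, h2⟩
      rw [D.invol.injective h2] at h1
      exact h1.asymm h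
  · rfl

/-- The tangent vectors of the scheme at a suitable point with upper part `U` are tangent to the
orbit of `U`. -/
theorem tangent_mem_orbitTangent [CharZero K] {s : K} (hs : s * s = 1)
    (hU : D.U ∈ selfAdj D.J s)
    (hlink : ∀ k, k < k.rev → D.σ k ≠ k → D.σ k < (D.σ k).rev ∨ D.σ k = k.rev)
    {V L : Matrix (Fin N) (Fin N) K} (hV : V ∈ strictUpperTri N K ⊓ selfAdj D.J s)
    (hsingle : ∀ k l, D.σ k = k → D.σ l = l → V k l = 0)
    (hUV : antiMap D.U V = 0) (hlow : antiMap D.lowerU V + antiMap D.U L ∈ upperTri N K) :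
    V ∈ orbitTangent D.J D.U := by
  have h1 : ∀ k l, (if D.σ l < l then V k (D.σ l) * D.u (D.σ l) else 0) +
      (if k < D.σ k then D.u k * V (D.σ k) l else 0) = 0 := fun k l => by
    rw [← anti_apply, hUV]; rfl
  have h2 : ∀ p q, q < p →
      ((if q < D.σ q then V p (D.σ q) * (D.label q / D.u q) else 0) +
        (if D.σ p < p then (D.label (D.σ p) / D.u (D.σ p)) * V (D.σ p) q else 0)) +
      ((if D.σ q < q then L p (D.σ q) * D.u (D.σ q) else 0) +
        (if p < D.σ p then D.u p * L (D.σ p) q else 0)) = 0 := fun p q hpq => by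
    have := hlow p q hpq
    rwa [Matrix.add_apply, anti_apply, antiMap_apply, Matrix.add_apply, mul_lowerU,
      lowerU_mul] at this
  -- This is why labels start at 1: the coefficients of `lowerU` on the chords must not vanish.
  have hlab : ∀ i, (D.label i : K) ≠ 0 := fun i => by
    exact Nat.cast_ne_zero.2 (Nat.succ_ne_zero _)
  have hu' : ∀ l, D.σ l < l → D.u (D.σ l) ≠ 0 := fun l hl => D.u_ne _ (by rwa [D.invol])
  -- Two linear equations in the same two entries, with determinant a difference of labels. Labels
  -- agree only on the same chord, where V(p, p) = 0, or on mirror chords, where `hlink` puts V(σ p,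
  -- q) on or below the diagonal.
  have hco : ∀ p q, D.σ p < p → q < D.σ q → q < p → V (D.σ p) q = 0 ∧ V p (D.σ q) = 0 := by
    intro p q hp hq hpq
    have e1 := h1 (D.σ p) (D.σ q)
    have e2 := h2 p q hpq
    simp only [D.inv, hp, hq, hp.asymm, hq.asymm, if_true, if_false, add_zero] at e1 e2
    have n1 := hu' p hp
    have n2 := D.u_ne q hq
    have e3 : ((D.label q : K) - D.label (D.σ p)) * V p (D.σ q) = 0 := by
      field_simp at e2
      apply mul_left_cancel₀ n1
      linear_combination e2 - (D.label (D.σ p) : K) * e1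
    have hdone : V p (D.σ q) = 0 → V (D.σ p) q = 0 ∧ V p (D.σ q) = 0 := by
      intro h
      rw [h, mul_zero, add_zero] at e1
      exact ⟨(mul_eq_zero.1 e1).resolve_right n2, h⟩
    rcases mul_eq_zero.1 e3 with h | h
    · rw [sub_eq_zero, Nat.cast_inj] at h
      rcases D.eq_or_eq_rev_of_label h with h3 | h3
      · apply hdone
        rw [h3, D.invol]
        exact hV.1 p p le_rfl
      · rw [D.invol] at h3
        have h4 : V (D.σ p) q = 0 := by
          apply hV.1
          by_contra hc
          rw [not_le, h3] at hc
          have h5 : D.σ p < (D.σ p).rev := hc.trans (Fin.rev_lt_rev.2 hp)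
          rcases hlink (D.σ p) h5 (by rw [D.inv]; exact hp.ne') with h6 | h6
          · rw [D.invol, ← h3] at h6
            exact h6.asymm hpq
          · rw [D.invol] at h6
            rw [h6, Fin.rev_rev] at hc
            exact hc.ne (by rw [← h6])
        rw [h4, zero_mul, zero_add] at e1
        exact ⟨h4, (mul_eq_zero.1 e1).resolve_left n1⟩
    · exact hdone h
  have hos : ∀ k l, k < D.σ k → D.σ l = l → l < D.σ k → V k l = 0 := by
    intro k l hk hl hkl
    have e2 := h2 (D.σ k) l hkl
    simp only [D.inv, hl, hk, hk.asymm, lt_irrefl, if_true, if_false, add_zero, zero_add] at e2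
    exact (mul_eq_zero.1 e2).resolve_left (div_ne_zero (hlab k) (D.u_ne k hk))
  have hsc : ∀ k l, D.σ k = k → D.σ l < l → D.σ l < k → V k l = 0 := by
    intro k l hk hl hkl
    have e2 := h2 k (D.σ l) hkl
    simp only [D.inv, hl, hk, hl.asymm, lt_irrefl, if_true, if_false, add_zero] at e2
    exact (mul_eq_zero.1 e2).resolve_right (div_ne_zero (hlab _) (hu' l hl))
  -- The unknown L(σ k, σ l) occurs in both equations. Eliminating it leaves V(k, l) times a
  -- difference of labels.
  have hoc : ∀ k l, k < D.σ k → D.σ l < l → D.σ l < k → l < D.σ k → V k l = 0 := by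
    intro k l hk hl h3 h4
    have e1 := h2 (D.σ k) l h4
    have e2 := h2 k (D.σ l) h3
    simp only [D.inv, hk, hl, hk.asymm, hl.asymm, if_true, if_false, add_zero, zero_add] at e1 e2
    have n1 := hu' l hl
    have n2 := D.u_ne k hk
    have e3 : ((D.label k : K) - D.label (D.σ l)) * V k l = 0 := by
      field_simp at e1 e2
      linear_combination e1 - e2
    refine (mul_eq_zero.1 e3).elim (fun h => ?_) id
    rw [sub_eq_zero, Nat.cast_inj] at h
    rcases D.eq_or_eq_rev_of_label h with h5 | h5
    · exact absurd h5.symm h3.ne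
    · rw [D.invol] at h5
      have h6 : l = k.rev := by rw [h5, Fin.rev_rev]
      rcases le_or_gt l k with h7 | h7
      · exact hV.1 k l h7
      · rw [h6] at h4 h7
        rcases hlink k h7 hk.ne' with h8 | h8
        · have h9 := Fin.rev_lt_rev.2 h4
          rw [Fin.rev_rev] at h9
          exact absurd (h8.trans h9) hk.asymm
        · exact absurd h8 h4.ne'
  -- Solves [X, U] = V directly: columns at left ends are read off from `V`, and the other columns,
  -- in rows at right ends, balance the remaining entries. The vanishing results above are what
  -- allow `X` to be cut off below the diagonal.
  let X : Matrix (Fin N) (Fin N) K := Matrix.of fun a b =>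
    if b < a then 0 else if b < D.σ b then V a (D.σ b) / D.u b else
      if D.σ a < a then (if D.σ b < b ∧ D.σ a ≤ D.σ b then 0 else - V (D.σ a) b / D.u (D.σ a))
      else 0
  have hX : X ∈ upperTri N K := fun i j h => by simp [X, h]
  have hXV : adMap D.U X = V := by
    ext k l
    rw [ad_apply]
    rcases le_or_gt l k with hkl | hkl
    · rw [hV.1 k l hkl]
      have e1 : D.σ l < l → X k (D.σ l) = 0 := fun h => hX _ _ (h.trans_le hkl)
      have e2 : k < D.σ k → X (D.σ k) l = 0 := fun h => hX _ _ (hkl.trans_lt h)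
      by_cases hl : D.σ l < l <;> by_cases hk : k < D.σ k <;> simp [hl, hk, e1, e2]
    by_cases hl : D.σ l < l
    · have n1 := hu' l hl
      have e1 : X k (D.σ l) * D.u (D.σ l) = if D.σ l < k then 0 else V k l := by
        simp only [X, Matrix.of_apply, D.inv, hl, if_true]
        split_ifs
        · simp
        · field_simp
      rw [if_pos hl, e1]
      by_cases hk : k < D.σ k
      · have n2 := D.u_ne k hk
        rw [if_pos hk]
        simp only [X, Matrix.of_apply, D.inv, hl, hl.asymm, hk, if_true, if_false, true_and]
        by_cases h3 : D.σ l < k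
        · rw [if_pos h3, if_neg h3.not_ge]
          by_cases h4 : l < D.σ k
          · rw [if_pos h4, hoc k l hk hl h3 h4]
            simp
          · rw [if_neg h4]
            field_simp
            ring
        · rw [if_neg h3, if_pos (not_lt.1 h3)]
          simp
      · rw [if_neg hk, sub_zero]
        split_ifs with h3
        · rcases (not_lt.1 hk).lt_or_eq with h4 | h4
          · have h5 := hco k (D.σ l) h4 (by rwa [D.invol]) h3
            rw [D.invol] at h5
            exact h5.2.symm
          · exact (hsc k l h4 hl h3).symm
        · rfl
    · rw [if_neg hl]
      by_cases hk : k < D.σ k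
      · have n2 := D.u_ne k hk
        rw [if_pos hk]
        simp only [X, Matrix.of_apply, D.inv, hl, hk, if_true, if_false, false_and]
        by_cases h3 : l < D.σ l
        · have h5 := h1 k (D.σ l)
          have n1 := D.u_ne l h3
          simp only [D.inv, h3, hk, if_true] at h5
          rw [if_pos h3]
          by_cases h4 : l < D.σ k
          · have h6 := hco (D.σ k) l (by rwa [D.invol]) h3 h4
            rw [D.invol] at h6
            rw [if_pos h4, h6.1]
            simp
          · rw [if_neg h4]
            field_simp
            linear_combination - h5
        · have h3' : D.σ l = l := le_antisymm (not_lt.1 h3) (not_lt.1 hl)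
          rw [if_neg h3]
          by_cases h4 : l < D.σ k
          · rw [if_pos h4, hos k l hk h3' h4]
            simp
          · rw [if_neg h4]
            field_simp
            ring
      · rw [if_neg hk, sub_zero]
        by_cases hk' : D.σ k < k
        · have h5 := h1 (D.σ k) l
          simp only [D.inv, hl, hk', if_true, if_false, zero_add] at h5
          exact ((mul_eq_zero.1 h5).resolve_left (hu' k hk')).symm
        · have hk'' : D.σ k = k := le_antisymm (not_lt.1 hk) (not_lt.1 hk')
          by_cases hl' : l < D.σ l
          · have h5 := h1 k (D.σ l)
            simp only [D.inv, hl', hk, if_true, if_false, add_zero] at h5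
            exact ((mul_eq_zero.1 h5).resolve_right (D.u_ne l hl')).symm
          · exact (hsingle k l hk'' (le_antisymm (not_lt.1 hl') (not_lt.1 hl))).symm
  rw [← hXV]
  exact D.mem_orbitTangent hs hU hX (by rw [hXV]; exact hV.2)

end ChordData

/-! ### Points over field extensions and the dimension bound -/

section Points
variable {n : ℕ}

theorem entry_map {R S : Type*} [CommRing R] [CommRing S] (f : R →+* S) (x : Coord n → R)
    (i j : ℤ) : entry (fun c => f (x c)) i j = f (entry x i j) := by
  unfold entry
  split_ifs
  · rfl
  · rw [map_zero]

theorem equations_map {R S : Type*} [CommRing R] [CommRing S] (f : R →+* S) (a : BoundaryType)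
    (x : Coord n → R) : equations a (fun c => f (x c)) = f '' equations a x := by
  unfold equations
  rw [Set.image_union, Set.image_union]
  congr 1
  · congr 1
    · ext p
      constructor
      · rintro ⟨i, j, rfl⟩
        exact ⟨_, ⟨i, j, rfl⟩, by simp [daggerEntry, entry_map]⟩
      · rintro ⟨_, ⟨i, j, rfl⟩, rfl⟩
        exact ⟨i, j, by simp [daggerEntry, entry_map]⟩
    · ext p
      constructor
      · rintro ⟨i, j, h, rfl⟩
        exact ⟨_, ⟨i, j, h, rfl⟩, by simp [sqEntry, entry_map]⟩
      · rintro ⟨_, ⟨i, j, h, rfl⟩, rfl⟩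
        exact ⟨i, j, h, by simp [sqEntry, entry_map]⟩
  · ext p
    constructor
    · rintro ⟨i, rfl⟩
      exact ⟨_, ⟨i, rfl⟩, (entry_map f x i i).symm⟩
    · rintro ⟨_, ⟨i, rfl⟩, rfl⟩
      exact ⟨i, (entry_map f x i i).symm⟩

theorem aeval_brauerIdeal_iff (hn : 0 < n) (a : BoundaryType) {K : Type*} [CommRing K]
    [Algebra ℂ K] (y : Coord n → K) :
    (∀ p ∈ brauerIdeal a n, aeval y p = 0) ↔ IsSolution a (toMatrix y) := by
  have h1 := equations_map (aeval y : MvPolynomial (Coord n) ℂ →ₐ[ℂ] K).toRingHom a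
    (fun c : Coord n => (X c : MvPolynomial (Coord n) ℂ))
  have h2 : (fun c : Coord n => (aeval y : MvPolynomial (Coord n) ℂ →ₐ[ℂ] K).toRingHom (X c)) = y := by
    ext c
    exact aeval_X y c
  rw [h2] at h1
  rw [← equations_eq_zero_iff hn, h1]
  constructor
  · rintro h _ ⟨p, hp, rfl⟩
    exact h p (Ideal.subset_span hp)
  · intro h p hp
    have h3 : brauerIdeal a n ≤ RingHom.ker (aeval y : MvPolynomial (Coord n) ℂ →ₐ[ℂ] K) :=
      Ideal.span_le.2 fun q hq => h _ ⟨q, hq, rfl⟩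
    exact h3 hp

-- A tangent vector is a point over the dual numbers: evaluating p at y + εv gives p(y) + ε dp(v).
-- This linearises the matrix equations without differentiating them one by one.
open TrivSqZeroExt in
theorem isSolution_dualNumber (hn : 0 < n) (a : BoundaryType) {K : Type*} [Field K]
    [Algebra ℂ K] (y v : Coord n → K) (hy : ∀ p ∈ brauerIdeal a n, aeval y p = 0)
    (hv : v ∈ tangentAt (brauerIdeal a n) y) :
    IsSolution a (toMatrix fun c => (inl (y c) + inr (v c) : TrivSqZeroExt K K)) := by
  rw [← aeval_brauerIdeal_iff hn]
  intro p hp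
  let z : Coord n → TrivSqZeroExt K K := fun c => inl (y c) + inr (v c)
  have hfst : ∀ q : MvPolynomial (Coord n) ℂ, (aeval z q).fst = aeval y q := by
    intro q
    have : (fstHom ℂ K K).comp (aeval z) = aeval y := by
      ext c
      simp [z]
    rw [← this]
    rfl
  have hsnd := eq_sum_pderiv_mul y (((sndHom K K).restrictScalars ℂ).comp (aeval z).toLinearMap)
    (fun q q' => by
      simp only [LinearMap.comp_apply, AlgHom.toLinearMap_apply, LinearMap.restrictScalars_apply,
        map_mul, sndHom_apply, snd_mul, hfst]
      simp [mul_comm]) p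
  apply TrivSqZeroExt.ext
  · exact (hfst p).trans (hy p hp)
  · simp only [LinearMap.comp_apply, AlgHom.toLinearMap_apply, LinearMap.restrictScalars_apply,
      sndHom_apply, aeval_X] at hsnd
    refine hsnd.trans ?_
    rw [snd_zero, ← hv p hp]
    simp [z]

/-- The symplectic form over a field. -/
def formMat (n : ℕ) (K : Type*) [Field K] : Matrix (Fin (2 * n)) (Fin (2 * n)) K :=
  Matrix.of fun r c => if c = r.rev then (epsSign r : K) else 0

theorem epsSign_mul_self (r : Fin (2 * n)) : epsSign r * epsSign r = 1 := by
  unfold epsSign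
  split_ifs <;> rfl

theorem epsSign_rev (r : Fin (2 * n)) : epsSign r.rev = - epsSign r := by
  unfold epsSign
  rw [Fin.val_rev]
  have := r.2
  by_cases h : (r : ℕ) < n
  · rw [if_neg (by omega), if_pos h]
  · rw [if_pos (by omega), if_neg h]
    rfl

variable (n) in
/-- The symplectic form, with the zero matrix. -/
def formChord (K : Type*) [Field K] : ChordData (2 * n) K where
  σ := id
  invol := fun _ => rfl
  rev_comm := fun _ => rfl
  u := fun _ => 1
  u_ne := fun _ _ => one_ne_zero
  J := formMat n K
  J_eq_zero := fun i j h => by simp [formMat, h]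
  J_ne := fun i => by
    simp only [formMat, Matrix.of_apply, if_true, epsSign]
    split_ifs <;> simp
  J_anti := fun i => by simp [formMat, epsSign_rev]

variable {K : Type*} [Field K]

theorem mem_selfAdj_formMat {a : BoundaryType} {X : Matrix (Fin (2 * n)) (Fin (2 * n)) K} :
    X ∈ selfAdj (formMat n K) ((a.sign : ℤ) : K) ↔
      ∀ r c, X r c = ((a.sign * (epsSign r * epsSign c) : ℤ) : K) * X c.rev r.rev := by
  have h1 : ∀ r : Fin (2 * n), (epsSign r : K) * epsSign r = 1 := fun r => by
    rw [← Int.cast_mul, epsSign_mul_self, Int.cast_one]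
  have h2 : ∀ r : Fin (2 * n), formMat n K r r.rev = epsSign r := fun r => by simp [formMat]
  refine ((formChord n K).mem_selfAdj).trans (forall_congr' fun r => forall_congr' fun c => ?_)
  change X r c * formMat n K r r.rev = _ * formMat n K c c.rev * _ ↔ _
  rw [h2, h2]
  push_cast
  constructor
  · intro h
    linear_combination (epsSign r : K) * h - X r c * h1 r
  · intro h
    linear_combination (epsSign r : K) * h + (a.sign : K) * epsSign c * X c.rev r.rev * h1 r

theorem sign_mul_self (a : BoundaryType) : ((a.sign : ℤ) : K) * ((a.sign : ℤ) : K) = 1 := by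
  cases a <;> simp [BoundaryType.sign]

theorem isSolution_iff {a : BoundaryType} {M : Matrix (Fin (2 * n)) (Fin (2 * n)) K} :
    IsSolution a M ↔ M - lowerPart M ∈ strictUpperTri (2 * n) K ∧
      M ∈ selfAdj (formMat n K) ((a.sign : ℤ) : K) ∧
      (M - lowerPart M) * (M - lowerPart M) = 0 ∧
      antiMap (M - lowerPart M) (lowerPart M) ∈ upperTri (2 * n) K := by
  constructor
  · rintro ⟨h1, h2, h3, h4⟩
    refine ⟨fun i j h => ?_, mem_selfAdj_formMat.2 h2, ?_, fun i j h => ?_⟩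
    · rcases h.lt_or_eq with h | rfl
      · simp [lowerPart_apply, h]
      · simp [lowerPart_apply, h1]
    · ext i j
      rcases le_or_gt i j with h | h
      · exact h3 i j h
      · exact mul_mem_upperTri (sub_lowerPart_mem M) (sub_lowerPart_mem M) i j h
    · rw [antiMap_apply, add_comm]
      exact h4 i j h
  · rintro ⟨h1, h2, h3, h4⟩
    refine ⟨fun r => ?_, mem_selfAdj_formMat.1 h2, fun r c _ => by rw [h3]; rfl, fun r c h => ?_⟩
    · simpa [lowerPart_apply] using h1 r r le_rfl
    · have := h4 r c h
      rwa [antiMap_apply, add_comm] at this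

theorem lowerPart_mem_selfAdj {s : K} {M : Matrix (Fin (2 * n)) (Fin (2 * n)) K}
    (h : M ∈ selfAdj (formMat n K) s) : lowerPart M ∈ selfAdj (formMat n K) s :=
  (formChord n K).lowerPart_mem_selfAdj h

open TrivSqZeroExt in
theorem map_snd_mul (A B : Matrix (Fin (2 * n)) (Fin (2 * n)) (TrivSqZeroExt K K)) :
    (A * B).map snd = A.map fst * B.map snd + A.map snd * B.map fst := by
  ext i j
  simp only [Matrix.map_apply, Matrix.mul_apply, Matrix.add_apply]
  rw [snd_sum, ← Finset.sum_add_distrib]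
  refine Finset.sum_congr rfl fun k _ => ?_
  rw [snd_mul]
  simp [mul_comm]

open TrivSqZeroExt in
/-- The linearized equations of the scheme. -/
theorem tangent_equations (hn : 0 < n) {a : BoundaryType} [Algebra ℂ K] {y v : Coord n → K}
    (hy : ∀ p ∈ brauerIdeal a n, aeval y p = 0) (hv : v ∈ tangentAt (brauerIdeal a n) y) :
    toMatrix v - lowerPart (toMatrix v) ∈ strictUpperTri (2 * n) K ∧
    toMatrix v ∈ selfAdj (formMat n K) ((a.sign : ℤ) : K) ∧
    antiMap (toMatrix y - lowerPart (toMatrix y)) (toMatrix v - lowerPart (toMatrix v)) = 0 ∧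
    antiMap (lowerPart (toMatrix y)) (toMatrix v - lowerPart (toMatrix v)) +
      antiMap (toMatrix y - lowerPart (toMatrix y)) (lowerPart (toMatrix v)) ∈
        upperTri (2 * n) K := by
  obtain ⟨h1, h2, h3, h4⟩ := isSolution_dualNumber hn a y v hy hv
  set Z := toMatrix fun c => (inl (y c) + inr (v c) : TrivSqZeroExt K K) with hZ
  have hlf : (lowerPart Z).map fst = lowerPart (toMatrix y) := by
    ext i j
    simp only [Matrix.map_apply, lowerPart_apply]
    split_ifs <;> simp [hZ, toMatrix]
  have hls : (lowerPart Z).map snd = lowerPart (toMatrix v) := by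
    ext i j
    simp only [Matrix.map_apply, lowerPart_apply]
    split_ifs <;> simp [hZ, toMatrix]
  have huf : (Z - lowerPart Z).map fst = toMatrix y - lowerPart (toMatrix y) := by
    rw [← hlf]
    ext i j
    simp [hZ, toMatrix]
  have hus : (Z - lowerPart Z).map snd = toMatrix v - lowerPart (toMatrix v) := by
    rw [← hls]
    ext i j
    simp [hZ, toMatrix]
  refine ⟨fun i j h => ?_, mem_selfAdj_formMat.2 fun r c => ?_, ?_, fun i j h => ?_⟩
  · rcases h.lt_or_eq with h | rfl
    · simp [lowerPart_apply, h]
    · have := congrArg snd (h1 j)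
      simpa [lowerPart_apply, hZ, toMatrix] using this
  · have h5 := congrArg snd (h2 r c)
    have h6 : ∀ m : ℤ, ((m : ℤ) : TrivSqZeroExt K K) = inl (m : K) := fun m => by simp
    rw [h6] at h5
    simpa [hZ, toMatrix] using h5
  · ext i j
    rcases le_or_gt i j with h | h
    · have h5 := congrArg snd (h3 i j h)
      have h6 := congrFun (congrFun (map_snd_mul (Z - lowerPart Z) (Z - lowerPart Z)) i) j
      rw [Matrix.map_apply, h5, huf, hus] at h6
      rw [antiMap_apply, add_comm]
      exact h6.symm
    · exact add_mem (mul_mem_upperTri (sub_lowerPart_mem _) (sub_lowerPart_mem _))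
        (mul_mem_upperTri (sub_lowerPart_mem _) (sub_lowerPart_mem _)) i j h
  · have h5 := congrArg snd (h4 i j h)
    have h6 := congrFun (congrFun (map_snd_mul (Z - lowerPart Z) (lowerPart Z)) i) j
    have h7 := congrFun (congrFun (map_snd_mul (lowerPart Z) (Z - lowerPart Z)) i) j
    rw [huf, hus, hls, hlf] at h6 h7
    rw [Matrix.add_apply, snd_add] at h5
    rw [Matrix.map_apply] at h6 h7
    rw [h6, h7, snd_zero] at h5
    rw [antiMap_apply, antiMap_apply, ← h5]
    simp only [Matrix.add_apply]
    ring

/-- Rank–nullity for the projection to the upper part. It separates motion along the orbit from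
motion inside the fibre. -/
theorem finrank_le_add {N : ℕ} {W A B : Submodule K (Matrix (Fin N) (Fin N) K)}
    (hA : ∀ V ∈ W, V - lowerPart V ∈ A) (hB : ∀ V ∈ W, V - lowerPart V = 0 → V ∈ B) :
    Module.finrank K W ≤ Module.finrank K A + Module.finrank K B := by
  let f := ((LinearMap.id - lowerPart : Matrix (Fin N) (Fin N) K →ₗ[K] _)).domRestrict W
  rw [← LinearMap.finrank_range_add_finrank_ker f]
  refine add_le_add (Submodule.finrank_mono ?_) ?_
  · rintro _ ⟨⟨V, hV⟩, rfl⟩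
    exact hA V hV
  · rw [← Submodule.finrank_map_subtype_eq]
    refine Submodule.finrank_mono ?_
    rintro _ ⟨⟨V, hV⟩, hV', rfl⟩
    exact hB V hV hV'

variable (n K) in
/-- Points as matrices. -/
def toMatrixEquiv : (Coord n → K) ≃ₗ[K] Matrix (Fin (2 * n)) (Fin (2 * n)) K where
  toFun := toMatrix
  invFun M c := M c.1 c.2
  map_add' _ _ := rfl
  map_smul' _ _ := rfl
  left_inv _ := rfl
  right_inv _ := rfl

theorem mem_fibre_of_tangent {a : BoundaryType} {U L V : Matrix (Fin (2 * n)) (Fin (2 * n)) K}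
    (h2 : V ∈ selfAdj (formMat n K) ((a.sign : ℤ) : K))
    (h4 : antiMap L (V - lowerPart V) + antiMap U (lowerPart V) ∈ upperTri (2 * n) K)
    (h : V - lowerPart V = 0) : V ∈ fibre (formMat n K) ((a.sign : ℤ) : K) U := by
  have h5 : lowerPart V = V := (sub_eq_zero.1 h).symm
  rw [h, map_zero, zero_add, h5] at h4
  exact ⟨⟨h5 ▸ lowerPart_mem V, h2⟩, h4⟩

/-- The tangent space of the scheme at a suitable point with monomial upper part. -/
theorem finrank_tangentSpace_le (hn : 0 < n) {a : BoundaryType} (D : ChordData (2 * n) ℂ)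
    (hDJ : D.J = formMat n ℂ) (hU : D.U ∈ selfAdj D.J ((a.sign : ℤ) : ℂ))
    (hlink : ∀ k, k < k.rev → D.σ k ≠ k → D.σ k < (D.σ k).rev ∨ D.σ k = k.rev)
    (hsingle : ∀ V ∈ strictUpperTri (2 * n) ℂ ⊓ selfAdj D.J ((a.sign : ℤ) : ℂ),
      ∀ k l, D.σ k = k → D.σ l = l → V k l = 0)
    {x : Coord n → ℂ} (hx : toMatrix x = D.U + D.lowerU) (hxI : x ∈ zeroLocus ℂ (brauerIdeal a n)) :
    Module.finrank ℂ (tangentSpace (brauerIdeal a n) x) ≤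
      Module.finrank ℂ (orbitTangent D.J D.U) +
        Module.finrank ℂ (fibre D.J ((a.sign : ℤ) : ℂ) D.U) := by
  have h1 : lowerPart (D.U + D.lowerU) = D.lowerU := by
    ext i j
    rw [lowerPart_apply, Matrix.add_apply]
    split_ifs with h
    · rw [D.U_mem_strictUpperTri i j h.le, zero_add]
    · rw [D.lowerU_mem_strictLowerTri i j (not_lt.1 h)]
  rw [← tangentAt_complex, ← (toMatrixEquiv n ℂ).finrank_map_eq]
  refine finrank_le_add ?_ ?_
  · rintro _ ⟨v, hv, rfl⟩
    obtain ⟨e1, e2, e3, e4⟩ := tangent_equations hn hxI hv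
    rw [hx, h1, add_sub_cancel_right] at e3 e4
    rw [← hDJ] at e2
    have e5 := sub_mem e2 (D.lowerPart_mem_selfAdj e2)
    exact D.tangent_mem_orbitTangent (sign_mul_self a) hU hlink ⟨e1, e5⟩ (hsingle _ ⟨e1, e5⟩) e3 e4
  · rintro _ ⟨v, hv, rfl⟩ h
    obtain ⟨e1, e2, e3, e4⟩ := tangent_equations hn hxI hv
    rw [hx, h1, add_sub_cancel_right] at e4
    rw [hDJ]
    exact mem_fibre_of_tangent e2 e4 h

theorem derivation_mul [Algebra ℂ K] (E : Derivation ℂ K K) {N : ℕ}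
    (A B : Matrix (Fin N) (Fin N) K) : (A * B).map E = A.map E * B + A * B.map E := by
  ext i j
  simp only [Matrix.map_apply, Matrix.mul_apply, Matrix.add_apply, map_sum, Derivation.leibniz,
    smul_eq_mul]
  rw [← Finset.sum_add_distrib]
  exact Finset.sum_congr rfl fun k _ => by ring

/-- The dimensions of the subvarieties of the scheme. -/
theorem ringKrullDim_le (hn : 0 < n) {a : BoundaryType} (D' : ChordData (2 * n) ℂ)
    (hU' : D'.U ∈ selfAdj D'.J ((a.sign : ℤ) : ℂ))
    (hi : a = .identified → ∀ k, k < k.rev → D'.σ k ≠ k)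
    (hc : a = .closed → ∀ k l, k < k.rev → l < l.rev → D'.σ k = k → D'.σ l = l → k = l)
    (hlink : ∀ k, k < k.rev → D'.σ k ≠ k → D'.σ k < (D'.σ k).rev ∨ D'.σ k = k.rev)
    (Q : Ideal (MvPolynomial (Coord n) ℂ)) (hQ : Q.IsPrime) (hIQ : brauerIdeal a n ≤ Q) :
    ringKrullDim (MvPolynomial (Coord n) ℂ ⧸ Q) ≤
      ((Module.finrank ℂ (orbitTangent D'.J D'.U) +
        Module.finrank ℂ (fibre D'.J ((a.sign : ℤ) : ℂ) D'.U) : ℕ) : WithBot ℕ∞) := by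
  obtain ⟨K, _, _, y, s, W, hy, hs, hW, hWD⟩ := exists_generic_point Q
  have : CharZero K := charZero_of_injective_algebraMap (algebraMap ℂ K).injective
  have hyI : ∀ p ∈ brauerIdeal a n, aeval y p = 0 := fun p hp => (hy p).2 (hIQ hp)
  obtain ⟨h1, h2, h3, h4⟩ := isSolution_iff.1 ((aeval_brauerIdeal_iff hn a y).1 hyI)
  have h2' : toMatrix y - lowerPart (toMatrix y) ∈ selfAdj (formMat n K) ((a.sign : ℤ) : K) :=
    sub_mem h2 (lowerPart_mem_selfAdj h2)
  -- The normal form is taken over the function field, so no stratification into orbits is needed.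
  obtain ⟨D, g, hg, hdet, hJ, hUg, hu, hU⟩ := exists_chordData (sign_mul_self a)
    (formChord n K).J_eq_zero (formChord n K).J_ne (formChord n K).J_anti h1 h3 h2'
  rw [hs]
  norm_cast
  refine le_trans ?_ (D.finrank_orbitTangent_add_fibre_le D' a hU hU' hi hc hlink)
  refine le_trans ?_ (add_le_add (finrank_orbitTangent_le_of_conj hg hdet hJ hUg)
    (finrank_fibre_le_of_conj D hg hdet hJ hUg))
  rw [← hW, ← (toMatrixEquiv n K).finrank_map_eq]
  refine finrank_le_add ?_ ?_
  · rintro _ ⟨v, hv, rfl⟩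
    obtain ⟨E, hE⟩ := hWD v hv
    obtain rfl : v = fun c => E (y c) := funext hE
    obtain ⟨e1, e2, -, -⟩ := tangent_equations hn hyI (derivation_mem_tangentAt _ y hyI E)
    have e5 := sub_mem e2 (lowerPart_mem_selfAdj e2)
    have e6 : (toMatrix fun c => E (y c)) - lowerPart (toMatrix fun c => E (y c)) =
        (toMatrix y - lowerPart (toMatrix y)).map E := by
      ext i j
      simp only [Matrix.map_apply, Matrix.sub_apply, lowerPart_apply, toMatrix, Matrix.of_apply]
      split_ifs <;> simp
    change (toMatrix fun c => E (y c)) - lowerPart (toMatrix fun c => E (y c)) ∈ _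
    rw [e6] at e5 ⊢
    generalize toMatrix y - lowerPart (toMatrix y) = U at *
    -- The normal form has entries 0 and 1, so the derivation kills it. Differentiating Ug = g D.U
    -- then gives E(U) = [E(g) g⁻¹, U].
    have e7 : D.U.map E = 0 := by
      ext i j
      simp only [Matrix.map_apply, ChordData.U, Matrix.of_apply, hu]
      split_ifs <;> simp
    have e8 := congrArg (fun A => A.map E) hUg
    simp only [derivation_mul, e7, mul_zero, add_zero] at e8
    have e9 : U.map E = adMap U (g.map E * g⁻¹) := by
      have h5 : g * g⁻¹ = 1 := Matrix.mul_nonsing_inv _ hdet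
      have h6 : g⁻¹ * U = D.U * g⁻¹ := by
        calc g⁻¹ * U = g⁻¹ * (U * g) * g⁻¹ := by
              rw [mul_assoc, mul_assoc, h5, mul_one]
          _ = D.U * g⁻¹ := by
              rw [hUg, ← mul_assoc, Matrix.nonsing_inv_mul _ hdet, one_mul]
      rw [adMap_apply, mul_assoc, h6]
      calc U.map E = (U.map E * g) * g⁻¹ := by rw [mul_assoc, h5, mul_one]
        _ = (g.map E * D.U - U * g.map E) * g⁻¹ := by rw [← e8, add_sub_cancel_right]
        _ = _ := by rw [sub_mul, mul_assoc, mul_assoc]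
    rw [e9] at e5 ⊢
    refine (formChord n K).mem_orbitTangent (sign_mul_self a) h2' ?_ e5
    refine mul_mem_upperTri (fun i j h => ?_) (inv_mem_upperTri hg hdet)
    rw [Matrix.map_apply, hg i j h, map_zero]
  · rintro _ ⟨v, hv, rfl⟩ h
    obtain ⟨E, hE⟩ := hWD v hv
    obtain rfl : v = fun c => E (y c) := funext hE
    obtain ⟨e1, e2, -, e4⟩ := tangent_equations hn hyI (derivation_mem_tangentAt _ y hyI E)
    exact mem_fibre_of_tangent e2 e4 h

end Points

/-! ### Link patterns as chord data -/

instance : DecidableEq BoundaryType := fun a b => by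
  cases a <;> cases b <;> first | exact isTrue rfl | exact isFalse (by simp)

/-- In the identified case there is no fixed point. In the closed case two fixed points are equal or
mirror images, so the entry lies on the diagonal or the antidiagonal, where `V` vanishes. -/
theorem ChordData.apply_single_eq_zero {N : ℕ} {K : Type*} [Field K] [CharZero K]
    (D : ChordData N K) (a : BoundaryType)
    (hi : a = .identified → ∀ k, k < k.rev → D.σ k ≠ k)
    (hc : a = .closed → ∀ k l, k < k.rev → l < l.rev → D.σ k = k → D.σ l = l → k = l)
    {V : Matrix (Fin N) (Fin N) K}
    (hV : V ∈ strictUpperTri N K ⊓ selfAdj D.J ((a.sign : ℤ) : K)) (k l : Fin N)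
    (hk : D.σ k = k) (hl : D.σ l = l) : V k l = 0 := by
  have hk' : D.σ k.rev = k.rev := by rw [D.rev_comm, hk]
  have hl' : D.σ l.rev = l.rev := by rw [D.rev_comm, hl]
  cases a with
  | identified =>
    rcases lt_or_gt_of_ne (D.rev_ne k) with h | h
    · exact absurd hk' (hi rfl k.rev (by rwa [Fin.rev_rev]))
    · exact absurd hk (hi rfl k h)
  | closed =>
    have hV1 : V ∈ selfAdj D.J 1 := by simpa [BoundaryType.sign] using hV.2
    have hc' := hc rfl
    rcases lt_or_gt_of_ne (D.rev_ne k) with h | h <;>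
    rcases lt_or_gt_of_ne (D.rev_ne l) with h' | h'
    · have := hc' k.rev l.rev (by rwa [Fin.rev_rev]) (by rwa [Fin.rev_rev]) hk' hl'
      exact hV.1 k l (Fin.rev_inj.1 this).symm.le
    · have := hc' k.rev l (by rwa [Fin.rev_rev]) h' hk' hl
      rw [← this]
      exact D.selfAdj_one_antidiag hV1 k
    · have := hc' k l.rev h (by rwa [Fin.rev_rev]) hk hl'
      rw [← Fin.rev_rev l, ← this]
      exact D.selfAdj_one_antidiag hV1 k
    · exact hV.1 k l (hc' k l h h' hk hl).symm.le

namespace LinkPattern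
variable {a : BoundaryType} {n : ℕ} (π : LinkPattern a n)

theorem periodic_of_lt {j : Fin (2 * n)} (h : (j : ℕ) < n) :
    π.periodic j = π.half ⟨j, h⟩ := dif_pos h

theorem periodic_rev (j : Fin (2 * n)) : π.periodic j.rev = (π.periodic j).rev := by
  have hj := j.2
  by_cases h : (j : ℕ) < n
  · rw [π.periodic_of_lt h, periodic, dif_neg (by rw [Fin.val_rev]; omega)]
    simp only [Fin.rev_rev]
  · rw [π.periodic_of_lt (by rw [Fin.val_rev]; omega)]
    conv_rhs => rw [periodic, dif_neg h, Fin.rev_rev]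

theorem periodic_cases {j : Fin (2 * n)} (h : (j : ℕ) < n) :
    (π.periodic j = Fin.castLE (by omega) (π.toFun ⟨j, h⟩) ∧
      (a = .identified → π.toFun ⟨j, h⟩ ≠ ⟨j, h⟩)) ∨
    (a = .identified ∧ π.toFun ⟨j, h⟩ = ⟨j, h⟩ ∧ π.periodic j = j.rev) := by
  rw [π.periodic_of_lt h]
  cases a with
  | identified =>
    by_cases h2 : π.toFun ⟨j, h⟩ = ⟨j, h⟩
    · right
      simp only [half, if_pos h2]
      exact ⟨trivial, h2, rfl⟩
    · left
      simp only [half, if_neg h2]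
      exact ⟨trivial, fun _ => h2⟩
  | closed => exact Or.inl ⟨rfl, fun h => absurd h (by simp)⟩

theorem periodic_lt_or {j : Fin (2 * n)} (h : (j : ℕ) < n) :
    (π.periodic j : ℕ) < n ∨ (a = .identified ∧ π.periodic j = j.rev) := by
  rcases π.periodic_cases h with ⟨h1, -⟩ | ⟨h1, -, h2⟩
  · left
    rw [h1]
    exact (π.toFun ⟨j, h⟩).2
  · exact Or.inr ⟨h1, h2⟩

theorem periodic_involutive : Function.Involutive π.periodic := by
  have key : ∀ j : Fin (2 * n), (j : ℕ) < n → π.periodic (π.periodic j) = j := by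
    intro j h
    rcases π.periodic_cases h with ⟨h1, h2⟩ | ⟨h1, h2, h3⟩
    · have h4 : ((Fin.castLE (by omega) (π.toFun ⟨j, h⟩) : Fin (2 * n)) : ℕ) < n :=
        (π.toFun ⟨j, h⟩).2
      have h5 : (⟨(Fin.castLE (by omega) (π.toFun ⟨j, h⟩) : Fin (2 * n)), h4⟩ : Fin n) =
          π.toFun ⟨j, h⟩ := rfl
      rw [h1]
      rcases π.periodic_cases h4 with ⟨h6, -⟩ | ⟨h6, h7, -⟩
      · rw [h6, h5, π.involutive]
        rfl
      · rw [h5, π.involutive] at h7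
        exact absurd h7.symm (h2 h6)
    · rw [h3, periodic_rev, h3, Fin.rev_rev]
  intro j
  by_cases h : (j : ℕ) < n
  · exact key j h
  · have h2 := key j.rev (by rw [Fin.val_rev]; omega)
    rw [periodic_rev, periodic_rev, Fin.rev_inj] at h2
    exact h2

theorem lt_of_lt_rev {j : Fin (2 * n)} (h : j < j.rev) : (j : ℕ) < n := by
  rw [Fin.lt_def, Fin.val_rev] at h
  omega

theorem periodic_ne_self (ha : a = .identified) (k : Fin (2 * n)) (hk : k < k.rev) :
    π.periodic k ≠ k := by
  intro h
  rcases π.periodic_cases (lt_of_lt_rev hk) with ⟨h1, h2⟩ | ⟨-, -, h3⟩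
  · apply h2 ha
    rw [h] at h1
    exact Fin.ext (congrArg Fin.val h1).symm
  · exact hk.ne (h.symm.trans h3)

theorem eq_of_periodic_eq_self (ha : a = .closed) (k l : Fin (2 * n)) (hk : k < k.rev)
    (hl : l < l.rev) (hk' : π.periodic k = k) (hl' : π.periodic l = l) : k = l := by
  have key : ∀ (k : Fin (2 * n)) (hk : k < k.rev), π.periodic k = k →
      π.toFun ⟨k, lt_of_lt_rev hk⟩ = ⟨k, lt_of_lt_rev hk⟩ := by
    intro k hk h
    rcases π.periodic_cases (lt_of_lt_rev hk) with ⟨h1, -⟩ | ⟨h1, -, -⟩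
    · rw [h] at h1
      exact Fin.ext (congrArg Fin.val h1).symm
    · rw [ha] at h1
      exact absurd h1 (by simp)
  have := π.unpaired ha _ _ (key k hk hk') (key l hl hl')
  exact Fin.ext (Fin.mk.inj this)

theorem periodic_link (k : Fin (2 * n)) (hk : k < k.rev) :
    π.periodic k < (π.periodic k).rev ∨ π.periodic k = k.rev := by
  rcases π.periodic_lt_or (lt_of_lt_rev hk) with h | h
  · left
    rw [Fin.lt_def, Fin.val_rev]
    omega
  · exact Or.inr h.2

/-- In the closed case no chord crosses the middle, so the clauses that give 0 and -1 never meet the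
support of the pattern. -/
theorem strictUpper_apply (i j : Fin (2 * n)) : strictUpper a π.periodic i j =
    if i < j ∧ π.periodic j = i then (if a = .identified ∧ n ≤ (i : ℕ) then -1 else 1) else 0 := by
  have hi := i.2
  have hj := j.2
  rw [strictUpper, Matrix.of_apply]
  by_cases h : j ≤ i
  · rw [if_pos h, if_neg fun h2 => h.not_gt h2.1]
  rw [if_neg h]
  have h' : i < j := not_le.1 h
  by_cases h2 : i = π.periodic j
  · conv_rhs => rw [if_pos ⟨h', h2.symm⟩]
    cases a with
    | identified =>
      simp only [if_pos h2, true_and, Nat.lt_add_one_iff]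
    | closed =>
      have h3 : ((i : ℕ) < n ∧ (j : ℕ) < n) ∨ (n ≤ (i : ℕ) ∧ n ≤ (j : ℕ)) := by
        by_cases h4 : (j : ℕ) < n
        · rcases π.periodic_lt_or h4 with h5 | h5
          · rw [h2]
            exact Or.inl ⟨h5, h4⟩
          · simp at h5
        · have h6 : (j.rev : ℕ) < n := by rw [Fin.val_rev]; omega
          rcases π.periodic_lt_or h6 with h5 | h5
          · rw [periodic_rev, ← h2, Fin.val_rev] at h5
            omega
          · simp at h5
      simp only [if_pos h2]
      rw [if_neg (by omega), if_neg (by omega), if_neg (by simp)]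
  · conv_rhs => rw [if_neg fun h3 => h2 h3.2.symm]
    cases a with
    | identified => simp only [if_neg h2]
    | closed => simp only [if_neg h2, ite_self]

/-- The chords of a link pattern. -/
def chordData : ChordData (2 * n) ℂ where
  σ := π.periodic
  invol := π.periodic_involutive
  rev_comm := π.periodic_rev
  u i := if a = .identified ∧ n ≤ (i : ℕ) then -1 else 1
  u_ne i _ := by split_ifs <;> simp
  J := formMat n ℂ
  J_eq_zero := (formChord n ℂ).J_eq_zero
  J_ne := (formChord n ℂ).J_ne
  J_anti := (formChord n ℂ).J_anti

theorem chordData_U : π.chordData.U = strictUpper a π.periodic := by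
  ext i j
  rw [strictUpper_apply]
  rfl

/-- Checked by the position of the chord: within the first half, within the second, or across the
middle, which occurs only for identified boundaries. The signs -1 in the second half account for the
type sign -1. -/
theorem chordData_U_mem : π.chordData.U ∈ selfAdj π.chordData.J ((a.sign : ℤ) : ℂ) := by
  rw [chordData_U]
  refine mem_selfAdj_formMat.2 fun r c => ?_
  rw [strictUpper_apply, strictUpper_apply]
  by_cases h : r < c ∧ π.periodic c = r
  · have h' : c.rev < r.rev ∧ π.periodic r.rev = c.rev := by
      refine ⟨Fin.rev_lt_rev.2 h.1, ?_⟩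
      rw [periodic_rev, ← h.2, π.periodic_involutive]
    rw [if_pos h, if_pos h']
    obtain ⟨h1, h2⟩ := h
    have hr := r.2
    have hc := c.2
    have h3 : ((r : ℕ) < n ∧ (c : ℕ) < n) ∨ (n ≤ (r : ℕ) ∧ n ≤ (c : ℕ)) ∨
        (a = .identified ∧ (r : ℕ) < n ∧ n ≤ (c : ℕ)) := by
      by_cases h4 : (c : ℕ) < n
      · exact Or.inl ⟨(Fin.lt_def.1 h1).trans h4, h4⟩
      · have h6 : (c.rev : ℕ) < n := by rw [Fin.val_rev]; omega
        rcases π.periodic_lt_or h6 with h5 | h5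
        · rw [periodic_rev, h2, Fin.val_rev] at h5
          omega
        · rw [periodic_rev, h2, Fin.rev_rev, ← Fin.rev_inj, Fin.rev_rev] at h5
          refine Or.inr (Or.inr ⟨h5.1, ?_, by omega⟩)
          rw [h5.2]
          exact h6
    rw [Fin.val_rev]
    cases a with
    | identified =>
      rcases h3 with h3 | h3 | ⟨-, h3⟩
      · rw [if_neg (by omega), if_pos ⟨rfl, by omega⟩]
        simp [epsSign, h3, BoundaryType.sign]
      · rw [if_pos ⟨rfl, h3.1⟩, if_neg (by omega)]
        simp [epsSign, h3.1.not_gt, h3.2.not_gt, BoundaryType.sign]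
      · rw [if_neg (by omega), if_neg (by omega)]
        simp [epsSign, h3, h3.2.not_gt, BoundaryType.sign]
    | closed =>
      rcases h3 with h3 | h3 | h3
      · simp [epsSign, h3, BoundaryType.sign]
      · simp [epsSign, h3.1.not_gt, h3.2.not_gt, BoundaryType.sign]
      · exact absurd h3.1 (by simp)
  · have h' : ¬ (c.rev < r.rev ∧ π.periodic r.rev = c.rev) := by
      rintro ⟨h1, h2⟩
      rw [periodic_rev, Fin.rev_inj] at h2
      exact h ⟨Fin.rev_lt_rev.1 h1, by rw [← h2, π.periodic_involutive]⟩
    rw [if_neg h, if_neg h', mul_zero]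

end LinkPattern

theorem formJ_eq {n : ℕ} (hn : 0 < n) : formJ n = formMat n ℂ := by
  ext i j
  have hi := i.2
  have hj := j.2
  have h : (i : ℕ) + 1 + ((j : ℕ) + 1) = 2 * n + 1 ↔ j = i.rev := by
    rw [Fin.ext_iff, Fin.val_rev]
    omega
  simp only [formJ, formMat, Matrix.of_apply, h, eps_eq hn, residue_add_one hn]


/-! ### The action of the symplectic Borel group -/

section Action
variable {N : ℕ} {K : Type*} [Field K]

/-- The upper triangular matrices that preserve the form `J`. -/
def symplecticBorel (J : Matrix (Fin N) (Fin N) K) : Set (Matrix (Fin N) (Fin N) K) :=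
  {g | g ∈ upperTri N K ∧ g.transpose * J * g = J}

theorem ChordData.isUnit_det_J (D : ChordData N K) : IsUnit D.J.det := by
  let Q : Matrix (Fin N) (Fin N) K := Matrix.of fun a b => if b = a.rev then (D.J b a)⁻¹ else 0
  refine Matrix.isUnit_det_of_right_inverse (B := Q) ?_
  ext a b
  rw [Matrix.mul_apply, Finset.sum_eq_single a.rev, Matrix.one_apply]
  · by_cases h : a = b
    · subst h
      simp [Q, D.J_ne]
    · have : b ≠ a := Ne.symm h
      simp [Q, h, this]
  · intro c _ hc
    simp [D.J_eq_zero a c hc]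
  · simp

variable {J : Matrix (Fin N) (Fin N) K}

theorem isUnit_det_of_symplectic (hJ : IsUnit J.det) {g : Matrix (Fin N) (Fin N) K}
    (hg : g ∈ symplecticBorel J) : IsUnit g.det := by
  have h := congrArg Matrix.det hg.2
  rw [Matrix.det_mul] at h
  rw [← h] at hJ
  exact isUnit_of_mul_isUnit_right hJ

theorem one_mem_symplecticBorel : (1 : Matrix (Fin N) (Fin N) K) ∈ symplecticBorel J :=
  ⟨one_mem_upperTri, by simp⟩

theorem mul_mem_symplecticBorel {g h : Matrix (Fin N) (Fin N) K} (hg : g ∈ symplecticBorel J)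
    (hh : h ∈ symplecticBorel J) : g * h ∈ symplecticBorel J := by
  refine ⟨mul_mem_upperTri hg.1 hh.1, ?_⟩
  calc (g * h).transpose * J * (g * h) = h.transpose * (g.transpose * J * g) * h := by
        rw [Matrix.transpose_mul]
        simp only [mul_assoc]
    _ = J := by rw [hg.2, hh.2]

theorem inv_mem_symplecticBorel (hJ : IsUnit J.det) {g : Matrix (Fin N) (Fin N) K}
    (hg : g ∈ symplecticBorel J) : g⁻¹ ∈ symplecticBorel J := by
  have hdet := isUnit_det_of_symplectic hJ hg
  refine ⟨inv_mem_upperTri hg.1 hdet, ?_⟩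
  have h1 : g * g⁻¹ = 1 := Matrix.mul_nonsing_inv _ hdet
  calc (g⁻¹).transpose * J * g⁻¹ = (g⁻¹).transpose * (g.transpose * J * g) * g⁻¹ := by rw [hg.2]
    _ = (g * g⁻¹).transpose * J * (g * g⁻¹) := by
        rw [Matrix.transpose_mul]
        simp only [mul_assoc]
    _ = J := by rw [h1, Matrix.transpose_one, one_mul, mul_one]

theorem inv_eq_of_symplectic (hJ : IsUnit J.det) {g : Matrix (Fin N) (Fin N) K}
    (hg : g ∈ symplecticBorel J) : g⁻¹ = J⁻¹ * g.transpose * J := by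
  refine Matrix.inv_eq_left_inv ?_
  calc J⁻¹ * g.transpose * J * g = J⁻¹ * (g.transpose * J * g) := by simp only [mul_assoc]
    _ = 1 := by rw [hg.2, Matrix.nonsing_inv_mul _ hJ]

theorem conj_mem_selfAdj (hJ : IsUnit J.det) {g X : Matrix (Fin N) (Fin N) K} {s : K}
    (hg : g ∈ symplecticBorel J) (hX : X ∈ selfAdj J s) : g * X * g⁻¹ ∈ selfAdj J s := by
  have hX' : X.transpose * J = s • (J * X) := hX
  have h1 := (inv_mem_symplecticBorel hJ hg).2
  have h3 : g⁻¹ * g = 1 := Matrix.nonsing_inv_mul _ (isUnit_det_of_symplectic hJ hg)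
  change (g * X * g⁻¹).transpose * J = s • (J * (g * X * g⁻¹))
  calc (g * X * g⁻¹).transpose * J
      = (g⁻¹).transpose * (X.transpose * (g.transpose * J)) := by
        rw [Matrix.transpose_mul, Matrix.transpose_mul]
        simp only [mul_assoc]
    _ = (g⁻¹).transpose * (X.transpose * (g.transpose * J * (g * g⁻¹))) := by
        rw [Matrix.mul_nonsing_inv _ (isUnit_det_of_symplectic hJ hg), mul_one]
    _ = (g⁻¹).transpose * ((X.transpose * (g.transpose * J * g)) * g⁻¹) := by
        simp only [mul_assoc]
    _ = s • ((g⁻¹).transpose * (J * (g⁻¹ * g)) * X * g⁻¹) := by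
        rw [hg.2, hX', h3, mul_one]
        simp only [Matrix.smul_mul, Matrix.mul_smul, mul_assoc]
    _ = s • (((g⁻¹).transpose * J * g⁻¹) * (g * X * g⁻¹)) := by simp only [mul_assoc]
    _ = _ := by rw [h1]

theorem mul_mem_strictUpperTri_left {X Y : Matrix (Fin N) (Fin N) K} (hX : X ∈ upperTri N K)
    (hY : Y ∈ strictUpperTri N K) : X * Y ∈ strictUpperTri N K := by
  intro i j h
  rw [Matrix.mul_apply]
  refine Finset.sum_eq_zero fun k _ => ?_
  by_cases h1 : k < i
  · rw [hX i k h1, zero_mul]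
  · rw [hY k j (h.trans (not_lt.1 h1)), mul_zero]

theorem mul_mem_strictUpperTri_right {X Y : Matrix (Fin N) (Fin N) K}
    (hX : X ∈ strictUpperTri N K) (hY : Y ∈ upperTri N K) : X * Y ∈ strictUpperTri N K := by
  intro i j h
  rw [Matrix.mul_apply]
  refine Finset.sum_eq_zero fun k _ => ?_
  by_cases h1 : k ≤ i
  · rw [hX i k h1, zero_mul]
  · rw [hY k j (h.trans_lt (not_le.1 h1)), mul_zero]

theorem lowerPart_eq_zero_iff {X : Matrix (Fin N) (Fin N) K} :
    lowerPart X = 0 ↔ X ∈ upperTri N K := by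
  constructor
  · intro h
    have := sub_lowerPart_mem X
    rwa [h, sub_zero] at this
  · intro h
    ext i j
    rw [lowerPart_apply]
    split_ifs with h1
    · exact h i j h1
    · rfl

theorem lowerPart_eq_self_iff {X : Matrix (Fin N) (Fin N) K} :
    lowerPart X = X ↔ X ∈ strictLowerTri N K := by
  constructor
  · intro h
    rw [← h]
    exact lowerPart_mem X
  · intro h
    ext i j
    rw [lowerPart_apply]
    split_ifs with h1
    · rfl
    · exact (h i j (not_lt.1 h1)).symm

/-- The action of upper triangular matrices on the points `U + Λ` of the affine space. -/
def conjAct (g M : Matrix (Fin N) (Fin N) K) : Matrix (Fin N) (Fin N) K :=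
  g * (M - lowerPart M) * g⁻¹ + lowerPart (g * lowerPart M * g⁻¹)

theorem conj_mem_upperTri {g X : Matrix (Fin N) (Fin N) K} (hg : g ∈ upperTri N K)
    (hdet : IsUnit g.det) (hX : X ∈ upperTri N K) : g * X * g⁻¹ ∈ upperTri N K :=
  mul_mem_upperTri (mul_mem_upperTri hg hX) (inv_mem_upperTri hg hdet)

theorem lowerPart_conjAct {g : Matrix (Fin N) (Fin N) K} (hg : g ∈ upperTri N K)
    (hdet : IsUnit g.det) (M : Matrix (Fin N) (Fin N) K) :
    lowerPart (conjAct g M) = lowerPart (g * lowerPart M * g⁻¹) := by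
  rw [conjAct, map_add, lowerPart_eq_zero_iff.2 (conj_mem_upperTri hg hdet (sub_lowerPart_mem M)),
    zero_add, lowerPart_eq_self_iff.2 (lowerPart_mem _)]

theorem conjAct_sub {g : Matrix (Fin N) (Fin N) K} (hg : g ∈ upperTri N K)
    (hdet : IsUnit g.det) (M : Matrix (Fin N) (Fin N) K) :
    conjAct g M - lowerPart (conjAct g M) = g * (M - lowerPart M) * g⁻¹ := by
  rw [lowerPart_conjAct hg hdet, conjAct, add_sub_cancel_right]

/-- Upper triangular matrices are stable under conjugation by `g`, so the strictly lower part of a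
conjugate depends only on the strictly lower part of the matrix. This makes `conjAct` an action. -/
theorem lowerPart_conj_lowerPart {g : Matrix (Fin N) (Fin N) K} (hg : g ∈ upperTri N K)
    (hdet : IsUnit g.det) (M : Matrix (Fin N) (Fin N) K) :
    lowerPart (g * lowerPart M * g⁻¹) = lowerPart (g * M * g⁻¹) := by
  have h := lowerPart_eq_zero_iff.2 (conj_mem_upperTri hg hdet (sub_lowerPart_mem M))
  rw [mul_sub, sub_mul, map_sub, sub_eq_zero] at h
  exact h.symm

theorem conjAct_conjAct {g h : Matrix (Fin N) (Fin N) K} (hg : g ∈ upperTri N K)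
    (hgdet : IsUnit g.det) (hh : h ∈ upperTri N K) (hhdet : IsUnit h.det)
    (M : Matrix (Fin N) (Fin N) K) : conjAct g (conjAct h M) = conjAct (g * h) M := by
  rw [conjAct, conjAct_sub hh hhdet, lowerPart_conjAct hh hhdet,
    lowerPart_conj_lowerPart hg hgdet, conjAct, Matrix.mul_inv_rev]
  simp only [mul_assoc]

theorem conjAct_one (M : Matrix (Fin N) (Fin N) K) : conjAct 1 M = M := by
  rw [conjAct, inv_one, one_mul, mul_one, one_mul, mul_one, lowerPart_eq_self_iff.2 (lowerPart_mem _),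
    sub_add_cancel]

end Action

section ActionOnPoints
variable {n : ℕ} {K : Type*} [Field K]

theorem isUnit_det_formMat : IsUnit (formMat n K).det := (formChord n K).isUnit_det_J

/-- Truncating the conjugate of Λ alters it by an upper triangular matrix, whose anticommutator with
the conjugate of U is again upper triangular and so invisible to the equations. -/
theorem IsSolution.conjAct {a : BoundaryType} {g M : Matrix (Fin (2 * n)) (Fin (2 * n)) K}
    (hg : g ∈ symplecticBorel (formMat n K)) (hM : IsSolution a M) :
    IsSolution a (conjAct g M) := by
  obtain ⟨h1, h2, h3, h4⟩ := isSolution_iff.1 hM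
  have hdet := isUnit_det_of_symplectic isUnit_det_formMat hg
  have hg' := inv_mem_upperTri hg.1 hdet
  have h5 : g⁻¹ * g = 1 := Matrix.nonsing_inv_mul _ hdet
  have h6 := lowerPart_mem_selfAdj h2
  rw [isSolution_iff, conjAct_sub hg.1 hdet, lowerPart_conjAct hg.1 hdet]
  refine ⟨mul_mem_strictUpperTri_right (mul_mem_strictUpperTri_left hg.1 h1) hg', ?_, ?_, ?_⟩
  · exact add_mem (conj_mem_selfAdj isUnit_det_formMat hg (sub_mem h2 h6))
      (lowerPart_mem_selfAdj (conj_mem_selfAdj isUnit_det_formMat hg h6))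
  · calc g * (M - lowerPart M) * g⁻¹ * (g * (M - lowerPart M) * g⁻¹)
        = g * (M - lowerPart M) * (g⁻¹ * g) * (M - lowerPart M) * g⁻¹ := by simp only [mul_assoc]
      _ = g * ((M - lowerPart M) * (M - lowerPart M)) * g⁻¹ := by
          rw [h5, mul_one]
          simp only [mul_assoc]
      _ = 0 := by rw [h3, mul_zero, zero_mul]
  · generalize M - lowerPart M = U at *
    generalize lowerPart M = L at *
    have h7 : antiMap (g * U * g⁻¹) (lowerPart (g * L * g⁻¹)) = g * antiMap U L * g⁻¹ -
        antiMap (g * U * g⁻¹) (g * L * g⁻¹ - lowerPart (g * L * g⁻¹)) := by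
      have h8 : g * antiMap U L * g⁻¹ = antiMap (g * U * g⁻¹) (g * L * g⁻¹) := by
        rw [antiMap_apply, antiMap_apply]
        calc g * (L * U + U * L) * g⁻¹ = g * L * (g⁻¹ * g) * U * g⁻¹ +
              g * U * (g⁻¹ * g) * L * g⁻¹ := by
              rw [h5]
              simp only [mul_one, mul_add, add_mul, mul_assoc]
          _ = _ := by simp only [mul_assoc]
      rw [h8, map_sub, sub_sub_cancel]
    have h9 : g * U * g⁻¹ ∈ upperTri (2 * n) K :=
      conj_mem_upperTri hg.1 hdet fun i j h => h1 i j h.le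
    have h10 := sub_lowerPart_mem (g * L * g⁻¹)
    rw [h7]
    exact sub_mem (conj_mem_upperTri hg.1 hdet h4)
      (add_mem (mul_mem_upperTri h10 h9) (mul_mem_upperTri h9 h10))

theorem isSolution_add_fibre {a : BoundaryType} {U L : Matrix (Fin (2 * n)) (Fin (2 * n)) K}
    (hU : U ∈ strictUpperTri (2 * n) K) (hU' : U ∈ selfAdj (formMat n K) ((a.sign : ℤ) : K))
    (hUU : U * U = 0) (hL : L ∈ fibre (formMat n K) ((a.sign : ℤ) : K) U) :
    IsSolution a (U + L) ∧ lowerPart (U + L) = L := by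
  have h : lowerPart (U + L) = L := by
    rw [map_add, lowerPart_eq_zero_iff.2 fun i j h => hU i j h.le,
      lowerPart_eq_self_iff.2 hL.1.1, zero_add]
  refine ⟨isSolution_iff.2 ?_, h⟩
  rw [h, add_sub_cancel_right]
  exact ⟨hU, add_mem hU' hL.1.2, hUU, hL.2⟩

theorem upperPart_eq (hn : 0 < n) (x : Coord n → ℂ) :
    upperPart x = toMatrix x - lowerPart (toMatrix x) := by
  ext i j
  have hi := i.2
  have hj := j.2
  rw [upperPart, Matrix.of_apply, entry_eq hn, residue_add_one, residue_add_one, Matrix.sub_apply,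
    lowerPart_apply]
  by_cases h : j < i
  · have := Fin.lt_def.1 h
    rw [if_neg (by omega), if_pos h, sub_self]
  · have := Fin.le_def.1 (not_lt.1 h)
    rw [if_pos (by omega), if_neg h, sub_zero]
    rfl

theorem mem_zeroLocus_iff (hn : 0 < n) {a : BoundaryType} {x : Coord n → ℂ} :
    x ∈ zeroLocus ℂ (brauerIdeal a n) ↔ IsSolution a (toMatrix x) := by
  rw [← aeval_brauerIdeal_iff hn]
  rfl

/-- The points of the orbit stratum are the translates of the points with upper part `π_<`. -/
theorem mem_orbitStratum_iff (hn : 0 < n) {a : BoundaryType} (π : LinkPattern a n)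
    (x : Coord n → ℂ) : x ∈ orbitStratum π ↔
      ∃ g ∈ symplecticBorel (formMat n ℂ), ∃ L ∈ fibre (formMat n ℂ) ((a.sign : ℤ) : ℂ) π.chordData.U,
        toMatrix x = conjAct g (π.chordData.U + L) := by
  have hJ : IsUnit (formMat n ℂ).det := isUnit_det_formMat
  have hU1 := π.chordData.U_mem_strictUpperTri
  have hU2 : π.chordData.U ∈ selfAdj (formMat n ℂ) ((a.sign : ℤ) : ℂ) := π.chordData_U_mem
  constructor
  · rintro ⟨hx, B, ⟨hB1, hB2⟩, hBU⟩
    rw [mem_zeroLocus_iff hn] at hx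
    rw [upperPart_eq hn, ← π.chordData_U] at hBU
    rw [formJ_eq hn] at hB2
    obtain ⟨b, hb⟩ : ∃ b : Matrix (Fin (2 * n)) (Fin (2 * n)) ℂ, b = B := ⟨_, rfl⟩
    rw [Matrix.coe_units_inv] at hB2 hBU
    have hbdet : IsUnit b.det := by
      rw [hb]
      exact B.isUnit.map Matrix.detMonoidHom
    rw [← hb] at hB1 hB2 hBU
    have hbS : b ∈ symplecticBorel (formMat n ℂ) := by
      refine ⟨hB1, ?_⟩
      calc b.transpose * formMat n ℂ * b
          = (formMat n ℂ * (formMat n ℂ)⁻¹) * b.transpose * formMat n ℂ * b := by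
            rw [Matrix.mul_nonsing_inv _ hJ, one_mul]
        _ = formMat n ℂ * ((formMat n ℂ)⁻¹ * b.transpose * formMat n ℂ) * b := by
            simp only [mul_assoc]
        _ = formMat n ℂ := by
            rw [← hB2, mul_assoc, Matrix.nonsing_inv_mul _ hbdet, mul_one]
    have hb' := inv_mem_symplecticBorel hJ hbS
    have hbdet' := isUnit_det_of_symplectic hJ hb'
    have h1 := hx.conjAct hbS
    have h2 := conjAct_sub hB1 hbdet (toMatrix x)
    rw [hBU] at h2
    obtain ⟨-, h3, -, h4⟩ := isSolution_iff.1 h1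
    rw [h2] at h4
    refine ⟨b⁻¹, hb', lowerPart (conjAct b (toMatrix x)),
      ⟨⟨lowerPart_mem _, lowerPart_mem_selfAdj h3⟩, h4⟩, ?_⟩
    rw [← h2, sub_add_cancel, conjAct_conjAct hb'.1 hbdet' hB1 hbdet,
      Matrix.nonsing_inv_mul _ hbdet, conjAct_one]
  · rintro ⟨g, hg, L, hL, hx⟩
    obtain ⟨h1, h2⟩ := isSolution_add_fibre hU1 hU2 π.chordData.U_mul_U hL
    have hdet := isUnit_det_of_symplectic hJ hg
    have hg' := inv_mem_symplecticBorel hJ hg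
    obtain ⟨B, hB⟩ : ∃ B : GL (Fin (2 * n)) ℂ, (B : Matrix (Fin (2 * n)) (Fin (2 * n)) ℂ) = g⁻¹ :=
      ⟨(Matrix.GeneralLinearGroup.mkOfDetNeZero g hdet.ne_zero)⁻¹, by
        rw [Matrix.coe_units_inv]
        rfl⟩
    refine ⟨(mem_zeroLocus_iff hn).2 (hx ▸ h1.conjAct hg), B, ⟨?_, ?_⟩, ?_⟩
    · rw [hB]
      exact hg'.1
    · rw [Matrix.coe_units_inv, hB, formJ_eq hn]
      exact inv_eq_of_symplectic hJ hg'
    · rw [Matrix.coe_units_inv, hB, upperPart_eq hn, hx, conjAct_sub hg.1 hdet, h2,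
        add_sub_cancel_right, Matrix.nonsing_inv_nonsing_inv _ hdet, ← π.chordData_U]
      have e2 : g⁻¹ * g = 1 := Matrix.nonsing_inv_mul _ hdet
      calc g⁻¹ * (g * π.chordData.U * g⁻¹) * g = (g⁻¹ * g) * π.chordData.U * (g⁻¹ * g) := by
            simp only [mul_assoc]
        _ = _ := by rw [e2, one_mul, mul_one]

end ActionOnPoints

/-! ### Entire curves in the Borel group -/

section Curves
variable {N : ℕ}

/-- All the entries of the matrix valued function are entire functions. -/
def EntireEntries {m : ℕ} (A : ℂ → Matrix (Fin m) (Fin m) ℂ) : Prop :=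
  ∀ i j, Differentiable ℂ fun z => A z i j

namespace EntireEntries
variable {A B : ℂ → Matrix (Fin N) (Fin N) ℂ}

theorem const (M : Matrix (Fin N) (Fin N) ℂ) : EntireEntries fun _ => M :=
  fun i j => differentiable_const (M i j)

theorem add (hA : EntireEntries A) (hB : EntireEntries B) : EntireEntries fun z => A z + B z :=
  fun i j => (hA i j).add (hB i j)

theorem sub (hA : EntireEntries A) (hB : EntireEntries B) : EntireEntries fun z => A z - B z :=
  fun i j => (hA i j).sub (hB i j)

theorem smul {f : ℂ → ℂ} (hf : Differentiable ℂ f) (hA : EntireEntries A) :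
    EntireEntries fun z => f z • A z :=
  fun i j => hf.mul (hA i j)

theorem mul (hA : EntireEntries A) (hB : EntireEntries B) : EntireEntries fun z => A z * B z := by
  intro i j
  simp only [Matrix.mul_apply]
  exact Differentiable.fun_sum fun k _ => (hA i k).mul (hB k j)

theorem transpose (hA : EntireEntries A) : EntireEntries fun z => (A z).transpose :=
  fun i j => hA j i

theorem lowerPart (hA : EntireEntries A) : EntireEntries fun z => lowerPart (A z) := by
  intro i j
  simp only [lowerPart_apply]
  split_ifs
  · exact hA i j
  · exact differentiable_const 0

theorem pow (hA : EntireEntries A) (k : ℕ) : EntireEntries fun z => A z ^ k := by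
  induction k with
  | zero =>
    simp only [pow_zero]
    exact const 1
  | succ k ih =>
    simp only [pow_succ]
    exact ih.mul hA

theorem geom_sum (hA : EntireEntries A) (k : ℕ) :
    EntireEntries fun z => ∑ i ∈ Finset.range k, A z ^ i := by
  induction k with
  | zero =>
    simp only [Finset.range_zero, Finset.sum_empty]
    exact const 0
  | succ k ih =>
    simp only [Finset.sum_range_succ]
    exact ih.add (hA.pow k)

theorem conjAct {J : Matrix (Fin N) (Fin N) ℂ} (hJ : IsUnit J.det)
    (hA : EntireEntries A) (hAJ : ∀ z, A z ∈ symplecticBorel J) (hB : EntireEntries B) :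
    EntireEntries fun z => conjAct (A z) (B z) := by
  have h : EntireEntries fun z => (A z)⁻¹ := by
    simp only [fun z => inv_eq_of_symplectic hJ (hAJ z)]
    exact ((const _).mul hA.transpose).mul (const _)
  exact ((hA.mul (hB.sub hB.lowerPart)).mul h).add ((hA.mul hB.lowerPart).mul h).lowerPart

end EntireEntries

theorem differentiable_eval {σ : Type*} {γ : ℂ → σ → ℂ} (hγ : ∀ c, Differentiable ℂ fun z => γ z c)
    (p : MvPolynomial σ ℂ) : Differentiable ℂ fun z => eval (γ z) p := by
  induction p using MvPolynomial.induction_on with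
  | C r =>
    simp only [eval_C]
    exact differentiable_const r
  | add p q hp hq =>
    simp only [map_add]
    exact hp.add hq
  | mul_X p c hp =>
    simp only [map_mul, eval_X]
    exact hp.mul (hγ c)

/-- The vanishing ideal of a set whose points can be joined by entire curves is prime. -/
theorem isPrime_vanishingIdeal {σ : Type*} {F : Set (σ → ℂ)} (hF : F.Nonempty)
    (h : ∀ x ∈ F, ∀ y ∈ F, ∃ γ : ℂ → σ → ℂ, (∀ c, Differentiable ℂ fun z => γ z c) ∧
      (∀ z, γ z ∈ F) ∧ γ 0 = x ∧ γ 1 = y) : (vanishingIdeal ℂ F).IsPrime := by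
  refine ⟨?_, ?_⟩
  · obtain ⟨x, hx⟩ := hF
    rw [Ne, Ideal.eq_top_iff_one]
    intro h1
    have := h1 x hx
    simp at this
  · intro f g hfg
    by_contra hcon
    push Not at hcon
    obtain ⟨hf, hg⟩ := hcon
    simp only [mem_vanishingIdeal_iff, not_forall] at hf hg
    obtain ⟨x, hx, hfx⟩ := hf
    obtain ⟨y, hy, hgy⟩ := hg
    obtain ⟨γ, hγ, hγF, rfl, rfl⟩ := h x hx y hy
    -- Along the curve both polynomials are entire functions with product zero, so one of them is
    -- identically zero.
    have h1 : AnalyticOnNhd ℂ (fun z => eval (γ z) f) Set.univ :=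
      (differentiable_eval hγ f).differentiableOn.analyticOnNhd isOpen_univ
    have h2 : AnalyticOnNhd ℂ (fun z => eval (γ z) g) Set.univ :=
      (differentiable_eval hγ g).differentiableOn.analyticOnNhd isOpen_univ
    rcases AnalyticOnNhd.eq_zero_or_eq_zero_of_mul_eq_zero h1 h2 (by
      intro z _
      have := hfg _ (hγF z)
      rwa [map_mul] at this) isPreconnected_univ with h3 | h3
    · exact hfx (h3 0 (Set.mem_univ _))
    · exact hgy (h3 1 (Set.mem_univ _))

/-- Cayley transform. The matrix Y = (C - 1)(C + 1)⁻¹ is nilpotent and anti-self-adjoint, and the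
curve is (1 + zY)(1 - zY)⁻¹. Nilpotency makes the inverse a finite geometric sum, so the curve has
no poles. -/
theorem exists_entire_unipotent {J C : Matrix (Fin N) (Fin N) ℂ}
    (hC : C ∈ symplecticBorel J) (hC1 : ∀ i, C i i = 1) :
    ∃ β : ℂ → Matrix (Fin N) (Fin N) ℂ, EntireEntries β ∧ (∀ z, β z ∈ symplecticBorel J) ∧
      β 0 = 1 ∧ β 1 = C := by
  have hS : C + 1 ∈ upperTri N ℂ := add_mem hC.1 one_mem_upperTri
  have hSdet : IsUnit (C + 1).det := isUnit_det_of_upperTri hS fun i => by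
    rw [Matrix.add_apply, hC1, Matrix.one_apply_eq]
    norm_num
  obtain ⟨T, hT⟩ : ∃ T, T = (C + 1)⁻¹ := ⟨_, rfl⟩
  have hST : (C + 1) * T = 1 := hT ▸ Matrix.mul_nonsing_inv _ hSdet
  have hTS : T * (C + 1) = 1 := hT ▸ Matrix.nonsing_inv_mul _ hSdet
  have hTu : T ∈ upperTri N ℂ := hT ▸ inv_mem_upperTri hS hSdet
  have hC0 : C - 1 ∈ strictUpperTri N ℂ := by
    intro i j h
    rcases h.lt_or_eq with h | rfl
    · rw [Matrix.sub_apply, hC.1 i j h, Matrix.one_apply_ne h.ne', sub_zero]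
    · rw [Matrix.sub_apply, hC1, Matrix.one_apply_eq, sub_self]
  obtain ⟨Y, hY⟩ : ∃ Y, Y = (C - 1) * T := ⟨_, rfl⟩
  have hYu : Y ∈ strictUpperTri N ℂ := hY ▸ mul_mem_strictUpperTri_right hC0 hTu
  have hYJ : Y.transpose * J = -(J * Y) := by
    have e1 : (C - 1).transpose * J * (C + 1) = -((C + 1).transpose * J * (C - 1)) := by
      simp only [Matrix.transpose_sub, Matrix.transpose_add, Matrix.transpose_one, sub_mul, add_mul,
        mul_sub, mul_add, mul_one, one_mul, hC.2]
      abel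
    have e2 : T.transpose * (C + 1).transpose = 1 := by
      rw [← Matrix.transpose_mul, hST, Matrix.transpose_one]
    calc Y.transpose * J = T.transpose * ((C - 1).transpose * J * ((C + 1) * T)) := by
          rw [hST, hY, Matrix.transpose_mul, mul_one, mul_assoc]
      _ = T.transpose * ((C - 1).transpose * J * (C + 1)) * T := by simp only [mul_assoc]
      _ = -((T.transpose * (C + 1).transpose) * J * ((C - 1) * T)) := by
          rw [e1, mul_neg, neg_mul]
          simp only [mul_assoc]
      _ = _ := by rw [e2, one_mul, hY]
  let G : ℂ → Matrix (Fin N) (Fin N) ℂ := fun z => ∑ i ∈ Finset.range N, (z • Y) ^ i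
  have hnil : ∀ z : ℂ, (z • Y) ^ N = 0 := fun z =>
    pow_eq_zero_of_strictUpperTri (Submodule.smul_mem _ z hYu)
  have hPG : ∀ z, (1 - z • Y) * G z = 1 := fun z => by
    rw [mul_neg_geom_sum, hnil, sub_zero]
  have hGP : ∀ z, G z * (1 - z • Y) = 1 := fun z => by
    rw [geom_sum_mul_neg, hnil, sub_zero]
  have hzY : EntireEntries fun z => z • Y := EntireEntries.smul differentiable_id (.const Y)
  have hYu' : Y ∈ upperTri N ℂ := fun i j h => hYu i j h.le
  refine ⟨fun z => (1 + z • Y) * G z, ((EntireEntries.const 1).add hzY).mul (hzY.geom_sum N),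
    fun z => ⟨?_, ?_⟩, ?_, ?_⟩
  · have h1 : G z = (1 - z • Y)⁻¹ := (Matrix.inv_eq_right_inv (hPG z)).symm
    simp only [h1]
    exact mul_mem_upperTri (add_mem one_mem_upperTri (Submodule.smul_mem _ z hYu'))
      (inv_mem_upperTri (sub_mem one_mem_upperTri (Submodule.smul_mem _ z hYu'))
        (Matrix.isUnit_det_of_right_inverse (hPG z)))
  · have e1 : (1 + z • Y).transpose * J = J * (1 - z • Y) := by
      rw [Matrix.transpose_add, Matrix.transpose_smul, Matrix.transpose_one, add_mul, mul_sub, one_mul,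
        mul_one, smul_mul_assoc, mul_smul_comm, hYJ, smul_neg, sub_eq_add_neg]
    have e2 : J * (1 + z • Y) = (1 - z • Y).transpose * J := by
      simp [Matrix.transpose_sub, Matrix.transpose_smul, sub_mul, mul_add, hYJ]
    have e3 : (1 - z • Y) * (1 + z • Y) = (1 + z • Y) * (1 - z • Y) := by
      simp only [sub_mul, add_mul, mul_sub, mul_add, mul_one, one_mul]
      abel
    calc ((1 + z • Y) * G z).transpose * J * ((1 + z • Y) * G z)
        = (G z).transpose * ((1 + z • Y).transpose * J) * (1 + z • Y) * G z := by
          rw [Matrix.transpose_mul]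
          simp only [mul_assoc]
      _ = (G z).transpose * J * ((1 - z • Y) * (1 + z • Y)) * G z := by
          rw [e1]
          simp only [mul_assoc]
      _ = (G z).transpose * (J * (1 + z • Y)) * ((1 - z • Y) * G z) := by
          rw [e3]
          simp only [mul_assoc]
      _ = ((1 - z • Y) * G z).transpose * J := by
          rw [e2, hPG, mul_one, ← mul_assoc, ← Matrix.transpose_mul, hPG]
      _ = J := by rw [hPG, Matrix.transpose_one, one_mul]
  · have h := hPG 0
    simp only [zero_smul, sub_zero, one_mul] at h
    simp only [zero_smul, add_zero, one_mul, h]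
  · have h := hPG 1
    rw [one_smul] at h
    simp only [one_smul]
    have e1 : (1 - Y) * (C + 1) = (1 + 1 : ℂ) • (1 : Matrix (Fin N) (Fin N) ℂ) := by
      rw [sub_mul, hY, mul_assoc, hTS, one_mul, mul_one, add_smul, one_smul]
      abel
    have e2 : (1 + Y) * (C + 1) = (1 + 1 : ℂ) • C := by
      rw [add_mul, hY, mul_assoc, hTS, one_mul, mul_one, add_smul, one_smul]
      abel
    have e3 : C + 1 = (1 + 1 : ℂ) • G 1 := by
      have h' := hGP 1
      rw [one_smul] at h'
      calc C + 1 = G 1 * (1 - Y) * (C + 1) := by rw [h', one_mul]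
        _ = _ := by rw [mul_assoc, e1, Matrix.mul_smul, mul_one]
    have e4 : (1 + 1 : ℂ) • ((1 + Y) * G 1) = (1 + 1 : ℂ) • C := by
      rw [← e2, e3, Matrix.mul_smul]
    exact smul_right_injective _ (by norm_num : (1 + 1 : ℂ) ≠ 0) e4

theorem ChordData.diag_mul_diag_rev (D : ChordData N ℂ) {B : Matrix (Fin N) (Fin N) ℂ}
    (hB : B ∈ symplecticBorel D.J) (k : Fin N) : B k k * B k.rev k.rev = 1 := by
  have h := congrFun (congrFun hB.2 k) k.rev
  rw [mul_assoc, Matrix.mul_apply, Finset.sum_eq_single k, Matrix.transpose_apply, Matrix.mul_apply,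
    Finset.sum_eq_single k.rev] at h
  · have h1 := D.J_ne k
    refine mul_right_cancel₀ h1 ?_
    rw [one_mul]
    linear_combination h
  · intro l _ hl
    rw [D.J_eq_zero k l hl, zero_mul]
  · simp
  · intro l _ hl
    rw [Matrix.transpose_apply]
    rcases lt_or_gt_of_ne hl with hlk | hlk
    · rw [Matrix.mul_apply, Finset.sum_eq_single l.rev, hB.1 l.rev k.rev (Fin.rev_lt_rev.2 hlk),
        mul_zero, mul_zero]
      · intro m _ hm
        rw [D.J_eq_zero l m hm, zero_mul]
      · simp
    · rw [hB.1 l k hlk, zero_mul]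
  · simp

theorem ChordData.rev_ne_self (D : ChordData N ℂ) (k : Fin N) : k.rev ≠ k := by
  intro h
  have h1 := D.J_rev k
  have h2 := D.J_ne k
  rw [h] at h1 h2
  exact h2 (self_eq_neg.1 h1)

/-- Factor `B` as a diagonal matrix times a unipotent one. The diagonal part is joined to 1 by
exponentials, the unipotent part by the Cayley curve. -/
theorem ChordData.exists_entire_symplecticBorel (D : ChordData N ℂ)
    {B : Matrix (Fin N) (Fin N) ℂ} (hB : B ∈ symplecticBorel D.J) :
    ∃ β : ℂ → Matrix (Fin N) (Fin N) ℂ, EntireEntries β ∧ (∀ z, β z ∈ symplecticBorel D.J) ∧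
      β 0 = 1 ∧ β 1 = B := by
  have hdet := isUnit_det_of_symplectic D.isUnit_det_J hB
  have hne := diag_ne_zero_of_upperTri hB.1 hdet
  have hdd := D.diag_mul_diag_rev hB
  -- Logarithms chosen on the first half only and extended with opposite sign, so that the diagonal
  -- curve stays symplectic.
  let t : Fin N → ℂ := fun k =>
    if k < k.rev then Complex.log (B k k) else -Complex.log (B k.rev k.rev)
  have ht1 : ∀ k, Complex.exp (t k) = B k k := by
    intro k
    by_cases h : k < k.rev
    · simp only [t, if_pos h, Complex.exp_log (hne k)]
    · simp only [t, if_neg h, Complex.exp_neg, Complex.exp_log (hne k.rev)]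
      exact (eq_inv_of_mul_eq_one_left (hdd k)).symm
  have ht2 : ∀ k, t k + t k.rev = 0 := by
    intro k
    by_cases h : k < k.rev
    · simp [t, if_pos h, if_neg h.not_gt, Fin.rev_rev]
    · have h' : k.rev < k := lt_of_le_of_ne (not_lt.1 h) (D.rev_ne_self k)
      simp [t, if_neg h, Fin.rev_rev, h']
  let E : ℂ → Matrix (Fin N) (Fin N) ℂ := fun z => Matrix.diagonal fun k => Complex.exp (z * t k)
  have hE : EntireEntries E := by
    intro i j
    simp only [E, Matrix.diagonal_apply]
    split_ifs
    · fun_prop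
    · exact differentiable_const 0
  have hEJ : ∀ z, E z ∈ symplecticBorel D.J := by
    intro z
    refine ⟨fun i j h => Matrix.diagonal_apply_ne _ h.ne', ?_⟩
    ext i j
    rw [Matrix.diagonal_transpose, Matrix.mul_diagonal, Matrix.diagonal_mul]
    by_cases h : j = i.rev
    · subst h
      rw [mul_right_comm, ← Complex.exp_add, ← mul_add, ht2, mul_zero, Complex.exp_zero, one_mul]
    · rw [D.J_eq_zero i j h, mul_zero, zero_mul]
  have hE1 : IsUnit (E 1).det := isUnit_det_of_symplectic D.isUnit_det_J (hEJ 1)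
  have hC := mul_mem_symplecticBorel (inv_mem_symplecticBorel D.isUnit_det_J (hEJ 1)) hB
  have hC1 : ∀ i, ((E 1)⁻¹ * B) i i = 1 := by
    intro i
    have h : E 1 * ((E 1)⁻¹ * B) = B := by
      rw [← mul_assoc, Matrix.mul_nonsing_inv _ hE1, one_mul]
    have h2 := congrFun (congrFun h i) i
    rw [Matrix.diagonal_mul, one_mul, ht1] at h2
    exact mul_left_cancel₀ (hne i) (h2.trans (mul_one _).symm)
  obtain ⟨β, hβ, hβJ, hβ0, hβ1⟩ := exists_entire_unipotent hC hC1
  refine ⟨fun z => E z * β z, hE.mul hβ, fun z => mul_mem_symplecticBorel (hEJ z) (hβJ z), ?_, ?_⟩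
  · have : E 0 = 1 := by simp [E]
    simp only [hβ0, this, mul_one]
  · simp only [hβ1]
    rw [← mul_assoc, Matrix.mul_nonsing_inv _ hE1, one_mul]

end Curves

/-! ### Irreducibility of the closure of a stratum -/

section Irreducible
variable {n : ℕ} {a : BoundaryType} (π : LinkPattern a n)

theorem LinkPattern.lowerU_mem_fibre :
    π.chordData.lowerU ∈ fibre (formMat n ℂ) ((a.sign : ℤ) : ℂ) π.chordData.U :=
  ⟨⟨π.chordData.lowerU_mem_strictLowerTri,
    π.chordData.lowerU_mem_selfAdj (sign_mul_self a) π.chordData_U_mem⟩,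
    π.chordData.anti_lowerU_upper⟩

theorem exists_toMatrix_eq (M : Matrix (Fin (2 * n)) (Fin (2 * n)) ℂ) :
    ∃ x : Coord n → ℂ, toMatrix x = M := (toMatrixEquiv n ℂ).surjective M

theorem LinkPattern.exists_mem_orbitStratum (hn : 0 < n) :
    ∃ x ∈ orbitStratum π, toMatrix x = π.chordData.U + π.chordData.lowerU := by
  obtain ⟨x, hx⟩ := exists_toMatrix_eq (π.chordData.U + π.chordData.lowerU)
  refine ⟨x, (mem_orbitStratum_iff hn π x).2 ⟨1, one_mem_symplecticBorel, _, π.lowerU_mem_fibre, ?_⟩,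
    hx⟩
  rw [hx, conjAct_one]

/-- The stratum is the image of the Borel group times the linear fibre. Two points are joined by an
entire curve in the group and a line in the fibre. -/
theorem LinkPattern.isPrime_componentIdeal (hn : 0 < n) : (componentIdeal π).IsPrime := by
  have hJ : IsUnit (formMat n ℂ).det := isUnit_det_formMat
  obtain ⟨x₀, hx₀, -⟩ := π.exists_mem_orbitStratum hn
  refine isPrime_vanishingIdeal ⟨x₀, hx₀⟩ fun x hx y hy => ?_
  obtain ⟨g, hg, L, hL, hgx⟩ := (mem_orbitStratum_iff hn π x).1 hx
  obtain ⟨h, hh, L', hL', hhy⟩ := (mem_orbitStratum_iff hn π y).1 hy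
  obtain ⟨β, hβ, hβJ, hβ0, hβ1⟩ := (formChord n ℂ).exists_entire_symplecticBorel
    (mul_mem_symplecticBorel hh (inv_mem_symplecticBorel hJ hg))
  have hb : ∀ z, β z * g ∈ symplecticBorel (formMat n ℂ) := fun z =>
    mul_mem_symplecticBorel (hβJ z) hg
  have hM : EntireEntries fun z => conjAct (β z * g) (π.chordData.U + (L + z • (L' - L))) :=
    EntireEntries.conjAct hJ (hβ.mul (.const g)) hb
      ((EntireEntries.const _).add ((EntireEntries.const L).add
        (EntireEntries.smul differentiable_id (.const (L' - L)))))
  have hinj : Function.Injective fun x : Coord n → ℂ => toMatrix x := (toMatrixEquiv n ℂ).injective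
  choose γ hγ using fun z => exists_toMatrix_eq (conjAct (β z * g) (π.chordData.U + (L + z • (L' - L))))
  refine ⟨γ, ?_, fun z => (mem_orbitStratum_iff hn π _).2 ⟨_, hb z, _, ?_, hγ z⟩, hinj ?_, hinj ?_⟩
  · rintro ⟨i, j⟩
    have := hM i j
    simp only [← hγ] at this
    exact this
  · exact add_mem hL (Submodule.smul_mem _ z (sub_mem hL' hL))
  · simp only [hγ, hβ0, hgx, one_mul, zero_smul, add_zero]
  · have hgdet := isUnit_det_of_symplectic hJ hg
    simp only [hγ, hβ1, hhy, one_smul]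
    rw [mul_assoc, Matrix.nonsing_inv_mul _ hgdet, mul_one, add_sub_cancel]

end Irreducible

/-! ### Dimension from below by the rank of a derivative -/

section Dominant

/-- The derivative at `0` of the orbit map, in a Banach algebra. -/
theorem hasStrictFDerivAt_orbitMap {A : Type*} [NormedRing A] [NormedAlgebra ℂ A] [CompleteSpace A]
    (u : A) (low : A →L[ℂ] A) : ∃ f' : A × A →L[ℂ] A,
      HasStrictFDerivAt (fun e : A × A => NormedSpace.exp e.1 * u * NormedSpace.exp (-e.1) +
        low (NormedSpace.exp e.1 * e.2 * NormedSpace.exp (-e.1))) f' 0 ∧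
      ∀ e, f' e = e.1 * u - u * e.1 + low e.2 := by
  have h0 : HasStrictFDerivAt (NormedSpace.exp : A → A) (1 : A →L[ℂ] A) 0 :=
    hasStrictFDerivAt_exp_zero
  have h1 : HasStrictFDerivAt (fun e : A × A => NormedSpace.exp e.1)
      ((1 : A →L[ℂ] A).comp (ContinuousLinearMap.fst ℂ A A)) 0 :=
    HasStrictFDerivAt.comp (g := (NormedSpace.exp : A → A)) 0 h0 hasStrictFDerivAt_fst
  have h2 : HasStrictFDerivAt (fun e : A × A => NormedSpace.exp (-e.1))
      ((1 : A →L[ℂ] A).comp (-(ContinuousLinearMap.fst ℂ A A))) 0 :=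
    HasStrictFDerivAt.comp (g := (NormedSpace.exp : A → A)) 0 (by simpa using h0)
      hasStrictFDerivAt_fst.neg
  have h3 : HasStrictFDerivAt (fun e : A × A => e.2) (ContinuousLinearMap.snd ℂ A A) 0 :=
    hasStrictFDerivAt_snd
  have h4 := ((h1.fun_mul' (hasStrictFDerivAt_const u 0)).fun_mul' h2).fun_add
    (low.hasStrictFDerivAt.comp 0 ((h1.fun_mul' h3).fun_mul' h2))
  refine ⟨_, h4, fun e => ?_⟩
  simp [sub_eq_neg_add]

/-- Compose with a linear projection onto as many coordinates as the rank. The image is then a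
neighbourhood of a point, so a polynomial relation among these linear forms on `F` vanishes on a
ball and is zero. The forms are algebraically independent in the coordinate ring. -/
theorem exists_finrank_range_le {σ : Type*} [Fintype σ] {F : Set (σ → ℂ)}
    (hprime : (vanishingIdeal ℂ F).IsPrime) {E : Type*} [NormedAddCommGroup E] [NormedSpace ℂ E]
    [CompleteSpace E] {φ : E → σ → ℂ} {φ' : E →L[ℂ] σ → ℂ} {e₀ : E}
    (hφ : HasStrictFDerivAt φ φ' e₀) (hF : ∀ e, φ e ∈ F) :
    ((Module.finrank ℂ φ'.range : ℕ) : WithBot ℕ∞) ≤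
      ringKrullDim (MvPolynomial σ ℂ ⧸ vanishingIdeal ℂ F) := by
  classical
  obtain ⟨d, hd⟩ : ∃ d, d = Module.finrank ℂ φ'.range := ⟨_, rfl⟩
  let ψ : φ'.range ≃ₗ[ℂ] (Fin d → ℂ) := LinearEquiv.ofFinrankEq _ _ (by simp [hd])
  obtain ⟨l, hl⟩ := LinearMap.exists_extend (ψ : φ'.range →ₗ[ℂ] (Fin d → ℂ))
  let L : (σ → ℂ) →L[ℂ] (Fin d → ℂ) := LinearMap.toContinuousLinearMap l
  have h1 : HasStrictFDerivAt (fun e => L (φ e)) (L.comp φ') e₀ := L.hasStrictFDerivAt.comp e₀ hφ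
  have h2 : (L.comp φ').range = ⊤ := by
    rw [LinearMap.range_eq_top]
    intro v
    obtain ⟨⟨w, hw'⟩, hw⟩ := ψ.surjective v
    obtain ⟨e, he⟩ := id hw'
    have h3 : l w = ψ ⟨w, hw'⟩ := congrArg (fun f => f ⟨w, hw'⟩) hl
    exact ⟨e, (congrArg l he).trans (h3.trans hw)⟩
  have h3 := h1.map_nhds_eq_of_surj h2
  let h : MvPolynomial (Fin d) ℂ →ₐ[ℂ] MvPolynomial σ ℂ :=
    aeval fun i => ∑ c, C (l (Pi.single c 1) i) * X c
  have hh : ∀ x p, eval x (h p) = eval (l x) p := by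
    intro x p
    have e1 : (eval x).comp (h : MvPolynomial (Fin d) ℂ →+* MvPolynomial σ ℂ) = eval (l x) := by
      refine MvPolynomial.ringHom_ext (fun r => ?_) fun i => ?_
      · simp [h]
      · simp only [h, RingHom.comp_apply, RingHom.coe_coe, aeval_X, map_sum, map_mul, eval_C, eval_X]
        conv_rhs => rw [← Finset.univ_sum_single x]
        rw [map_sum, Finset.sum_apply]
        refine Finset.sum_congr rfl fun c _ => ?_
        have : Pi.single c (x c) = x c • (Pi.single c 1 : σ → ℂ) := by
          rw [← Pi.single_smul, smul_eq_mul, mul_one]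
        rw [this, map_smul, Pi.smul_apply, smul_eq_mul, mul_comm]
    exact congrArg (fun f => f p) e1
  obtain ⟨s, hs1, hs2, -⟩ := exists_submodule_derivations _
    (FractionRing (MvPolynomial σ ℂ ⧸ vanishingIdeal ℂ F))
    (Ideal.Quotient.mkₐ ℂ (vanishingIdeal ℂ F)) (Ideal.Quotient.mkₐ_surjective ℂ _)
  rw [hs1, ← hd]
  refine Nat.cast_le.2 (hs2 d ((Ideal.Quotient.mkₐ ℂ (vanishingIdeal ℂ F)).comp h) ?_)
  rw [injective_iff_map_eq_zero]
  intro p hp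
  have hp' : h p ∈ vanishingIdeal ℂ F := Ideal.Quotient.eq_zero_iff_mem.1 hp
  have h4 : ∀ᶠ v in nhds (L (φ e₀)), eval v p = 0 := by
    rw [← h3, Filter.eventually_map]
    refine Filter.Eventually.of_forall fun e => ?_
    have : eval (φ e) (h p) = 0 := hp' _ (hF e)
    rwa [hh] at this
  obtain ⟨t, ht, hball⟩ := Metric.eventually_nhds_iff_ball.1 h4
  refine MvPolynomial.funext_set (fun i => Metric.ball (L (φ e₀) i) t) (fun i => ?_) fun v hv => ?_
  · exact infinite_of_mem_nhds (L (φ e₀) i) (Metric.ball_mem_nhds _ ht)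
  · rw [map_zero]
    refine hball v ?_
    rw [ball_pi _ ht]
    exact hv

end Dominant

/-! ### The orbit map of a link pattern -/

section OrbitMap
variable {N : ℕ}

theorem exp_mem_symplecticBorel {J X : Matrix (Fin N) (Fin N) ℂ} (hJ : IsUnit J.det)
    (hX : X ∈ borelLie J) : NormedSpace.exp X ∈ symplecticBorel J := by
  have hX2 : X.transpose * J = (-1 : ℂ) • (J * X) := hX.2
  have h1 : X.transpose = J * (-X) * J⁻¹ := by
    rw [mul_neg, ← neg_one_smul ℂ (J * X), ← hX2, mul_assoc, Matrix.mul_nonsing_inv _ hJ, mul_one]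
  have h2 : IsUnit (NormedSpace.exp X).det := (Matrix.isUnit_iff_isUnit_det _).1 (Matrix.isUnit_exp X)
  refine ⟨Matrix.BlockTriangular.exp (b := id) hX.1, ?_⟩
  rw [← Matrix.exp_transpose, h1, Matrix.exp_conj _ _ ((Matrix.isUnit_iff_isUnit_det _).2 hJ),
    Matrix.exp_neg, mul_assoc, mul_assoc, mul_assoc, ← mul_assoc J⁻¹, Matrix.nonsing_inv_mul _ hJ,
    one_mul, Matrix.nonsing_inv_mul _ h2, mul_one]

-- The derivative at 0 of (X, L) ↦ exp(X)·(U, L) is (X, L) ↦ [X, U] + L. The first term is upper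
-- triangular and the second strictly lower triangular, so the dimensions of the two images add up.
open scoped Matrix.Norms.Operator in
theorem LinkPattern.le_ringKrullDim {n : ℕ} (hn : 0 < n) {a : BoundaryType} (π : LinkPattern a n) :
    ((Module.finrank ℂ (orbitTangent π.chordData.J π.chordData.U) +
        Module.finrank ℂ (fibre π.chordData.J ((a.sign : ℤ) : ℂ) π.chordData.U) : ℕ) :
          WithBot ℕ∞) ≤
      ringKrullDim (MvPolynomial (Coord n) ℂ ⧸ componentIdeal π) := by
  obtain ⟨U, hU⟩ : ∃ U, U = π.chordData.U := ⟨_, rfl⟩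
  have hUu : U ∈ strictUpperTri (2 * n) ℂ := hU ▸ π.chordData.U_mem_strictUpperTri
  have hUu' : U ∈ upperTri (2 * n) ℂ := fun i j h => hUu i j h.le
  have hF := mem_orbitStratum_iff hn π
  change ((Module.finrank ℂ (orbitTangent (formMat n ℂ) π.chordData.U) +
    Module.finrank ℂ (fibre (formMat n ℂ) ((a.sign : ℤ) : ℂ) π.chordData.U) : ℕ) :
          WithBot ℕ∞) ≤ _
  rw [← hU] at hF ⊢
  let low : Matrix (Fin (2 * n)) (Fin (2 * n)) ℂ →L[ℂ] Matrix (Fin (2 * n)) (Fin (2 * n)) ℂ :=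
    LinearMap.toContinuousLinearMap lowerPart
  obtain ⟨f', hf', hf'e⟩ := hasStrictFDerivAt_orbitMap U low
  let P := borelLie (formMat n ℂ)
  let Q := fibre (formMat n ℂ) ((a.sign : ℤ) : ℂ) U
  let ι : P × Q →L[ℂ] Matrix (Fin (2 * n)) (Fin (2 * n)) ℂ × Matrix (Fin (2 * n)) (Fin (2 * n)) ℂ :=
    P.subtypeL.prodMap Q.subtypeL
  let T : Matrix (Fin (2 * n)) (Fin (2 * n)) ℂ →L[ℂ] (Coord n → ℂ) :=
    LinearMap.toContinuousLinearMap (toMatrixEquiv n ℂ).symm.toLinearMap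
  have h1 := T.hasStrictFDerivAt.comp (0 : P × Q)
    (HasStrictFDerivAt.comp (f := ι) (0 : P × Q) (by rw [map_zero]; exact hf') ι.hasStrictFDerivAt)
  have h2 := exists_finrank_range_le (π.isPrime_componentIdeal hn) h1 ?_
  · refine le_trans (Nat.cast_le.2 ?_) h2
    have h3 : orbitTangent (formMat n ℂ) U ⊓ Q = ⊥ := by
      rw [eq_bot_iff]
      rintro _ ⟨⟨X, hX, rfl⟩, hY⟩
      have hXu : adMap U X ∈ upperTri (2 * n) ℂ :=
        sub_mem (mul_mem_upperTri hX.1 hUu') (mul_mem_upperTri hUu' hX.1)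
      rw [Submodule.mem_bot, ← lowerPart_eq_self_iff.2 hY.1.1, lowerPart_eq_zero_iff]
      exact hXu
    have h4 := Submodule.finrank_sup_add_finrank_inf_eq (orbitTangent (formMat n ℂ) U) Q
    rw [h3, finrank_bot, add_zero] at h4
    rw [← h4, ← (toMatrixEquiv n ℂ).symm.finrank_map_eq]
    refine Submodule.finrank_mono ?_
    rw [Submodule.map_le_iff_le_comap]
    refine sup_le ?_ ?_
    · rintro _ ⟨X, hX, rfl⟩
      refine ⟨(⟨X, hX⟩, 0), congrArg (toMatrixEquiv n ℂ).symm ((hf'e (X, 0)).trans ?_)⟩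
      change X * U - U * X + lowerPart 0 = X * U - U * X
      rw [map_zero, add_zero]
    · intro L hL
      refine ⟨(0, ⟨L, hL⟩), congrArg (toMatrixEquiv n ℂ).symm ((hf'e (0, L)).trans ?_)⟩
      change (0 : Matrix (Fin (2 * n)) (Fin (2 * n)) ℂ) * U - U * 0 + lowerPart L = L
      rw [zero_mul, mul_zero, sub_zero, zero_add]
      exact lowerPart_eq_self_iff.2 hL.1.1
  · rintro ⟨⟨X, hX⟩, ⟨L, hL⟩⟩
    refine (hF _).2 ⟨NormedSpace.exp X, exp_mem_symplecticBorel isUnit_det_formMat hX, L, hL, ?_⟩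
    have h3 : lowerPart (U + L) = L := by
      rw [map_add, lowerPart_eq_zero_iff.2 hUu', lowerPart_eq_self_iff.2 hL.1.1, zero_add]
    rw [conjAct, h3, add_sub_cancel_right, ← Matrix.exp_neg]
    exact (toMatrixEquiv n ℂ).apply_symm_apply _

end OrbitMap
end
end BrauerLoop

/-- For every link pattern `π`, the variety `E^a_π` is a top-dimensional irreducible component of
the scheme `E^a_N`, `N = 2n`, this scheme is generically reduced along it, and at a generic point
of `E^a_π` the Zariski tangent space of `E^a_N` has the dimension of `E^a_π`. -/
theorem mainTheorem5 (a : BrauerLoop.BoundaryType) (n : ℕ) (hn : 0 < n)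
    (π : BrauerLoop.LinkPattern a n) :
    BrauerLoop.componentIdeal π ∈ (BrauerLoop.brauerIdeal a n).minimalPrimes ∧
    ringKrullDim (MvPolynomial (BrauerLoop.Coord n) ℂ ⧸ BrauerLoop.componentIdeal π) =
      ringKrullDim (MvPolynomial (BrauerLoop.Coord n) ℂ ⧸ BrauerLoop.brauerIdeal a n) ∧
    BrauerLoop.GenericallyReducedAlong (BrauerLoop.brauerIdeal a n)
      (BrauerLoop.componentIdeal π) ∧
    ∃ f : MvPolynomial (BrauerLoop.Coord n) ℂ, f ∉ BrauerLoop.componentIdeal π ∧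
      ∀ x ∈ MvPolynomial.zeroLocus ℂ (BrauerLoop.componentIdeal π),
        MvPolynomial.eval x f ≠ 0 →
        ((Module.finrank ℂ (BrauerLoop.tangentSpace (BrauerLoop.brauerIdeal a n) x) : ℕ) :
            WithBot ℕ∞) =
          ringKrullDim (MvPolynomial (BrauerLoop.Coord n) ℂ ⧸ BrauerLoop.componentIdeal π) := by
  have hne : ∀ k : Fin (2 * n), k < k.rev → π.periodic k ≠ k →
      π.periodic k < (π.periodic k).rev ∨ π.periodic k = k.rev := fun k hk _ => π.periodic_link k hk
  obtain ⟨x₀, hx₀, hx₀'⟩ := π.exists_mem_orbitStratum hn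
  refine BrauerLoop.component_criterion (BrauerLoop.brauerIdeal a n) (BrauerLoop.orbitStratum π)
    (fun x hx => hx.1) (π.isPrime_componentIdeal hn) _ (π.le_ringKrullDim hn) (fun Q hQ hIQ => ?_)
    x₀ hx₀ ?_
  · exact BrauerLoop.ringKrullDim_le hn π.chordData π.chordData_U_mem π.periodic_ne_self
      π.eq_of_periodic_eq_self hne Q hQ hIQ
  · exact BrauerLoop.finrank_tangentSpace_le hn π.chordData rfl π.chordData_U_mem hne
      (fun V hV k l => π.chordData.apply_single_eq_zero a π.periodic_ne_self
        π.eq_of_periodic_eq_self hV k l) hx₀' hx₀.1
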